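/- **Model.** A wiretap channel with a helping interferer (WTC-HI) is a memoryless channel $P_{Y_1,Y_2|X_1,X_2}$; the alphabets are arbitrary (non-empty) standard Borel spaces. An $(M,n)$ code consists of a stochastic encoder of the message $W$, uniform on $\{1,\dots,M\}$, into $X_1^n$, a random helper input $X_2^n$ independent of $(W,X_1^n)$, and a deterministic decoder $\phi$ of $Y_1^n$; $P_e=\Pr\{\phi(Y_1^n)\ne W\}$. A secrecy rate $R\ge 0$ is achievable if for every $\epsilon>0$ and all sufficiently large $n$ there is a code with $M\ge 2^{nR}$, $P_e\le\epsilon$ and $R-\frac1n H(W|Y_2^n)\le\epsilon$. The secrecy capacity $R_s$ is the supremum of the achievable secrecy rates. All information quantities are in bits and may be $+\infty$; "max" and "min" over laws and channels are suprema and infima. Let $$R_u=\min_{P_{\tilde Y_1,\tilde Y_2|X_1,X_2}}\ \max_{P_{X_1},P_{X_2}} I(X_1,X_2;\tilde Y_1|\tilde Y_2),$$ where the minimum is over all joint channels with the same marginals, $P_{\tilde Y_j|X_1,X_2}=P_{Y_j|X_1,X_2}$ for $j=1,2$, and the maximum is over independent inputs $X_1,X_2$. **Theorem.** (a) For every WTC-HI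 for which $\max_{P_{X_1},P_{X_2}} I(X_1;Y_1|X_2)$ is finite (for instance whenever $X_1$ or $Y_1$ has a finite alphabet), $$R_s\le\min\Big[R_u,\ \max_{P_{X_1},P_{X_2}} I(X_1;Y_1|X_2)\Big].$$ (b) Let $a,b,\bar P_1,\bar P_2\ge0$ and consider the Gaussian WTC-HI $Y_1=X_1+\sqrt b X_2+Z_1$, $Y_2=\sqrt aX_1+X_2+Z_2$, where $(Z_1,Z_2)$ is independent of the inputs, $Z_1$ and $Z_2$ are standard Gaussian with any joint law, and codes satisfy the power constraints $\frac1n\sum_{k=1}^n E[X_{j,k}^2]\le\bar P_j$, $j=1,2$; the maxima are now over independent inputs with $E[X_j^2]\le\bar P_j$. Then again $R_s\le\min[R_u,\max I(X_1;Y_1|X_2)]$. Put $$f(P_1,P_2,\rho)=\frac12\log_2\frac{(1+P_1+bP_2)(1+aP_1+P_2)-(\rho+\sqrt aP_1+\sqrt bP_2)^2}{(1-\rho^2)(1+aP_1+P_2)},$$ $$\rho^*(P_1,P_2)=\frac{(1+a)P_1+(1+b)P_2+(\sqrt{ab}-1)^2P_1P_2-\sqrt\Delta}{2(\sqrt aP_1+\sqrt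 bP_2)},$$ $$\Delta=[(\sqrt a-1)^2P_1+(\sqrt b-1)^2P_2+(\sqrt{ab}-1)^2P_1P_2]\,[(\sqrt a+1)^2P_1+(\sqrt b+1)^2P_2+(\sqrt{ab}-1)^2P_1P_2],$$ with $\rho^*=0$ when $\sqrt aP_1+\sqrt bP_2=0$, and with $f(P_1,P_2,1)=0$ in the degenerate case $\rho^*(P_1,P_2)=1$, where the fraction reads $0/0$. Then: 1. if $\tilde Z_1,\tilde Z_2$ are jointly Gaussian, with zero means, unit variances and covariance $\rho\in(-1,1)$, then for all $P_1,P_2\ge0$ the maximum of $I(X_1,X_2;\tilde Y_1|\tilde Y_2)$ over independent inputs with $E[X_j^2]\le P_j$ equals $f(P_1,P_2,\rho)$ and is attained by independent Gaussian inputs $X_j\sim\mathcal N(0,P_j)$; 2. $|\rho^*(P_1,P_2)|\le 1$ and $f(P_1,P_2,\rho^*(P_1,P_2))\le f(P_1,P_2,\rho)$ for all $P_1,P_2\ge0$ and $\rho\in(-1,1)$; 3. $R_u=\inf_{-1<\rho<1}\ \max_{0\le P_1\le\bar P_1,\,0\le P_2\le\bar P_2}f(P_1,P_2,\rho)=f(\bar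 P_1,\bar P_2,\rho^*(\bar P_1,\bar P_2))$, and the minimum defining $R_u$ is attained by jointly Gaussian noises with covariance $\rho^*(\bar P_1,\bar P_2)$. -/

import Mathlib

open MeasureTheory ProbabilityTheory
open scoped ENNReal NNReal

noncomputable section

namespace WTCHI

/-! ### Information measures (in bits) -/

/-- Conditional mutual information `I(X; Y | Z)`, in bits: the Kullback-Leibler divergence between
the joint law of `(Z, X, Y)` and the law under which `X` and `Y` have the same conditional laws
given `Z` but are conditionally independent. The value may be `∞`. -/
def condMutualInfo {Ω α β γ : Type*} [MeasurableSpace Ω]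
    [MeasurableSpace α] [StandardBorelSpace α] [Nonempty α]
    [MeasurableSpace β] [StandardBorelSpace β] [Nonempty β] [MeasurableSpace γ]
    (X : Ω → α) (Y : Ω → β) (Z : Ω → γ) (μ : Measure Ω) [IsFiniteMeasure μ] : ℝ≥0∞ :=
  InformationTheory.klDiv (μ.map fun ω => (Z ω, X ω, Y ω))
    (μ.map Z ⊗ₘ (condDistrib X Z μ ×ₖ condDistrib Y Z μ)) / ENNReal.ofReal (Real.log 2)

/-- Conditional Shannon entropy `H(W | Z)`, in bits, of a finitely valued `W`: the mean over `Z` of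
the entropy `-∑ p log₂ p` of the conditional law of `W` given `Z`. -/
def condEntropy {Ω ι γ : Type*} [MeasurableSpace Ω]
    [Fintype ι] [Nonempty ι] [MeasurableSpace ι] [StandardBorelSpace ι] [MeasurableSpace γ]
    (W : Ω → ι) (Z : Ω → γ) (μ : Measure Ω) [IsFiniteMeasure μ] : ℝ :=
  (∫ z, ∑ w, Real.negMulLog ((condDistrib W Z μ z).real {w}) ∂(μ.map Z)) / Real.log 2

/-! ### Memoryless channels and codes -/

/-- `n` independent uses of the channel `K`. -/
def memoryless {α β : Type*} [MeasurableSpace α] [MeasurableSpace β]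
    (K : Kernel α β) [IsMarkovKernel K] (n : ℕ) : Kernel (Fin n → α) (Fin n → β) where
  toFun x := Measure.pi fun k => K (x k)
  measurable' := by
    refine Measurable.measure_of_isPiSystem_of_isProbabilityMeasure generateFrom_pi.symm
      isPiSystem_pi ?_
    rintro _ ⟨s, hs, rfl⟩
    simp only [Set.mem_pi, Set.mem_univ, Set.mem_ofPred_eq, forall_const] at hs
    simp only [Measure.pi_pi]
    exact Finset.measurable_prod _ fun k _ =>
      (Kernel.measurable_coe K (hs k)).comp (measurable_pi_apply k)

instance {α β : Type*} [MeasurableSpace α] [MeasurableSpace β]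
    (K : Kernel α β) [IsMarkovKernel K] (n : ℕ) : IsMarkovKernel (memoryless K n) :=
  ⟨fun x => inferInstanceAs (IsProbabilityMeasure (Measure.pi fun k => K (x k)))⟩

/-- An input constraint on an alphabet: a letter cost and a bound on the mean cost. -/
structure InputConstraint (α : Type*) where
  cost : α → ℝ≥0∞
  budget : ℝ≥0∞

/-- No constraint. -/
def InputConstraint.none (α : Type*) : InputConstraint α := ⟨fun _ => 0, 0⟩

/-- The average power constraint `E[X²] ≤ P`. -/
def InputConstraint.power (P : ℝ≥0) : InputConstraint ℝ := ⟨fun x => ENNReal.ofReal (x ^ 2), P⟩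

section Model

variable {𝒳₁ 𝒳₂ 𝒴₁ 𝒴₂ : Type*}
  [MeasurableSpace 𝒳₁] [MeasurableSpace 𝒳₂] [MeasurableSpace 𝒴₁] [MeasurableSpace 𝒴₂]

/-- A code with `M` messages and block length `n`: a stochastic encoder of the message, a
randomized helper that does not know the message, and a deterministic decoder. -/
structure Code (𝒳₁ 𝒳₂ 𝒴₁ : Type*)
    [MeasurableSpace 𝒳₁] [MeasurableSpace 𝒳₂] [MeasurableSpace 𝒴₁] (M n : ℕ) where
  enc₁ : Kernel (Fin M) (Fin n → 𝒳₁)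
  markov₁ : IsMarkovKernel enc₁
  enc₂ : Measure (Fin n → 𝒳₂)
  prob₂ : IsProbabilityMeasure enc₂
  dec : (Fin n → 𝒴₁) → Fin M
  measurable_dec : Measurable dec

attribute [instance] Code.markov₁ Code.prob₂

namespace Code

variable {M n : ℕ} [NeZero M]

/-- The joint law of `((W, X₁ⁿ), X₂ⁿ)` and `(Y₁ₖ, Y₂ₖ)ₖ`, for a message `W` that is uniform on the
`M` messages. -/
def law (C : Code 𝒳₁ 𝒳₂ 𝒴₁ M n) (K : Kernel (𝒳₁ × 𝒳₂) (𝒴₁ × 𝒴₂)) [IsMarkovKernel K] :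
    Measure (((Fin M × (Fin n → 𝒳₁)) × (Fin n → 𝒳₂)) × (Fin n → 𝒴₁ × 𝒴₂)) :=
  (((PMF.uniformOfFintype (Fin M)).toMeasure ⊗ₘ C.enc₁).prod C.enc₂) ⊗ₘ
    (memoryless K n).comap (fun t k => (t.1.2 k, t.2 k)) (by fun_prop)

instance (C : Code 𝒳₁ 𝒳₂ 𝒴₁ M n) (K : Kernel (𝒳₁ × 𝒳₂) (𝒴₁ × 𝒴₂)) [IsMarkovKernel K] :
    IsProbabilityMeasure (C.law K) := by
  unfold law; infer_instance

/-- The probability of error, averaged over the messages. -/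
def errorProb (C : Code 𝒳₁ 𝒳₂ 𝒴₁ M n) (K : Kernel (𝒳₁ × 𝒳₂) (𝒴₁ × 𝒴₂)) [IsMarkovKernel K] : ℝ :=
  (C.law K).real {ω | C.dec (fun k => (ω.2 k).1) ≠ ω.1.1.1}

/-- The equivocation `H(W | Y₂ⁿ)` at the eavesdropper, in bits. -/
def equivocation (C : Code 𝒳₁ 𝒳₂ 𝒴₁ M n) (K : Kernel (𝒳₁ × 𝒳₂) (𝒴₁ × 𝒴₂))
    [IsMarkovKernel K] : ℝ :=
  condEntropy (fun ω => ω.1.1.1) (fun ω k => (ω.2 k).2) (C.law K)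

/-- The block-averaged input constraints `(1/n) ∑ₖ E[cⱼ(Xⱼ,ₖ)] ≤ Bⱼ`, multiplied by `n`. -/
def Admissible (C : Code 𝒳₁ 𝒳₂ 𝒴₁ M n) (K : Kernel (𝒳₁ × 𝒳₂) (𝒴₁ × 𝒴₂)) [IsMarkovKernel K]
    (c₁ : InputConstraint 𝒳₁) (c₂ : InputConstraint 𝒳₂) : Prop :=
  ∑ k, ∫⁻ ω, c₁.cost (ω.1.1.2 k) ∂(C.law K) ≤ n * c₁.budget ∧
  ∑ k, ∫⁻ ω, c₂.cost (ω.1.2 k) ∂(C.law K) ≤ n * c₂.budget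

end Code

/-- The secrecy rate `R` (in bits per channel use) is achievable. -/
def IsAchievable (K : Kernel (𝒳₁ × 𝒳₂) (𝒴₁ × 𝒴₂)) [IsMarkovKernel K]
    (c₁ : InputConstraint 𝒳₁) (c₂ : InputConstraint 𝒳₂) (R : ℝ) : Prop :=
  ∀ ε : ℝ, 0 < ε → ∀ᶠ n : ℕ in Filter.atTop,
    ∃ (M : ℕ) (_ : NeZero M) (C : Code 𝒳₁ 𝒳₂ 𝒴₁ M n), C.Admissible K c₁ c₂ ∧
      (2 : ℝ) ^ (n * R) ≤ M ∧ C.errorProb K ≤ ε ∧ R - C.equivocation K / n ≤ ε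

/-- The secrecy capacity: the supremum of the achievable secrecy rates. -/
def secrecyCapacity (K : Kernel (𝒳₁ × 𝒳₂) (𝒴₁ × 𝒴₂)) [IsMarkovKernel K]
    (c₁ : InputConstraint 𝒳₁) (c₂ : InputConstraint 𝒳₂) : ℝ≥0∞ :=
  ⨆ (R : ℝ≥0) (_ : IsAchievable K c₁ c₂ R), (R : ℝ≥0∞)

/-! ### The two bounds -/

variable [StandardBorelSpace 𝒳₁] [StandardBorelSpace 𝒳₂] [StandardBorelSpace 𝒴₁]
  [StandardBorelSpace 𝒴₂] [Nonempty 𝒳₁] [Nonempty 𝒳₂] [Nonempty 𝒴₁] [Nonempty 𝒴₂]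

/-- `I(X₁, X₂; Y₁ | Y₂)` for independent inputs with laws `p₁` and `p₂`. -/
def genieInfo (K : Kernel (𝒳₁ × 𝒳₂) (𝒴₁ × 𝒴₂)) [IsMarkovKernel K]
    (p₁ : Measure 𝒳₁) (p₂ : Measure 𝒳₂) [IsProbabilityMeasure p₁] [IsProbabilityMeasure p₂] :
    ℝ≥0∞ :=
  condMutualInfo (fun ω => ω.1) (fun ω => ω.2.1) (fun ω => ω.2.2) ((p₁.prod p₂) ⊗ₘ K)

/-- `I(X₁; Y₁ | X₂)` for independent inputs with laws `p₁` and `p₂`. -/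
def directInfo (K : Kernel (𝒳₁ × 𝒳₂) (𝒴₁ × 𝒴₂)) [IsMarkovKernel K]
    (p₁ : Measure 𝒳₁) (p₂ : Measure 𝒳₂) [IsProbabilityMeasure p₁] [IsProbabilityMeasure p₂] :
    ℝ≥0∞ :=
  condMutualInfo (fun ω => ω.1.1) (fun ω => ω.2.1) (fun ω => ω.1.2) ((p₁.prod p₂) ⊗ₘ K)

/-- The maximum over independent input laws, subject to the input constraints, of
`I(X₁, X₂; Y₁ | Y₂)`. -/
def maxGenieInfo (K : Kernel (𝒳₁ × 𝒳₂) (𝒴₁ × 𝒴₂)) [IsMarkovKernel K]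
    (c₁ : InputConstraint 𝒳₁) (c₂ : InputConstraint 𝒳₂) : ℝ≥0∞ :=
  ⨆ (p₁ : Measure 𝒳₁) (p₂ : Measure 𝒳₂) (_ : IsProbabilityMeasure p₁) (_ : IsProbabilityMeasure p₂)
    (_ : ∫⁻ x, c₁.cost x ∂p₁ ≤ c₁.budget) (_ : ∫⁻ x, c₂.cost x ∂p₂ ≤ c₂.budget), genieInfo K p₁ p₂

/-- The maximum over independent input laws, subject to the input constraints, of
`I(X₁; Y₁ | X₂)`. -/
def maxDirectInfo (K : Kernel (𝒳₁ × 𝒳₂) (𝒴₁ × 𝒴₂)) [IsMarkovKernel K]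
    (c₁ : InputConstraint 𝒳₁) (c₂ : InputConstraint 𝒳₂) : ℝ≥0∞ :=
  ⨆ (p₁ : Measure 𝒳₁) (p₂ : Measure 𝒳₂) (_ : IsProbabilityMeasure p₁) (_ : IsProbabilityMeasure p₂)
    (_ : ∫⁻ x, c₁.cost x ∂p₁ ≤ c₁.budget) (_ : ∫⁻ x, c₂.cost x ∂p₂ ≤ c₂.budget), directInfo K p₁ p₂

/-- The channels `K'` and `K` have the same marginals `P(y₁ | x₁, x₂)` and `P(y₂ | x₁, x₂)`. -/
def SameMarginals (K' K : Kernel (𝒳₁ × 𝒳₂) (𝒴₁ × 𝒴₂)) : Prop :=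
  K'.fst = K.fst ∧ K'.snd = K.snd

/-- The Sato-type bound `R_u`: the minimum over all joint channels with the same marginals of the
maximum over independent input laws of `I(X₁, X₂; Ỹ₁ | Ỹ₂)`. -/
def satoBound (K : Kernel (𝒳₁ × 𝒳₂) (𝒴₁ × 𝒴₂)) [IsMarkovKernel K]
    (c₁ : InputConstraint 𝒳₁) (c₂ : InputConstraint 𝒳₂) : ℝ≥0∞ :=
  ⨅ (K' : Kernel (𝒳₁ × 𝒳₂) (𝒴₁ × 𝒴₂)) (_ : IsMarkovKernel K') (_ : SameMarginals K' K),
    maxGenieInfo K' c₁ c₂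

end Model

/-! ### The Gaussian channel -/

/-- The channel `Y₁ = X₁ + √b X₂ + Z₁`, `Y₂ = √a X₁ + X₂ + Z₂`, where `(Z₁, Z₂)` has law `ν` and is
independent of the inputs. -/
def additiveChannel (a b : ℝ) (ν : Measure (ℝ × ℝ)) : Kernel (ℝ × ℝ) (ℝ × ℝ) :=
  (Kernel.id ×ₖ Kernel.const (ℝ × ℝ) ν).map fun t =>
    (t.1.1 + √b * t.1.2 + t.2.1, √a * t.1.1 + t.1.2 + t.2.2)

instance (a b : ℝ) (ν : Measure (ℝ × ℝ)) [IsProbabilityMeasure ν] :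
    IsMarkovKernel (additiveChannel a b ν) :=
  Kernel.IsMarkovKernel.map _ (by fun_prop)

/-- The centred Gaussian law on the plane with unit variances and covariance `ρ ∈ [-1, 1]`. -/
def correlatedNoise (ρ : ℝ) : Measure (ℝ × ℝ) :=
  ((gaussianReal 0 1).prod (gaussianReal 0 1)).map fun g => (g.1, ρ * g.1 + √(1 - ρ ^ 2) * g.2)

instance (ρ : ℝ) : IsProbabilityMeasure (correlatedNoise ρ) :=
  Measure.isProbabilityMeasure_map (by fun_prop)

/-- The function `f(P₁, P₂, ρ)`. If `ρ = 1` and the numerator vanishes too, the conventions for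
division and logarithm give `0`, the limit of `f` as `ρ → 1`. -/
def f (a b P₁ P₂ ρ : ℝ) : ℝ :=
  1 / 2 * Real.logb 2
    (((1 + P₁ + b * P₂) * (1 + a * P₁ + P₂) - (ρ + √a * P₁ + √b * P₂) ^ 2) /
      ((1 - ρ ^ 2) * (1 + a * P₁ + P₂)))

/-- The discriminant `Δ`. -/
def discr (a b P₁ P₂ : ℝ) : ℝ :=
  ((√a - 1) ^ 2 * P₁ + (√b - 1) ^ 2 * P₂ + (√(a * b) - 1) ^ 2 * P₁ * P₂) *
    ((√a + 1) ^ 2 * P₁ + (√b + 1) ^ 2 * P₂ + (√(a * b) - 1) ^ 2 * P₁ * P₂)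

/-- The minimizing correlation `ρ*(P₁, P₂)`; it is `0` where the denominator is `0`. -/
def rhoStar (a b P₁ P₂ : ℝ) : ℝ :=
  ((1 + a) * P₁ + (1 + b) * P₂ + (√(a * b) - 1) ^ 2 * P₁ * P₂ - √(discr a b P₁ P₂)) /
    (2 * (√a * P₁ + √b * P₂))

end WTCHI

end

/-! The converse rests on one use of the Donsker-Varadhan inequality for a whole block. Compare the
true law with the law in which each letter of `Y₁` is redrawn from the corresponding letter of `Y₂`
alone (`decoupled`). Under the second law the message and `Y₁ⁿ` are conditionally independent given
`Y₂ⁿ`. The test function is the logarithm of a reverse channel `guess` of the decoder, minus the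
log-posterior of `W` given `Y₂ⁿ`. Its exponential has mean at most 1 under the second law, and its
mean under the true law is `H(W|Y₂ⁿ)` less a Fano term. The divergence of the two laws splits into
letters (`integral_le_sum_klDiv`), and with the right redrawing kernel each letter contributes at
most `I(X₁,X₂;Y₁|Y₂)`.

This inequality, `condEntropy_le_sum_klDiv`, is used twice. Applied to `K'` it gives the genie
bound, and since error probability and equivocation each see only one marginal of the channel, `K'`
may be any channel with the marginals of `K`. Applied to `revealHelper K`, where the second output
is `X₂`, the equivocation is `log M` and the bound becomes `∑ I(X₁;Y₁|X₂)`. When the latter is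
finite per letter, the Fano term in the former is `o(n)`.

For the Gaussian channel, `I` is bounded above by replacing the law of `Y₁` given `Y₂` with a
Gaussian kernel around a linear estimator (`condMutualInfo_le_of_gaussKernel`), and below by using a
Gaussian log-likelihood ratio as a test function (`le_condMutualInfo_of_gaussKernel`). Both bounds
involve second moments only. For a channel `K'` with the right marginals, each noise separately is
independent of the inputs, so the lower bound depends on `K'` only through the noise covariance `r`,
affinely and with slope proportional to the derivative of `f` in `ρ`. At an interior `ρ*` this
derivative vanishes (`rhoStar_stationary`), so no `K'` does better than `f(ρ*)`: a saddle point.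
Minimality of `ρ*` is a Cauchy-Schwarz inequality after a partial fraction decomposition
(`condVar_div_mul`). If `ρ* = 1`, then `Y₁ = Y₂` almost surely under fully correlated noise and the
information is 0. -/

noncomputable section

namespace WTCHI

open InformationTheory

/-! ### Variational lower bounds on the Kullback-Leibler divergence -/

/-- If `exp (-Λ)` times `P` is dominated by `Q`, then the mean of `g` under `P` is at most that of
`Λ` as soon as `exp g` has `Q`-mass at most `1`. -/
theorem integral_le_of_withDensity_exp_neg_le {Ω : Type*} [MeasurableSpace Ω]
    {P Q : Measure Ω} [IsProbabilityMeasure P] {Λ g : Ω → ℝ}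
    (hΛm : Measurable Λ) (hgm : Measurable g) (hΛ : Integrable Λ P) (hg : Integrable g P)
    (hPQ : ∫⁻ ω, ENNReal.ofReal (Real.exp (g ω)) * ENNReal.ofReal (Real.exp (-Λ ω)) ∂P ≤
      ∫⁻ ω, ENNReal.ofReal (Real.exp (g ω)) ∂Q)
    (hQ : ∫⁻ ω, ENNReal.ofReal (Real.exp (g ω)) ∂Q ≤ 1) :
    ∫ ω, g ω ∂P ≤ ∫ ω, Λ ω ∂P := by
  have h1 : ∫⁻ ω, ENNReal.ofReal (Real.exp (g ω - Λ ω)) ∂P ≤ 1 := by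
    refine le_trans (le_of_eq ?_) (hPQ.trans hQ)
    refine lintegral_congr fun ω => ?_
    rw [← ENNReal.ofReal_mul (Real.exp_nonneg _), ← Real.exp_add, sub_eq_add_neg]
  have hint : Integrable (fun ω => Real.exp (g ω - Λ ω)) P :=
    (lintegral_ofReal_ne_top_iff_integrable (by fun_prop)
      (Filter.Eventually.of_forall fun _ => Real.exp_nonneg _)).1
      (h1.trans_lt ENNReal.one_lt_top).ne
  have h2 : ∫ ω, Real.exp (g ω - Λ ω) ∂P ≤ 1 := by
    rw [integral_eq_lintegral_of_nonneg_ae (Filter.Eventually.of_forall fun _ => Real.exp_nonneg _)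
      (by fun_prop)]
    exact ENNReal.toReal_le_of_le_ofReal zero_le_one (by simpa using h1)
  -- The inequality `x + 1 ≤ exp x` at `x = g - Λ`; by `h2` the right side is at most 0.
  have h3 : ∫ ω, (g ω - Λ ω) ∂P ≤ ∫ ω, (Real.exp (g ω - Λ ω) - 1) ∂P :=
    integral_mono (hg.sub hΛ) (hint.sub (integrable_const 1)) fun ω => by
      have := Real.add_one_le_exp (g ω - Λ ω)
      simp only
      linarith
  rw [integral_sub hg hΛ, integral_sub hint (integrable_const 1)] at h3
  simp only [integral_const, probReal_univ, smul_eq_mul, mul_one] at h3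
  linarith

/-- Equality, except at `d = 0`, where `Real.log 0 = 0` and the product is 0. Zeros of a density
thus need no separate treatment. -/
theorem exp_neg_log_mul_le_one (d : ℝ) (hd : 0 ≤ d) :
    ENNReal.ofReal (Real.exp (-Real.log d)) * ENNReal.ofReal d ≤ 1 := by
  rcases hd.eq_or_lt with rfl | h
  · simp
  · rw [← ENNReal.ofReal_mul (Real.exp_nonneg _), Real.exp_neg, Real.exp_log h,
      inv_mul_cancel₀ h.ne']
    simp

theorem withDensity_ofReal_toReal_rnDeriv {Ω : Type*} [MeasurableSpace Ω] {P Q : Measure Ω}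
    [SigmaFinite P] [SigmaFinite Q] (h : P ≪ Q) :
    Q.withDensity (fun ω => ENNReal.ofReal (P.rnDeriv Q ω).toReal) = P := by
  rw [withDensity_congr_ae (g := P.rnDeriv Q), Measure.withDensity_rnDeriv_eq _ _ h]
  filter_upwards [P.rnDeriv_lt_top Q] with ω hω using ENNReal.ofReal_toReal hω.ne

/-- The Donsker-Varadhan lower bound. -/
theorem ofReal_integral_le_klDiv {Ω : Type*} [MeasurableSpace Ω]
    {P Q : Measure Ω} [IsProbabilityMeasure P] [IsProbabilityMeasure Q] {g : Ω → ℝ}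
    (hgm : Measurable g) (hg : Integrable g P)
    (hQ : ∫⁻ ω, ENNReal.ofReal (Real.exp (g ω)) ∂Q ≤ 1) :
    ENNReal.ofReal (∫ ω, g ω ∂P) ≤ klDiv P Q := by
  by_cases htop : klDiv P Q = ∞
  · simp [htop]
  obtain ⟨hac, hint⟩ := klDiv_ne_top_iff.1 htop
  rw [klDiv_of_ac_of_integrable hac hint]
  simp only [probReal_univ, add_sub_cancel_right]
  refine ENNReal.ofReal_le_ofReal (integral_le_of_withDensity_exp_neg_le (Q := Q)
    (measurable_llr P Q) hgm hint hg ?_ hQ)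
  nth_rw 1 [← withDensity_ofReal_toReal_rnDeriv hac]
  rw [lintegral_withDensity_eq_lintegral_mul _ (by fun_prop) (by
    have := measurable_llr P Q
    fun_prop)]
  refine lintegral_mono fun ω => ?_
  simp only [Pi.mul_apply, llr]
  rw [mul_comm, mul_assoc]
  exact mul_le_of_le_one_right' (exp_neg_log_mul_le_one _ ENNReal.toReal_nonneg)

/-! ### Products of kernels -/

theorem lintegral_pi_prod {n : ℕ} {β : Fin n → Type*} [∀ k, MeasurableSpace (β k)]
    (μ : ∀ k, Measure (β k)) [∀ k, IsProbabilityMeasure (μ k)] (f : ∀ k, β k → ℝ≥0∞)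
    (hf : ∀ k, Measurable (f k)) :
    ∫⁻ y, ∏ k, f k (y k) ∂Measure.pi μ = ∏ k, ∫⁻ y, f k y ∂μ k := by
  have hind : iIndepFun (fun k (y : ∀ k, β k) => f k (y k)) (Measure.pi μ) :=
    iIndepFun_pi fun k => (hf k).aemeasurable
  rw [lintegral_prod_eq_prod_lintegral_of_indepFun Finset.univ _ hind (fun k => by fun_prop)]
  refine Finset.prod_congr rfl fun k _ => ?_
  exact (measurePreserving_eval μ k).lintegral_comp (hf k)

theorem pi_withDensity {n : ℕ} {β : Fin n → Type*} [∀ k, MeasurableSpace (β k)]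
    (μ : ∀ k, Measure (β k)) [∀ k, IsProbabilityMeasure (μ k)] (f : ∀ k, β k → ℝ≥0∞)
    (hf : ∀ k, Measurable (f k)) [∀ k, SigmaFinite ((μ k).withDensity (f k))] :
    Measure.pi (fun k => (μ k).withDensity (f k)) =
      (Measure.pi μ).withDensity fun y => ∏ k, f k (y k) := by
  refine Measure.pi_eq fun s hs => ?_
  rw [withDensity_apply _ (MeasurableSet.univ_pi hs),
    ← lintegral_indicator (MeasurableSet.univ_pi hs)]
  simp_rw [withDensity_apply _ (hs _), ← lintegral_indicator (hs _)]
  rw [← lintegral_pi_prod μ _ fun k => (hf k).indicator (hs k)]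
  refine lintegral_congr fun y => ?_
  by_cases hy : y ∈ Set.univ.pi s
  · rw [Set.indicator_of_mem hy]
    exact Finset.prod_congr rfl fun k _ => (Set.indicator_of_mem (hy k trivial) _).symm
  · rw [Set.indicator_of_notMem hy]
    simp only [Set.mem_pi, not_forall] at hy
    obtain ⟨k, _, hk⟩ := hy
    exact (Finset.prod_eq_zero (Finset.mem_univ k) (Set.indicator_of_notMem hk _)).symm

/-- The kernel whose output coordinates are conditionally independent with laws `κ k t`. -/
def piKernel {α : Type*} [MeasurableSpace α] {n : ℕ} {β : Type*} [MeasurableSpace β]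
    (κ : Fin n → Kernel α β) [∀ k, IsMarkovKernel (κ k)] : Kernel α (Fin n → β) where
  toFun t := Measure.pi fun k => κ k t
  measurable' := by
    refine Measurable.measure_of_isPiSystem_of_isProbabilityMeasure generateFrom_pi.symm
      isPiSystem_pi ?_
    rintro _ ⟨s, hs, rfl⟩
    simp only [Set.mem_pi, Set.mem_univ, Set.mem_ofPred_eq, forall_const] at hs
    simp only [Measure.pi_pi]
    exact Finset.measurable_prod _ fun k _ => Kernel.measurable_coe (κ k) (hs k)

section PiKernel

variable {α : Type*} [MeasurableSpace α] {n : ℕ} {β γ : Type*} [MeasurableSpace β]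
  [MeasurableSpace γ]

theorem piKernel_apply (κ : Fin n → Kernel α β) [∀ k, IsMarkovKernel (κ k)] (t : α) :
    piKernel κ t = Measure.pi fun k => κ k t := rfl

instance (κ : Fin n → Kernel α β) [∀ k, IsMarkovKernel (κ k)] : IsMarkovKernel (piKernel κ) :=
  ⟨fun t => inferInstanceAs (IsProbabilityMeasure (Measure.pi fun k => κ k t))⟩

/-- A product of composition products is the composition product of the products. -/
theorem pi_compProd (a : Fin n → Measure β) [∀ k, IsProbabilityMeasure (a k)]
    (κ : Fin n → Kernel β γ) [∀ k, IsMarkovKernel (κ k)] :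
    (Measure.pi fun k => a k ⊗ₘ κ k) =
      (Measure.pi a ⊗ₘ piKernel fun k => (κ k).comap (fun y : Fin n → β => y k) (by fun_prop)).map
        fun p k => (p.1 k, p.2 k) := by
  refine (Measure.pi_eq_generateFrom (C := fun _ => Set.image2 (· ×ˢ ·) {s | MeasurableSet s}
    {t | MeasurableSet t}) (fun _ => generateFrom_prod) (fun _ => isPiSystem_prod) (fun k => ?_)
    fun s hs => ?_)
  · exact (Measure.FiniteSpanningSetsIn.mk (fun _ => Set.univ)
      (fun _ => ⟨Set.univ, MeasurableSet.univ, Set.univ, MeasurableSet.univ, by simp⟩)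
      (fun _ => measure_lt_top _ _) (Set.iUnion_const _))
  · choose u hu v hv huv using hs
    have hs' : ∀ k, MeasurableSet (s k) := fun k => huv k ▸ (hu k).prod (hv k)
    rw [Measure.map_apply (by fun_prop) (MeasurableSet.univ_pi hs')]
    have hpre : (fun (p : (Fin n → β) × (Fin n → γ)) k => (p.1 k, p.2 k)) ⁻¹' Set.univ.pi s =
        Set.univ.pi u ×ˢ Set.univ.pi v := by
      ext p
      simp only [Set.mem_preimage, Set.mem_pi, Set.mem_univ, forall_const, Set.mem_prod, ← huv]
      exact forall_and
    rw [hpre, Measure.compProd_apply_prod (MeasurableSet.univ_pi hu) (MeasurableSet.univ_pi hv),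
      ← lintegral_indicator (MeasurableSet.univ_pi hu)]
    simp_rw [piKernel_apply, Measure.pi_pi, ← huv,
      Measure.compProd_apply_prod (hu _) (hv _), ← lintegral_indicator (hu _)]
    rw [← lintegral_pi_prod a _ fun k => ((κ k).measurable_coe (hv k)).indicator (hu k)]
    refine lintegral_congr fun y => ?_
    by_cases hy : y ∈ Set.univ.pi u
    · rw [Set.indicator_of_mem hy]
      refine Finset.prod_congr rfl fun k _ => ?_
      rw [Set.indicator_of_mem (hy k trivial)]
      rfl
    · rw [Set.indicator_of_notMem hy]
      simp only [Set.mem_pi, not_forall] at hy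
      obtain ⟨k, _, hk⟩ := hy
      exact (Finset.prod_eq_zero (Finset.mem_univ k) (Set.indicator_of_notMem hk _)).symm

end PiKernel

/-! ### Single-letterization -/

/-- Both `f` and the kernel derivative `κ.rnDeriv η` are densities of the same joint law, hence
agree almost everywhere. A joint density is therefore also a density of almost every conditional
law. -/
theorem ae_eq_withDensity_of_compProd_eq {α β : Type*} [MeasurableSpace α] [MeasurableSpace β]
    [MeasurableSpace.CountablyGenerated β] {μ : Measure α} [IsFiniteMeasure μ]
    {κ η : Kernel α β} [IsFiniteKernel κ] [IsFiniteKernel η] {f : α × β → ℝ≥0∞}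
    (hf : Measurable f) (h : (μ ⊗ₘ η).withDensity f = μ ⊗ₘ κ) :
    ∀ᵐ a ∂μ, κ a = (η a).withDensity fun y => f (a, y) := by
  have hac : ∀ᵐ a ∂μ, κ a ≪ η a :=
    (h ▸ withDensity_absolutelyContinuous _ _ : μ ⊗ₘ κ ≪ μ ⊗ₘ η).kernel_of_compProd
  have hκ : ∀ᵐ a ∂μ, κ a = η.withDensity (κ.rnDeriv η) a := by
    filter_upwards [hac] with a ha using (Kernel.withDensity_rnDeriv_eq ha).symm
  have heq : (μ ⊗ₘ η).withDensity f = (μ ⊗ₘ η).withDensity fun p => κ.rnDeriv η p.1 p.2 := by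
    rw [h, Measure.compProd_congr hκ, Measure.compProd_withDensity (by fun_prop)]
  have hne : ∫⁻ p, f p ∂(μ ⊗ₘ η) ≠ ∞ := by
    rw [← setLIntegral_univ, ← withDensity_apply _ MeasurableSet.univ, h]
    exact measure_ne_top _ _
  have hfae := (withDensity_eq_iff hf.aemeasurable
    (Kernel.measurable_rnDeriv κ η).aemeasurable hne).1 heq
  filter_upwards [hκ, Measure.ae_ae_of_ae_compProd hfae] with a ha hb
  rw [ha, Kernel.withDensity_apply _ (by fun_prop)]
  exact withDensity_congr_ae (hb.mono fun y hy => hy.symm)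

section Letters

variable {T 𝒳 β : Type*} [MeasurableSpace T] [MeasurableSpace 𝒳] [MeasurableSpace β] {n : ℕ}

theorem map_letter_compProd_piKernel (μ : Measure T) [IsProbabilityMeasure μ]
    (x : T → Fin n → 𝒳) (hx : Measurable x) (K : Fin n → Kernel 𝒳 β) [∀ k, IsMarkovKernel (K k)]
    (k : Fin n) :
    (μ ⊗ₘ piKernel fun k => (K k).comap (fun t => x t k) (by fun_prop)).map
        (fun p => (x p.1 k, p.2 k)) = μ.map (fun t => x t k) ⊗ₘ K k := by
  refine Measure.ext_of_lintegral _ fun F hF => ?_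
  rw [lintegral_map hF (by fun_prop), Measure.lintegral_compProd (by fun_prop),
    Measure.lintegral_compProd hF, lintegral_map (hF.lintegral_kernel_prod_right') (by fun_prop)]
  refine lintegral_congr fun t => ?_
  rw [piKernel_apply]
  exact (measurePreserving_eval (fun k => K k (x t k)) k).lintegral_comp
    (f := fun y => F (x t k, y)) (by fun_prop)

/-- Given `t` both output laws are products, so the log-likelihood ratio is a sum over letters. By
linearity its mean is the sum of the letter divergences, however the inputs `x t k` are correlated
over `k`. The change-of-measure form of Donsker-Varadhan with `Λ` equal to this sum concludes. -/
theorem integral_le_sum_klDiv [MeasurableSpace.CountablyGenerated β]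
    (μ : Measure T) [IsProbabilityMeasure μ]
    (x : T → Fin n → 𝒳) (hx : Measurable x) (K S : Fin n → Kernel 𝒳 β)
    [∀ k, IsMarkovKernel (K k)] [∀ k, IsMarkovKernel (S k)]
    (hfin : ∀ k, klDiv (μ.map (fun t => x t k) ⊗ₘ K k) (μ.map (fun t => x t k) ⊗ₘ S k) ≠ ∞)
    {g : T × (Fin n → β) → ℝ} (hgm : Measurable g)
    (hg : Integrable g (μ ⊗ₘ piKernel fun k => (K k).comap (fun t => x t k) (by fun_prop)))
    (hQ : ∫⁻ ω, ENNReal.ofReal (Real.exp (g ω))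
      ∂(μ ⊗ₘ piKernel fun k => (S k).comap (fun t => x t k) (by fun_prop)) ≤ 1) :
    ∫ ω, g ω ∂(μ ⊗ₘ piKernel fun k => (K k).comap (fun t => x t k) (by fun_prop)) ≤
      ∑ k, (klDiv (μ.map (fun t => x t k) ⊗ₘ K k) (μ.map (fun t => x t k) ⊗ₘ S k)).toReal := by
  have hp : ∀ k, IsProbabilityMeasure (μ.map fun t => x t k) := fun k =>
    Measure.isProbabilityMeasure_map (by fun_prop)
  set P := μ ⊗ₘ piKernel fun k => (K k).comap (fun t => x t k) (by fun_prop) with hP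
  set D : Fin n → 𝒳 × β → ℝ := fun k p => ((μ.map (fun t => x t k) ⊗ₘ K k).rnDeriv
    (μ.map (fun t => x t k) ⊗ₘ S k) p).toReal with hD
  have hDm : ∀ k, Measurable (D k) := fun k => (Measure.measurable_rnDeriv _ _).ennreal_toReal
  have hDlog : ∀ k, llr (μ.map (fun t => x t k) ⊗ₘ K k) (μ.map (fun t => x t k) ⊗ₘ S k) =
    fun p => Real.log (D k p) := fun k => rfl
  have hac := fun k => (klDiv_ne_top_iff.1 (hfin k)).1
  have hint := fun k => (klDiv_ne_top_iff.1 (hfin k)).2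
  have hmap : ∀ k, MeasurePreserving (fun p : T × (Fin n → β) => (x p.1 k, p.2 k)) P
      (μ.map (fun t => x t k) ⊗ₘ K k) := fun k =>
    ⟨by fun_prop, map_letter_compProd_piKernel μ x hx K k⟩
  have hΛint : ∀ k, Integrable (fun p : T × (Fin n → β) => Real.log (D k (x p.1 k, p.2 k))) P :=
    fun k => (hmap k).integrable_comp_of_integrable (hint k)
  have hΛ : ∫ p, ∑ k, Real.log (D k (x p.1 k, p.2 k)) ∂P =
      ∑ k, (klDiv (μ.map (fun t => x t k) ⊗ₘ K k) (μ.map (fun t => x t k) ⊗ₘ S k)).toReal := by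
    rw [integral_finsetSum _ fun k _ => hΛint k]
    refine Finset.sum_congr rfl fun k _ => ?_
    rw [toReal_klDiv_of_measure_eq (hac k) (by simp), hDlog, ← (hmap k).map_eq,
      integral_map (hmap k).aemeasurable (hDm k).log.aestronglyMeasurable]
  rw [← hΛ]
  refine integral_le_of_withDensity_exp_neg_le (by fun_prop) hgm
    (integrable_finsetSum _ fun k _ => hΛint k) hg ?_ hQ
  -- The densities `D k` come from joint laws of input and output letters; here they become
  -- densities between the conditional output laws, so that their product is the density on the
  -- block.
  have hae : ∀ᵐ t ∂μ, ∀ k, K k (x t k) =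
      (S k (x t k)).withDensity fun y => ENNReal.ofReal (D k (x t k, y)) := by
    refine ae_all_iff.2 fun k => ?_
    exact ae_of_ae_map (by fun_prop) (ae_eq_withDensity_of_compProd_eq (hDm k).ennreal_ofReal
      (withDensity_ofReal_toReal_rnDeriv (hac k)))
  rw [hP, Measure.lintegral_compProd (by fun_prop), Measure.lintegral_compProd (by fun_prop)]
  refine lintegral_mono_ae ?_
  filter_upwards [hae] with t ht
  simp only [piKernel_apply, Kernel.comap_apply]
  have hfinite : ∀ k, IsFiniteMeasure
      ((S k (x t k)).withDensity fun y => ENNReal.ofReal (D k (x t k, y))) := fun k =>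
    ht k ▸ inferInstance
  rw [show (fun k => K k (x t k)) = fun k => (S k (x t k)).withDensity
    fun y => ENNReal.ofReal (D k (x t k, y)) from funext ht,
    pi_withDensity _ _ (fun k => by fun_prop),
    lintegral_withDensity_eq_lintegral_mul _ (by fun_prop) (by fun_prop)]
  refine lintegral_mono fun y => ?_
  simp only [Pi.mul_apply]
  rw [mul_comm, mul_assoc]
  refine mul_le_of_le_one_right' ?_
  rw [← Finset.sum_neg_distrib, Real.exp_sum,
    ENNReal.ofReal_prod_of_nonneg fun _ _ => Real.exp_nonneg _, ← Finset.prod_mul_distrib]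
  exact Finset.prod_le_one' fun k _ => exp_neg_log_mul_le_one _ ENNReal.toReal_nonneg

end Letters

/-! ### A converse for one block -/

section Block

variable {T 𝒳 𝒴₁ 𝒴₂ : Type*} [MeasurableSpace T] [MeasurableSpace 𝒳] [MeasurableSpace 𝒴₁]
  [MeasurableSpace 𝒴₂] {n : ℕ}

/-- The channel with the same second output as `K`, whose first output depends on the input only
through the second output, via `κ`. -/
def decoupled (K : Kernel 𝒳 (𝒴₁ × 𝒴₂)) (κ : Kernel 𝒴₂ 𝒴₁) : Kernel 𝒳 (𝒴₁ × 𝒴₂) :=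
  (K.snd ⊗ₖ κ.comap Prod.snd measurable_snd).map Prod.swap

instance (K : Kernel 𝒳 (𝒴₁ × 𝒴₂)) (κ : Kernel 𝒴₂ 𝒴₁) [IsMarkovKernel K] [IsMarkovKernel κ] :
    IsMarkovKernel (decoupled K κ) :=
  Kernel.IsMarkovKernel.map _ measurable_swap

theorem decoupled_apply (K : Kernel 𝒳 (𝒴₁ × 𝒴₂)) (κ : Kernel 𝒴₂ 𝒴₁) [IsMarkovKernel K]
    [IsMarkovKernel κ] (x : 𝒳) : decoupled K κ x = (K.snd x ⊗ₘ κ).map Prod.swap := by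
  rw [decoupled, Kernel.map_apply _ measurable_swap]
  congr 1
  refine Measure.ext_of_lintegral _ fun F hF => ?_
  rw [Kernel.lintegral_compProd _ _ _ hF, Measure.lintegral_compProd hF]
  rfl

/-- Letterwise redrawing is the same as taking `Y₂ⁿ` from the true channel and then redrawing the
whole vector `z` by a product kernel that sees `Y₂ⁿ` only. This is what makes `z` conditionally
independent of the message given `Y₂ⁿ`. -/
theorem lintegral_pi_decoupled (K : Kernel 𝒳 (𝒴₁ × 𝒴₂)) [IsMarkovKernel K]
    (κ : Fin n → Kernel 𝒴₂ 𝒴₁) [∀ k, IsMarkovKernel (κ k)] (x : Fin n → 𝒳)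
    (F : (Fin n → 𝒴₂) → (Fin n → 𝒴₁) → ℝ≥0∞) (hF : Measurable (Function.uncurry F)) :
    ∫⁻ y, F (fun k => (y k).2) (fun k => (y k).1) ∂(Measure.pi fun k => decoupled K (κ k) (x k)) =
      ∫⁻ y, ∫⁻ z, F (fun k => (y k).2) z ∂(piKernel
        (fun k => (κ k).comap (fun y : Fin n → 𝒴₂ => y k) (by fun_prop)) fun k => (y k).2)
        ∂(Measure.pi fun k => K (x k)) := by
  have hsnd : Measurable fun y : Fin n → 𝒴₁ × 𝒴₂ => fun k => (y k).2 := by fun_prop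
  have hmeas : Measurable fun p : Fin n → 𝒴₂ × 𝒴₁ => F (fun k => (p k).1) fun k => (p k).2 :=
    hF.comp (g := Function.uncurry F)
      (f := fun p : Fin n → 𝒴₂ × 𝒴₁ => ((fun k => (p k).1), fun k => (p k).2)) (by fun_prop)
  have hS : (Measure.pi fun k => decoupled K (κ k) (x k)) =
      (Measure.pi fun k => K.snd (x k) ⊗ₘ κ k).map fun p k => (p k).swap := by
    simp_rw [decoupled_apply]
    have : ∀ k, IsProbabilityMeasure ((K.snd (x k) ⊗ₘ κ k).map Prod.swap) := fun k =>
      Measure.isProbabilityMeasure_map (by fun_prop)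
    rw [Measure.pi_map_pi fun k => by fun_prop]
  have hmeas' : Measurable fun p : Fin n → 𝒴₁ × 𝒴₂ => F (fun k => (p k).2) fun k => (p k).1 :=
    hF.comp (g := Function.uncurry F)
      (f := fun p : Fin n → 𝒴₁ × 𝒴₂ => ((fun k => (p k).2), fun k => (p k).1)) (by fun_prop)
  rw [hS, lintegral_map hmeas' (by fun_prop)]
  simp only [Prod.fst_swap, Prod.snd_swap]
  rw [pi_compProd, lintegral_map hmeas (by fun_prop), Measure.lintegral_compProd (by exact hF)]
  have hK : (Measure.pi fun k => K.snd (x k)) =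
      (Measure.pi fun k => K (x k)).map fun y k => (y k).2 := by
    have : ∀ k, IsProbabilityMeasure ((K (x k)).map Prod.snd) := fun k =>
      Measure.isProbabilityMeasure_map (by fun_prop)
    rw [Measure.pi_map_pi fun k => by fun_prop]
    simp_rw [Kernel.snd_apply]
  rw [hK, lintegral_map (hF.lintegral_kernel_prod_right) hsnd]

/-- A subprobability reverse channel of a decoder: the decoded message or a uniform guess. -/
def guess (M : ℕ) (w v : Fin M) : ℝ := if w = v then 1 / 2 else 1 / (2 * M)

theorem guess_pos {M : ℕ} [NeZero M] (w v : Fin M) : 0 < guess M w v := by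
  have : (0 : ℝ) < M := Nat.cast_pos.2 (NeZero.pos M)
  unfold guess
  split_ifs <;> positivity

theorem sum_guess_le {M : ℕ} [NeZero M] (v : Fin M) : ∑ w, guess M w v ≤ 1 := by
  have hM : (0 : ℝ) < M := Nat.cast_pos.2 (NeZero.pos M)
  calc ∑ w, guess M w v ≤ ∑ w : Fin M, ((if w = v then 1 / 2 else 0) + 1 / (2 * (M : ℝ))) := by
        refine Finset.sum_le_sum fun w _ => ?_
        unfold guess
        split_ifs
        · have : 0 < 1 / (2 * (M : ℝ)) := by positivity
          linarith
        · simp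
    _ = 1 := by
        rw [Finset.sum_add_distrib, Finset.sum_ite_eq']
        simp
        field_simp
        norm_num

/-- In this form the mean of the logarithm is `-log 2 - Pₑ log M`, which is the Fano term. -/
theorem log_guess {M : ℕ} [NeZero M] (w v : Fin M) :
    Real.log (guess M w v) = -Real.log 2 - if v ≠ w then Real.log M else 0 := by
  have hM : (M : ℝ) ≠ 0 := Nat.cast_ne_zero.2 (NeZero.ne M)
  unfold guess
  by_cases h : w = v
  · simp [h]
  · rw [if_neg h, if_pos (Ne.symm h), one_div, Real.log_inv, Real.log_mul two_ne_zero hM]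
    ring

/-- The log-posterior is unbounded, but averaged over `W` given `Z` it is weighted by the posterior,
and `|p log p| ≤ 1` on `[0, 1]`; hence the integrability. -/
theorem condEntropy_mul_log_two {Ω γ : Type*} [MeasurableSpace Ω] [MeasurableSpace γ] {M : ℕ}
    [NeZero M] {P : Measure Ω} [IsProbabilityMeasure P] {W : Ω → Fin M} {Z : Ω → γ}
    (hW : Measurable W) (hZ : Measurable Z) :
    Integrable (fun ω => Real.log ((condDistrib W Z P (Z ω)).real {W ω})) P ∧
    condEntropy W Z P * Real.log 2 =
      -∫ ω, Real.log ((condDistrib W Z P (Z ω)).real {W ω}) ∂P := by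
  set post := condDistrib W Z P with hpost
  have hm : Measurable fun p : γ × Fin M => Real.log ((post p.1).real {p.2}) :=
    measurable_from_prod_countable_left fun w =>
      ((post.measurable_coe (measurableSet_singleton w)).ennreal_toReal).log
  have : IsProbabilityMeasure (P.map Z) := Measure.isProbabilityMeasure_map hZ.aemeasurable
  have hlaw : P.map (fun ω => (Z ω, W ω)) = P.map Z ⊗ₘ post :=
    (compProd_map_condDistrib hW.aemeasurable).symm
  have hbd : ∀ z w, ‖(post z).real {w} * ‖Real.log ((post z).real {w})‖‖ ≤ 1 := fun z w => by
    have h0 : 0 ≤ (post z).real {w} := measureReal_nonneg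
    have h1 : (post z).real {w} ≤ 1 := measureReal_le_one
    rw [norm_mul, norm_norm, ← norm_mul, mul_comm, Real.norm_eq_abs]
    rcases h0.eq_or_lt with h | h
    · simp [← h]
    · exact (Real.abs_log_mul_self_lt _ h h1).le
  have hint : Integrable (fun p : γ × Fin M => Real.log ((post p.1).real {p.2}))
      (P.map Z ⊗ₘ post) := by
    rw [Measure.integrable_compProd_iff hm.aestronglyMeasurable]
    refine ⟨Filter.Eventually.of_forall fun z => .of_finite, ?_⟩
    simp_rw [integral_fintype .of_finite, smul_eq_mul]
    refine integrable_finsetSum _ fun w _ => ?_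
    refine Integrable.of_bound (C := 1) (Measurable.aestronglyMeasurable ?_)
      (Filter.Eventually.of_forall fun z => hbd z w)
    exact ((post.measurable_coe (measurableSet_singleton w)).ennreal_toReal).mul
      ((hm.comp (measurable_id.prodMk measurable_const)).norm)
  have hZW : Measurable fun ω => (Z ω, W ω) := hZ.prodMk hW
  refine ⟨?_, ?_⟩
  · rw [← hlaw] at hint
    exact hint.comp_measurable hZW
  · have hlog : Real.log 2 ≠ 0 := (Real.log_pos one_lt_two).ne'
    rw [condEntropy, div_mul_cancel₀ _ hlog]
    have h1 : ∫ ω, Real.log ((post (Z ω)).real {W ω}) ∂P =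
        ∫ p, Real.log ((post p.1).real {p.2}) ∂(P.map fun ω => (Z ω, W ω)) :=
      (integral_map hZW.aemeasurable hm.aestronglyMeasurable).symm
    rw [h1, hlaw, Measure.integral_compProd hint, ← integral_neg]
    refine integral_congr_ae (Filter.Eventually.of_forall fun z => ?_)
    simp only [integral_fintype .of_finite, smul_eq_mul, Real.negMulLog]
    rw [← Finset.sum_neg_distrib]
    exact Finset.sum_congr rfl fun w _ => by rw [neg_mul]

variable [StandardBorelSpace 𝒴₁] [StandardBorelSpace 𝒴₂]

/-- The equivocation is bounded by a sum of single-letter divergences, up to the Fano term. -/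
theorem condEntropy_le_sum_klDiv {M : ℕ} [NeZero M] (μ : Measure T) [IsProbabilityMeasure μ]
    (W : T → Fin M) (hW : Measurable W) (x : T → Fin n → 𝒳) (hx : Measurable x)
    (K : Kernel 𝒳 (𝒴₁ × 𝒴₂)) [IsMarkovKernel K]
    (κ : Fin n → Kernel 𝒴₂ 𝒴₁) [∀ k, IsMarkovKernel (κ k)]
    (dec : (Fin n → 𝒴₁) → Fin M) (hdec : Measurable dec)
    (hfin : ∀ k, klDiv (μ.map (fun t => x t k) ⊗ₘ K)
      (μ.map (fun t => x t k) ⊗ₘ decoupled K (κ k)) ≠ ∞) :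
    condEntropy (fun ω : T × (Fin n → 𝒴₁ × 𝒴₂) => W ω.1) (fun ω k => (ω.2 k).2)
        (μ ⊗ₘ (memoryless K n).comap x hx) * Real.log 2 ≤
      ∑ k, (klDiv (μ.map (fun t => x t k) ⊗ₘ K)
        (μ.map (fun t => x t k) ⊗ₘ decoupled K (κ k))).toReal + Real.log 2 +
      (μ ⊗ₘ (memoryless K n).comap x hx).real {ω | dec (fun k => (ω.2 k).1) ≠ W ω.1} *
        Real.log M := by
  have hmem : (memoryless K n).comap x hx =
      piKernel fun k => K.comap (fun t => x t k) (by fun_prop) := rfl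
  set P := μ ⊗ₘ (memoryless K n).comap x hx with hP
  set V : T × (Fin n → 𝒴₁ × 𝒴₂) → Fin M := fun ω => W ω.1
  set Z : T × (Fin n → 𝒴₁ × 𝒴₂) → Fin n → 𝒴₂ := fun ω k => (ω.2 k).2
  set d : T × (Fin n → 𝒴₁ × 𝒴₂) → Fin M := fun ω => dec fun k => (ω.2 k).1
  have hV : Measurable V := by fun_prop
  have hZ : Measurable Z := by fun_prop
  have hd : Measurable d := by fun_prop
  obtain ⟨hint, hent⟩ := condEntropy_mul_log_two (P := P) hV hZ
  set post := condDistrib V Z P with hpost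
  have hpm : Measurable fun p : (Fin n → 𝒴₂) × Fin M => Real.log ((post p.1).real {p.2}) :=
    measurable_from_prod_countable_left fun w =>
      ((post.measurable_coe (measurableSet_singleton w)).ennreal_toReal).log
  have hgm : Measurable fun p : Fin M × Fin M => guess M p.1 p.2 := measurable_of_countable _
  have hlg : ∀ ω, Real.log (guess M (V ω) (d ω)) =
      -Real.log 2 - {ω | d ω ≠ V ω}.indicator (fun _ => Real.log M) ω := fun ω => by
    rw [log_guess, Set.indicator_apply]
    rfl
  have hset : MeasurableSet {ω | d ω ≠ V ω} := (measurableSet_eq_fun hd hV).compl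
  have hi1 : Integrable (fun ω => Real.log (guess M (V ω) (d ω))) P := by
    simp_rw [hlg]
    exact (integrable_const _).sub ((integrable_const _).indicator hset)
  have hi2 : ∫ ω, Real.log (guess M (V ω) (d ω)) ∂P =
      -Real.log 2 - P.real {ω | d ω ≠ V ω} * Real.log M := by
    simp_rw [hlg]
    rw [integral_sub (integrable_const _) ((integrable_const _).indicator hset),
      integral_indicator_const _ hset]
    simp
  -- The test function compares the reverse channel of the decoder with the posterior of the
  -- eavesdropper. By `hent` and `hi2` its mean is the equivocation (in nats) minus `log 2` and the
  -- error term; what remains is to bound the mean of its exponential under the decoupled law.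
  have hmain : ∫ ω, (Real.log (guess M (V ω) (d ω)) - Real.log ((post (Z ω)).real {V ω})) ∂P ≤
      ∑ k, (klDiv (μ.map (fun t => x t k) ⊗ₘ K)
        (μ.map (fun t => x t k) ⊗ₘ decoupled K (κ k))).toReal := by
    refine integral_le_sum_klDiv μ x hx (fun _ => K) (fun k => decoupled K (κ k)) hfin
      ((hgm.comp (hV.prodMk hd)).log.sub (hpm.comp (hZ.prodMk hV))) (hi1.sub hint) ?_
    set κn := piKernel (fun k => (κ k).comap (fun y : Fin n → 𝒴₂ => y k) (by fun_prop)) with hκn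
    set G : (Fin n → 𝒴₂) → Fin M → (Fin n → 𝒴₁) → ℝ≥0∞ := fun z w y =>
      ENNReal.ofReal (Real.exp (-Real.log ((post z).real {w}))) *
        ENNReal.ofReal (guess M w (dec y)) with hG
    have hGm : Measurable fun p : ((Fin n → 𝒴₂) × Fin M) × (Fin n → 𝒴₁) => G p.1.1 p.1.2 p.2 :=
      ((hpm.comp measurable_fst).neg.exp.ennreal_ofReal).mul (hgm.comp
        ((measurable_snd.comp measurable_fst).prodMk (hdec.comp measurable_snd))).ennreal_ofReal
    have hGm' : Measurable fun q : (Fin n → 𝒴₂) × Fin M => ∫⁻ y, G q.1 q.2 y ∂κn q.1 := by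
      have := hGm.lintegral_kernel_prod_right' (κ := κn.comap Prod.fst measurable_fst)
      exact this
    calc ∫⁻ ω, ENNReal.ofReal (Real.exp
          (Real.log (guess M (V ω) (d ω)) - Real.log ((post (Z ω)).real {V ω})))
          ∂(μ ⊗ₘ piKernel fun k => (decoupled K (κ k)).comap (fun t => x t k) (by fun_prop))
        = ∫⁻ ω, G (Z ω) (V ω) (fun k => (ω.2 k).1)
          ∂(μ ⊗ₘ piKernel fun k => (decoupled K (κ k)).comap (fun t => x t k) (by fun_prop)) := by
          refine lintegral_congr fun ω => ?_
          rw [sub_eq_add_neg, add_comm, Real.exp_add, Real.exp_log (guess_pos _ _),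
            ENNReal.ofReal_mul (Real.exp_nonneg _)]
      _ = ∫⁻ ω, ∫⁻ y, G (Z ω) (V ω) y ∂κn (Z ω) ∂P := by
          have hm1 : Measurable fun ω : T × (Fin n → 𝒴₁ × 𝒴₂) =>
              G (Z ω) (V ω) (fun k => (ω.2 k).1) :=
            hGm.comp (g := fun p : ((Fin n → 𝒴₂) × Fin M) × (Fin n → 𝒴₁) => G p.1.1 p.1.2 p.2)
              (f := fun ω => ((Z ω, V ω), fun k => (ω.2 k).1)) (by fun_prop)
          have hm2 : Measurable fun ω => ∫⁻ y, G (Z ω) (V ω) y ∂κn (Z ω) :=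
            hGm'.comp (hZ.prodMk hV)
          rw [hP, hmem, Measure.lintegral_compProd hm1, Measure.lintegral_compProd hm2]
          refine lintegral_congr fun t => ?_
          simp only [piKernel_apply, Kernel.comap_apply]
          exact lintegral_pi_decoupled K κ (x t) (fun z y => G z (W t) y)
            (hGm.comp (g := fun p : ((Fin n → 𝒴₂) × Fin M) × (Fin n → 𝒴₁) => G p.1.1 p.1.2 p.2)
              (f := fun q : (Fin n → 𝒴₂) × (Fin n → 𝒴₁) => ((q.1, W t), q.2)) (by fun_prop))
      _ = ∫⁻ z, ∫⁻ w, ∫⁻ y, G z w y ∂κn z ∂post z ∂(P.map Z) := by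
          rw [← Measure.lintegral_compProd hGm', compProd_map_condDistrib hV.aemeasurable,
            lintegral_map hGm' (hZ.prodMk hV)]
      -- Integrating over `w` with the posterior weights cancels the factor `exp (-log post)`. What
      -- remains is the total mass of `guess`, at most 1 for every decoded message.
      _ ≤ ∫⁻ z, 1 ∂(P.map Z) := by
          refine lintegral_mono fun z => ?_
          rw [lintegral_fintype]
          calc ∑ w, (∫⁻ y, G z w y ∂κn z) * post z {w}
              ≤ ∑ w, ∫⁻ y, ENNReal.ofReal (guess M w (dec y)) ∂κn z := by
                refine Finset.sum_le_sum fun w _ => ?_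
                rw [hG]
                simp only
                rw [lintegral_const_mul _ (by
                  exact (hgm.comp (measurable_const.prodMk hdec)).ennreal_ofReal),
                  mul_right_comm, ← ofReal_measureReal (μ := post z) (s := {w})]
                exact mul_le_of_le_one_left' (exp_neg_log_mul_le_one _ measureReal_nonneg)
            _ = ∫⁻ y, ∑ w, ENNReal.ofReal (guess M w (dec y)) ∂κn z := by
                have hm3 : ∀ w : Fin M, Measurable fun y => ENNReal.ofReal (guess M w (dec y)) :=
                  fun w => (hgm.comp (measurable_const.prodMk hdec)).ennreal_ofReal
                rw [lintegral_finsetSum _ fun w _ => hm3 w]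
            _ ≤ ∫⁻ y, 1 ∂κn z := by
                refine lintegral_mono fun y => ?_
                rw [← ENNReal.ofReal_sum_of_nonneg fun w _ => (guess_pos w _).le]
                exact ENNReal.ofReal_le_one.2 (sum_guess_le _)
            _ = 1 := by simp
      _ = 1 := by
          have : IsProbabilityMeasure (P.map Z) := Measure.isProbabilityMeasure_map hZ.aemeasurable
          simp
  rw [integral_sub hi1 hint, hi2] at hmain
  rw [hent]
  have : P.real {ω | d ω ≠ V ω} = P.real {ω | dec (fun k => (ω.2 k).1) ≠ W ω.1} := rfl
  linarith

end Block

/-! ### Single-letter divergences and conditional mutual information -/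

/-- Sampling `ω` and then a fresh `y` from `η (Z ω)` produces the reference law of a conditional
mutual information. This form avoids all handling of the kernel `condDistrib X Z μ`. -/
theorem lintegral_compProd_condDistrib_prod {Ω α β γ : Type*} [MeasurableSpace Ω]
    [MeasurableSpace α] [StandardBorelSpace α] [Nonempty α] [MeasurableSpace β]
    [MeasurableSpace γ] {X : Ω → α} {Z : Ω → γ} (hX : Measurable X) (hZ : Measurable Z)
    (μ : Measure Ω) [IsFiniteMeasure μ] (η : Kernel γ β) [IsMarkovKernel η]
    {F : γ × α × β → ℝ≥0∞} (hF : Measurable F) :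
    ∫⁻ q, F q ∂(μ.map Z ⊗ₘ (condDistrib X Z μ ×ₖ η)) =
      ∫⁻ ω, ∫⁻ y, F (Z ω, X ω, y) ∂η (Z ω) ∂μ := by
  have hm : Measurable fun p : γ × α => ∫⁻ y, F (p.1, p.2, y) ∂η p.1 := by
    have h : Measurable fun q : (γ × α) × β => F (q.1.1, q.1.2, q.2) := by fun_prop
    exact h.lintegral_kernel_prod_right' (κ := η.comap Prod.fst measurable_fst)
  rw [Measure.lintegral_compProd hF, ← lintegral_map (f := fun p : γ × α =>
    ∫⁻ y, F (p.1, p.2, y) ∂η p.1) hm (hZ.prodMk hX), ← compProd_map_condDistrib hX.aemeasurable,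
    Measure.lintegral_compProd hm]
  refine lintegral_congr fun z => ?_
  rw [Kernel.prod_apply, lintegral_prod _ (by fun_prop)]

theorem klDiv_eq_condMutualInfo_mul {Ω α β γ : Type*} [MeasurableSpace Ω]
    [MeasurableSpace α] [StandardBorelSpace α] [Nonempty α]
    [MeasurableSpace β] [StandardBorelSpace β] [Nonempty β] [MeasurableSpace γ]
    (X : Ω → α) (Y : Ω → β) (Z : Ω → γ) (μ : Measure Ω) [IsFiniteMeasure μ] :
    klDiv (μ.map fun ω => (Z ω, X ω, Y ω))
      (μ.map Z ⊗ₘ (condDistrib X Z μ ×ₖ condDistrib Y Z μ)) =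
    condMutualInfo X Y Z μ * ENNReal.ofReal (Real.log 2) := by
  rw [condMutualInfo, ENNReal.div_mul_cancel]
  · simpa using Real.log_pos one_lt_two
  · exact ENNReal.ofReal_ne_top

section Letter

variable {𝒳₁ 𝒳₂ 𝒴₁ 𝒴₂ : Type*}
  [MeasurableSpace 𝒳₁] [MeasurableSpace 𝒳₂] [MeasurableSpace 𝒴₁] [MeasurableSpace 𝒴₂]

theorem lintegral_compProd_decoupled {𝒳 : Type*} [MeasurableSpace 𝒳] (p : Measure 𝒳) [SFinite p]
    (K : Kernel 𝒳 (𝒴₁ × 𝒴₂)) [IsMarkovKernel K] (κ : Kernel 𝒴₂ 𝒴₁) [IsMarkovKernel κ]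
    {F : 𝒳 × 𝒴₁ × 𝒴₂ → ℝ≥0∞} (hF : Measurable F) :
    ∫⁻ q, F q ∂(p ⊗ₘ decoupled K κ) =
      ∫⁻ x, ∫⁻ y, ∫⁻ u, F (x, u, y.2) ∂κ y.2 ∂K x ∂p := by
  rw [Measure.lintegral_compProd hF]
  refine lintegral_congr fun x => ?_
  have hm : Measurable fun y : 𝒴₂ => ∫⁻ u, F (x, u, y) ∂κ y := by
    have h : Measurable fun q : 𝒴₂ × 𝒴₁ => F (x, q.2, q.1) := by fun_prop
    exact h.lintegral_kernel_prod_right'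
  rw [decoupled_apply, lintegral_map (by fun_prop) measurable_swap,
    Measure.lintegral_compProd (by fun_prop), Kernel.snd_apply]
  exact lintegral_map hm measurable_snd

/-- The channel whose second output is the input of the helper. -/
def revealHelper (K : Kernel (𝒳₁ × 𝒳₂) (𝒴₁ × 𝒴₂)) : Kernel (𝒳₁ × 𝒳₂) (𝒴₁ × 𝒳₂) :=
  K.fst ×ₖ Kernel.deterministic Prod.snd measurable_snd

instance (K : Kernel (𝒳₁ × 𝒳₂) (𝒴₁ × 𝒴₂)) [IsMarkovKernel K] :
    IsMarkovKernel (revealHelper K) := by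
  unfold revealHelper; infer_instance

theorem fst_revealHelper (K : Kernel (𝒳₁ × 𝒳₂) (𝒴₁ × 𝒴₂)) [IsMarkovKernel K] :
    (revealHelper K).fst = K.fst := Kernel.fst_prod _ _

theorem snd_revealHelper (K : Kernel (𝒳₁ × 𝒳₂) (𝒴₁ × 𝒴₂)) [IsMarkovKernel K] :
    (revealHelper K).snd = Kernel.deterministic Prod.snd measurable_snd := Kernel.snd_prod _ _

theorem lintegral_revealHelper (K : Kernel (𝒳₁ × 𝒳₂) (𝒴₁ × 𝒴₂)) [IsMarkovKernel K]
    (x : 𝒳₁ × 𝒳₂) {F : 𝒴₁ × 𝒳₂ → ℝ≥0∞} (hF : Measurable F) :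
    ∫⁻ y, F y ∂revealHelper K x = ∫⁻ y, F (y.1, x.2) ∂K x := by
  rw [revealHelper, Kernel.prod_apply, lintegral_prod _ (by fun_prop), Kernel.fst_apply,
    lintegral_map (by fun_prop) measurable_fst]
  refine lintegral_congr fun y => ?_
  rw [Kernel.deterministic_apply, lintegral_dirac' _ (by fun_prop)]

variable [StandardBorelSpace 𝒳₁] [StandardBorelSpace 𝒳₂] [StandardBorelSpace 𝒴₁]
  [StandardBorelSpace 𝒴₂] [Nonempty 𝒳₁] [Nonempty 𝒳₂] [Nonempty 𝒴₁] [Nonempty 𝒴₂]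

/-- When the redrawing kernel is the conditional law of `Y₁` given `Y₂`, the decoupled law is the
reference law of `I(X₁,X₂;Y₁|Y₂)` with its coordinates permuted. Data processing under the
permutation gives the inequality. -/
theorem klDiv_decoupled_le_genieInfo (K : Kernel (𝒳₁ × 𝒳₂) (𝒴₁ × 𝒴₂)) [IsMarkovKernel K]
    (p₁ : Measure 𝒳₁) (p₂ : Measure 𝒳₂) [IsProbabilityMeasure p₁] [IsProbabilityMeasure p₂] :
    klDiv (p₁.prod p₂ ⊗ₘ K) (p₁.prod p₂ ⊗ₘ decoupled K
        (condDistrib (fun ω => ω.2.1) (fun ω => ω.2.2) (p₁.prod p₂ ⊗ₘ K))) ≤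
      genieInfo K p₁ p₂ * ENNReal.ofReal (Real.log 2) := by
  rw [genieInfo, ← klDiv_eq_condMutualInfo_mul]
  set ν := p₁.prod p₂ ⊗ₘ K
  set κ := condDistrib (fun ω : (𝒳₁ × 𝒳₂) × 𝒴₁ × 𝒴₂ => ω.2.1) (fun ω => ω.2.2) ν
  have : IsProbabilityMeasure (ν.map fun ω => ω.2.2) :=
    Measure.isProbabilityMeasure_map (by fun_prop)
  have : IsProbabilityMeasure (ν.map fun ω => (ω.2.2, ω.1, ω.2.1)) :=
    Measure.isProbabilityMeasure_map (by fun_prop)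
  refine le_trans (le_of_eq ?_) (klDiv_map_le _ _
    (g := fun q : 𝒴₂ × (𝒳₁ × 𝒳₂) × 𝒴₁ => (q.2.1, q.2.2, q.1)) (by fun_prop))
  congr 1
  · rw [Measure.map_map (by fun_prop) (by fun_prop)]
    exact Measure.map_id.symm
  · refine Measure.ext_of_lintegral _ fun F hF => ?_
    rw [lintegral_map hF (by fun_prop), lintegral_compProd_condDistrib_prod (by fun_prop)
      (by fun_prop) _ _ (by fun_prop), lintegral_compProd_decoupled _ _ _ hF]
    have h : Measurable fun q : ((𝒳₁ × 𝒳₂) × 𝒴₁ × 𝒴₂) × 𝒴₁ => F (q.1.1, q.2, q.1.2.2) := by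
      fun_prop
    refine Eq.trans ?_ (Measure.lintegral_compProd (h.lintegral_kernel_prod_right'
      (κ := κ.comap (fun ω => ω.2.2) (by fun_prop)))).symm
    rfl

/-- Here the second output is `X₂` itself, so redrawing `Y₁` from it gives the reference law of
`I(X₁;Y₁|X₂)`. The relabelling map writes the coordinate `x₂` twice, as an input and as an output.
-/
theorem klDiv_decoupled_revealHelper_le_directInfo (K : Kernel (𝒳₁ × 𝒳₂) (𝒴₁ × 𝒴₂))
    [IsMarkovKernel K] (p₁ : Measure 𝒳₁) (p₂ : Measure 𝒳₂) [IsProbabilityMeasure p₁]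
    [IsProbabilityMeasure p₂] :
    klDiv (p₁.prod p₂ ⊗ₘ revealHelper K) (p₁.prod p₂ ⊗ₘ decoupled (revealHelper K)
        (condDistrib (fun ω => ω.2.1) (fun ω => ω.1.2) (p₁.prod p₂ ⊗ₘ K))) ≤
      directInfo K p₁ p₂ * ENNReal.ofReal (Real.log 2) := by
  rw [directInfo, ← klDiv_eq_condMutualInfo_mul]
  set ν := p₁.prod p₂ ⊗ₘ K
  set κ := condDistrib (fun ω : (𝒳₁ × 𝒳₂) × 𝒴₁ × 𝒴₂ => ω.2.1) (fun ω => ω.1.2) ν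
  have : IsProbabilityMeasure (ν.map fun ω => ω.1.2) :=
    Measure.isProbabilityMeasure_map (by fun_prop)
  have : IsProbabilityMeasure (ν.map fun ω => (ω.1.2, ω.1.1, ω.2.1)) :=
    Measure.isProbabilityMeasure_map (by fun_prop)
  refine le_trans (le_of_eq ?_) (klDiv_map_le _ _
    (g := fun q : 𝒳₂ × 𝒳₁ × 𝒴₁ => ((q.2.1, q.1), q.2.2, q.1)) (by fun_prop))
  congr 1
  · refine Measure.ext_of_lintegral _ fun F hF => ?_
    rw [lintegral_map hF (by fun_prop), lintegral_map (by fun_prop) (by fun_prop),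
      Measure.lintegral_compProd hF, Measure.lintegral_compProd (by fun_prop)]
    refine lintegral_congr fun x => ?_
    rw [lintegral_revealHelper K x (by fun_prop)]
  · refine Measure.ext_of_lintegral _ fun F hF => ?_
    rw [lintegral_map hF (by fun_prop), lintegral_compProd_condDistrib_prod (by fun_prop)
      (by fun_prop) _ _ (by fun_prop), lintegral_compProd_decoupled _ _ _ hF]
    have h : Measurable fun q : ((𝒳₁ × 𝒳₂) × 𝒴₁ × 𝒴₂) × 𝒴₁ =>
      F ((q.1.1.1, q.1.1.2), q.2, q.1.1.2) := by fun_prop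
    refine Eq.trans ?_ (Measure.lintegral_compProd (h.lintegral_kernel_prod_right'
      (κ := κ.comap (fun ω => ω.1.2) (by fun_prop)))).symm
    refine lintegral_congr fun x => ?_
    have h' : Measurable fun q : 𝒳₂ × 𝒴₁ => F (x, q.2, q.1) := by fun_prop
    exact lintegral_revealHelper K x (F := fun y => ∫⁻ u, F (x, u, y.2) ∂κ y.2)
      ((h'.lintegral_kernel_prod_right' (κ := κ)).comp measurable_snd)

end Letter

/-! ### Codes -/

theorem condEntropy_eq_of_map_eq {Ω Ω' ι γ : Type*} [MeasurableSpace Ω] [MeasurableSpace Ω']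
    [Fintype ι] [Nonempty ι] [MeasurableSpace ι] [StandardBorelSpace ι] [MeasurableSpace γ]
    {W : Ω → ι} {Z : Ω → γ} {W' : Ω' → ι} {Z' : Ω' → γ} {μ : Measure Ω} {μ' : Measure Ω'}
    [IsFiniteMeasure μ] [IsFiniteMeasure μ']
    (hW : Measurable W) (hZ : Measurable Z) (hW' : Measurable W') (hZ' : Measurable Z')
    (h : μ.map (fun ω => (Z ω, W ω)) = μ'.map fun ω => (Z' ω, W' ω)) :
    condEntropy W Z μ = condEntropy W' Z' μ' := by
  have hc : condDistrib W Z μ = condDistrib W' Z' μ' := by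
    rw [condDistrib, condDistrib]
    congr
  have hZZ : μ.map Z = μ'.map Z' := by
    have h1 := congrArg (Measure.map Prod.fst) h
    rwa [Measure.map_map measurable_fst (hZ.prodMk hW),
      Measure.map_map measurable_fst (hZ'.prodMk hW')] at h1
  rw [condEntropy, condEntropy, hc, hZZ]

namespace Code

variable {𝒳₁ 𝒳₂ 𝒴₁ 𝒴₂ 𝒵 : Type*}
  [MeasurableSpace 𝒳₁] [MeasurableSpace 𝒳₂] [MeasurableSpace 𝒴₁] [MeasurableSpace 𝒴₂]
  [MeasurableSpace 𝒵] {M n : ℕ} [NeZero M]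

/-- The joint law of the message and the channel inputs. -/
def inputLaw (C : Code 𝒳₁ 𝒳₂ 𝒴₁ M n) : Measure ((Fin M × (Fin n → 𝒳₁)) × (Fin n → 𝒳₂)) :=
  ((PMF.uniformOfFintype (Fin M)).toMeasure ⊗ₘ C.enc₁).prod C.enc₂

instance (C : Code 𝒳₁ 𝒳₂ 𝒴₁ M n) : IsProbabilityMeasure C.inputLaw := by
  unfold inputLaw; infer_instance

/-- The law of the `k`-th letter of the encoder. -/
def letter₁ (C : Code 𝒳₁ 𝒳₂ 𝒴₁ M n) (k : Fin n) : Measure 𝒳₁ :=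
  ((PMF.uniformOfFintype (Fin M)).toMeasure ⊗ₘ C.enc₁).map fun t => t.2 k

/-- The law of the `k`-th letter of the helper. -/
def letter₂ (C : Code 𝒳₁ 𝒳₂ 𝒴₁ M n) (k : Fin n) : Measure 𝒳₂ := C.enc₂.map fun t => t k

instance (C : Code 𝒳₁ 𝒳₂ 𝒴₁ M n) (k : Fin n) : IsProbabilityMeasure (C.letter₁ k) :=
  Measure.isProbabilityMeasure_map (by fun_prop)

instance (C : Code 𝒳₁ 𝒳₂ 𝒴₁ M n) (k : Fin n) : IsProbabilityMeasure (C.letter₂ k) :=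
  Measure.isProbabilityMeasure_map (measurable_pi_apply k).aemeasurable

theorem inputLaw_map_letter (C : Code 𝒳₁ 𝒳₂ 𝒴₁ M n) (k : Fin n) :
    C.inputLaw.map (fun t => (t.1.2 k, t.2 k)) = (C.letter₁ k).prod (C.letter₂ k) := by
  rw [inputLaw, letter₁, letter₂, Measure.map_prod_map _ _ (by fun_prop) (by fun_prop)]
  rfl

theorem law_eq (C : Code 𝒳₁ 𝒳₂ 𝒴₁ M n) (K : Kernel (𝒳₁ × 𝒳₂) (𝒴₁ × 𝒴₂)) [IsMarkovKernel K] :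
    C.law K = C.inputLaw ⊗ₘ
      (memoryless K n).comap (fun t k => (t.1.2 k, t.2 k)) (by fun_prop) := rfl

theorem law_map_fst (C : Code 𝒳₁ 𝒳₂ 𝒴₁ M n) (K : Kernel (𝒳₁ × 𝒳₂) (𝒴₁ × 𝒴₂))
    [IsMarkovKernel K] : (C.law K).map Prod.fst = C.inputLaw :=
  Measure.fst_compProd _ _

/-- With `π` a projection, this shows that the receiver and the eavesdropper each see only their own
marginal of the channel. It is the reason why `K` can be exchanged for any channel with the same
marginals. -/
theorem law_map_output {𝒴 : Type*} [MeasurableSpace 𝒴] (C : Code 𝒳₁ 𝒳₂ 𝒴₁ M n)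
    (K : Kernel (𝒳₁ × 𝒳₂) (𝒴₁ × 𝒴₂)) [IsMarkovKernel K] {π : 𝒴₁ × 𝒴₂ → 𝒴} (hπ : Measurable π)
    (L : Kernel (𝒳₁ × 𝒳₂) 𝒴) [IsMarkovKernel L] (hL : K.map π = L) :
    (C.law K).map (fun ω => (ω.1, fun k => π (ω.2 k))) = C.inputLaw ⊗ₘ
      (memoryless L n).comap (fun t k => (t.1.2 k, t.2 k)) (by fun_prop) := by
  refine Measure.ext_of_lintegral _ fun F hF => ?_
  rw [lintegral_map hF (by fun_prop), law_eq, Measure.lintegral_compProd (by fun_prop),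
    Measure.lintegral_compProd hF]
  refine lintegral_congr fun t => ?_
  have h : (memoryless L n fun k => (t.1.2 k, t.2 k)) =
      (memoryless K n fun k => (t.1.2 k, t.2 k)).map fun y k => π (y k) := by
    have : ∀ k, IsProbabilityMeasure ((K (t.1.2 k, t.2 k)).map π) := fun k =>
      Measure.isProbabilityMeasure_map hπ.aemeasurable
    change Measure.pi _ = (Measure.pi _).map _
    rw [Measure.pi_map_pi fun k => hπ.aemeasurable]
    simp_rw [← hL, Kernel.map_apply _ hπ]
  rw [Kernel.comap_apply, Kernel.comap_apply, h, lintegral_map (by fun_prop) (by fun_prop)]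

theorem errorProb_congr (C : Code 𝒳₁ 𝒳₂ 𝒴₁ M n) (K : Kernel (𝒳₁ × 𝒳₂) (𝒴₁ × 𝒴₂))
    [IsMarkovKernel K] (K' : Kernel (𝒳₁ × 𝒳₂) (𝒴₁ × 𝒵)) [IsMarkovKernel K']
    (h : K'.fst = K.fst) : C.errorProb K' = C.errorProb K := by
  have hs : MeasurableSet
      {q : ((Fin M × (Fin n → 𝒳₁)) × (Fin n → 𝒳₂)) × (Fin n → 𝒴₁) | C.dec q.2 ≠ q.1.1.1} :=
    (measurableSet_eq_fun (C.measurable_dec.comp measurable_snd) (by fun_prop)).compl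
  have e1 := congrArg (fun μ => μ.real {q | C.dec q.2 ≠ q.1.1.1})
    ((C.law_map_output K' measurable_fst K.fst (by rw [← h, Kernel.fst_eq])).trans
      (C.law_map_output K measurable_fst K.fst (Kernel.fst_eq K).symm).symm)
  beta_reduce at e1
  rwa [map_measureReal_apply (by fun_prop) hs, map_measureReal_apply (by fun_prop) hs] at e1

theorem equivocation_congr (C : Code 𝒳₁ 𝒳₂ 𝒴₁ M n) (K K' : Kernel (𝒳₁ × 𝒳₂) (𝒴₁ × 𝒴₂))
    [IsMarkovKernel K] [IsMarkovKernel K'] (h : K'.snd = K.snd) :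
    C.equivocation K' = C.equivocation K := by
  refine condEntropy_eq_of_map_eq (by fun_prop) (by fun_prop) (by fun_prop) (by fun_prop) ?_
  have e1 := congrArg (Measure.map fun q => (q.2, q.1.1.1))
    ((C.law_map_output K' measurable_snd K.snd (by rw [← h, Kernel.snd_eq])).trans
      (C.law_map_output K measurable_snd K.snd (Kernel.snd_eq K).symm).symm)
  rwa [Measure.map_map (by fun_prop) (by fun_prop), Measure.map_map (by fun_prop) (by fun_prop)]
    at e1

theorem lintegral_letter₁ (C : Code 𝒳₁ 𝒳₂ 𝒴₁ M n) (K : Kernel (𝒳₁ × 𝒳₂) (𝒴₁ × 𝒴₂))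
    [IsMarkovKernel K] {c : 𝒳₁ → ℝ≥0∞} (hc : Measurable c) (k : Fin n) :
    ∫⁻ ω, c (ω.1.1.2 k) ∂(C.law K) = ∫⁻ x, c x ∂(C.letter₁ k) := by
  have h := C.inputLaw_map_letter k
  rw [← C.law_map_fst K, Measure.map_map (by fun_prop) (by fun_prop)] at h
  have h1 := congrArg (fun μ => ∫⁻ x, c x ∂(μ.map Prod.fst)) h
  beta_reduce at h1
  rwa [Measure.map_fst_prod, measure_univ, one_smul, Measure.map_map (by fun_prop) (by fun_prop),
    lintegral_map hc (by fun_prop)] at h1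

theorem lintegral_letter₂ (C : Code 𝒳₁ 𝒳₂ 𝒴₁ M n) (K : Kernel (𝒳₁ × 𝒳₂) (𝒴₁ × 𝒴₂))
    [IsMarkovKernel K] {c : 𝒳₂ → ℝ≥0∞} (hc : Measurable c) (k : Fin n) :
    ∫⁻ ω, c (ω.1.2 k) ∂(C.law K) = ∫⁻ x, c x ∂(C.letter₂ k) := by
  have h := C.inputLaw_map_letter k
  rw [← C.law_map_fst K, Measure.map_map (by fun_prop) (by fun_prop)] at h
  have h1 := congrArg (fun μ => ∫⁻ x, c x ∂(μ.map Prod.snd)) h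
  beta_reduce at h1
  rwa [Measure.map_snd_prod, measure_univ, one_smul, Measure.map_map (by fun_prop) (by fun_prop),
    lintegral_map hc (by fun_prop)] at h1

/-- The eavesdropper sees `X₂ⁿ`, which is independent of the message, so the posterior is uniform.
-/
theorem equivocation_revealHelper (C : Code 𝒳₁ 𝒳₂ 𝒴₁ M n) (K : Kernel (𝒳₁ × 𝒳₂) (𝒴₁ × 𝒴₂))
    [IsMarkovKernel K] : C.equivocation (revealHelper K) = Real.logb 2 M := by
  have hlaw : (C.law (revealHelper K)).map (fun ω => ((fun k => (ω.2 k).2), ω.1.1.1)) =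
      C.enc₂.prod (PMF.uniformOfFintype (Fin M)).toMeasure := by
    have h1 := congrArg (Measure.map fun q => (q.2, q.1.1.1)) (C.law_map_output (revealHelper K)
      measurable_snd (Kernel.deterministic Prod.snd measurable_snd)
      ((Kernel.snd_eq _).symm.trans (snd_revealHelper K)))
    rw [Measure.map_map (by fun_prop) (by fun_prop)] at h1
    refine h1.trans (Measure.ext_of_lintegral _ fun F hF => ?_)
    rw [lintegral_map hF (by fun_prop), Measure.lintegral_compProd (by fun_prop)]
    have h2 : ∀ t : (Fin M × (Fin n → 𝒳₁)) × (Fin n → 𝒳₂),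
        memoryless (Kernel.deterministic Prod.snd (measurable_snd (α := 𝒳₁) (β := 𝒳₂))) n
          (fun k => (t.1.2 k, t.2 k)) = Measure.dirac t.2 := fun t => by
      change Measure.pi _ = _
      simp only [Kernel.deterministic_apply]
      refine Measure.pi_eq fun s hs => ?_
      rw [Measure.dirac_apply' _ (MeasurableSet.univ_pi hs)]
      simp_rw [Measure.dirac_apply' _ (hs _)]
      by_cases ht : t.2 ∈ Set.univ.pi s
      · rw [Set.indicator_of_mem ht]
        exact (Finset.prod_eq_one fun k _ => Set.indicator_of_mem (ht k trivial) _).symm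
      · rw [Set.indicator_of_notMem ht]
        simp only [Set.mem_pi, not_forall] at ht
        obtain ⟨k, _, hk⟩ := ht
        exact (Finset.prod_eq_zero (Finset.mem_univ k) (Set.indicator_of_notMem hk _)).symm
    have h3 : ∀ t : (Fin M × (Fin n → 𝒳₁)) × (Fin n → 𝒳₂),
        ∫⁻ z, F (z, t.1.1) ∂(memoryless (Kernel.deterministic Prod.snd
          (measurable_snd (α := 𝒳₁) (β := 𝒳₂))) n fun k => (t.1.2 k, t.2 k)) = F (t.2, t.1.1) :=
      fun t => by rw [h2, lintegral_dirac' _ (by fun_prop)]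
    refine (lintegral_congr h3).trans ?_
    rw [inputLaw, lintegral_prod_symm' _ (by fun_prop), lintegral_prod _ (by fun_prop)]
    refine lintegral_congr fun z => ?_
    rw [Measure.lintegral_compProd (by fun_prop)]
    simp
  have hZ : (C.law (revealHelper K)).map (fun ω k => (ω.2 k).2) = C.enc₂ := by
    have := congrArg (Measure.map Prod.fst) hlaw
    rwa [Measure.map_map (by fun_prop) (by fun_prop), Measure.map_fst_prod, measure_univ,
      one_smul] at this
  set P := C.law (revealHelper K)
  set Z : ((Fin M × (Fin n → 𝒳₁)) × (Fin n → 𝒳₂)) × (Fin n → 𝒴₁ × 𝒳₂) → Fin n → 𝒳₂ :=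
    fun ω k => (ω.2 k).2
  set W : ((Fin M × (Fin n → 𝒳₁)) × (Fin n → 𝒳₂)) × (Fin n → 𝒴₁ × 𝒳₂) → Fin M :=
    fun ω => ω.1.1.1
  have hWm : AEMeasurable W P := by fun_prop
  have hcond : condDistrib W Z P =ᵐ[P.map Z]
      Kernel.const _ (PMF.uniformOfFintype (Fin M)).toMeasure := by
    refine condDistrib_ae_eq_of_measure_eq_compProd Z hWm ?_
    rw [hZ, Measure.compProd_const]
    exact hlaw
  have hM : (M : ℝ) ≠ 0 := Nat.cast_ne_zero.2 (NeZero.ne M)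
  have : IsProbabilityMeasure (P.map Z) := by rw [hZ]; infer_instance
  change (∫ z, ∑ w, Real.negMulLog ((condDistrib W Z P z).real {w}) ∂(P.map Z)) / Real.log 2 = _
  rw [Real.logb]
  congr 1
  rw [integral_congr_ae (g := fun _ => Real.log M)]
  · simp
  · filter_upwards [hcond] with z hz
    rw [hz]
    simp [Measure.real, Real.negMulLog]
    field_simp

variable [StandardBorelSpace 𝒴₁] [StandardBorelSpace 𝒴₂]

theorem equivocation_le_of_klDiv_le (C : Code 𝒳₁ 𝒳₂ 𝒴₁ M n) (K : Kernel (𝒳₁ × 𝒳₂) (𝒴₁ × 𝒴₂))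
    [IsMarkovKernel K] (κ : Fin n → Kernel 𝒴₂ 𝒴₁) [∀ k, IsMarkovKernel (κ k)]
    (I : Fin n → ℝ≥0∞) (hI : ∀ k, I k ≠ ∞)
    (h : ∀ k, klDiv ((C.letter₁ k).prod (C.letter₂ k) ⊗ₘ K)
      ((C.letter₁ k).prod (C.letter₂ k) ⊗ₘ decoupled K (κ k)) ≤
        I k * ENNReal.ofReal (Real.log 2)) :
    C.equivocation K ≤ ∑ k, (I k).toReal + 1 + C.errorProb K * Real.logb 2 M := by
  have hlog : 0 < Real.log 2 := Real.log_pos one_lt_two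
  have hne : ∀ k, I k * ENNReal.ofReal (Real.log 2) ≠ ∞ := fun k =>
    ENNReal.mul_ne_top (hI k) ENNReal.ofReal_ne_top
  have hmain := condEntropy_le_sum_klDiv C.inputLaw (fun t => t.1.1) (by fun_prop)
    (fun t k => (t.1.2 k, t.2 k)) (by fun_prop) K κ C.dec C.measurable_dec
    (fun k => by rw [inputLaw_map_letter]; exact ne_top_of_le_ne_top (hne k) (h k))
  simp_rw [inputLaw_map_letter] at hmain
  have hsum : ∑ k, (klDiv ((C.letter₁ k).prod (C.letter₂ k) ⊗ₘ K)
      ((C.letter₁ k).prod (C.letter₂ k) ⊗ₘ decoupled K (κ k))).toReal ≤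
      (∑ k, (I k).toReal) * Real.log 2 := by
    rw [Finset.sum_mul]
    refine Finset.sum_le_sum fun k _ => (ENNReal.toReal_mono (hne k) (h k)).trans (le_of_eq ?_)
    rw [ENNReal.toReal_mul, ENNReal.toReal_ofReal hlog.le]
  change C.equivocation K * Real.log 2 ≤ _ + Real.log 2 + C.errorProb K * Real.log M at hmain
  rw [← mul_le_mul_iff_left₀ hlog, add_mul, add_mul, one_mul, mul_assoc, Real.logb,
    div_mul_cancel₀ _ hlog.ne']
  linarith

variable [StandardBorelSpace 𝒳₁] [StandardBorelSpace 𝒳₂] [Nonempty 𝒳₁] [Nonempty 𝒳₂]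
  [Nonempty 𝒴₁] [Nonempty 𝒴₂]

theorem equivocation_le (C : Code 𝒳₁ 𝒳₂ 𝒴₁ M n) (K : Kernel (𝒳₁ × 𝒳₂) (𝒴₁ × 𝒴₂))
    [IsMarkovKernel K] (h : ∀ k, genieInfo K (C.letter₁ k) (C.letter₂ k) ≠ ∞) :
    C.equivocation K ≤ ∑ k, (genieInfo K (C.letter₁ k) (C.letter₂ k)).toReal + 1 +
      C.errorProb K * Real.logb 2 M :=
  C.equivocation_le_of_klDiv_le K _ _ h fun _ => klDiv_decoupled_le_genieInfo K _ _

/-- The usual converse with the helper's input known, obtained from the equivocation bound for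
`revealHelper K`, whose first marginal, and hence error probability, is that of `K`. -/
theorem logb_le (C : Code 𝒳₁ 𝒳₂ 𝒴₁ M n) (K : Kernel (𝒳₁ × 𝒳₂) (𝒴₁ × 𝒴₂))
    [IsMarkovKernel K] (h : ∀ k, directInfo K (C.letter₁ k) (C.letter₂ k) ≠ ∞) :
    Real.logb 2 M ≤ ∑ k, (directInfo K (C.letter₁ k) (C.letter₂ k)).toReal + 1 +
      C.errorProb K * Real.logb 2 M := by
  have := C.equivocation_le_of_klDiv_le (revealHelper K) _ _ h fun _ =>
    klDiv_decoupled_revealHelper_le_directInfo K _ _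
  rwa [equivocation_revealHelper, C.errorProb_congr K (revealHelper K) (fst_revealHelper K)]
    at this

end Code

/-! ### Bounds on achievable rates -/

section Rates

variable {𝒳₁ 𝒳₂ 𝒴₁ 𝒴₂ : Type*}
  [MeasurableSpace 𝒳₁] [MeasurableSpace 𝒳₂] [MeasurableSpace 𝒴₁] [MeasurableSpace 𝒴₂]
  {K : Kernel (𝒳₁ × 𝒳₂) (𝒴₁ × 𝒴₂)} [IsMarkovKernel K]
  {c₁ : InputConstraint 𝒳₁} {c₂ : InputConstraint 𝒳₂}

theorem exists_code_of_isAchievable {R D ε : ℝ} (hε : 0 < ε) (hε' : ε ≤ 1 / 2)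
    (hD : ∀ (M n : ℕ) [NeZero M] (C : Code 𝒳₁ 𝒳₂ 𝒴₁ M n), C.Admissible K c₁ c₂ →
      Real.logb 2 M ≤ n * D + 1 + C.errorProb K * Real.logb 2 M)
    (h : IsAchievable K c₁ c₂ R) :
    ∃ (M n : ℕ) (_ : NeZero M) (C : Code 𝒳₁ 𝒳₂ 𝒴₁ M n), C.Admissible K c₁ c₂ ∧ 0 < (n : ℝ) ∧
      1 ≤ n * ε ∧ n * R ≤ Real.logb 2 M ∧ C.errorProb K * Real.logb 2 M ≤ ε * Real.logb 2 M ∧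
      (1 - ε) * Real.logb 2 M ≤ n * D + 1 ∧ R - C.equivocation K / n ≤ ε := by
  obtain ⟨n, ⟨M, hM, C, hadm, hMR, hPe, heq⟩, hn⟩ :=
    ((h ε hε).and (Filter.eventually_ge_atTop ⌈1 / ε⌉₊)).exists
  have hnε : 1 / ε ≤ n := (Nat.le_ceil _).trans (Nat.cast_le.2 hn)
  have hn0 : (0 : ℝ) < n := lt_of_lt_of_le (by positivity) hnε
  have hMpos : (1 : ℝ) ≤ M := Nat.one_le_cast.2 (NeZero.pos M)
  have hlog : 0 ≤ Real.logb 2 M := Real.logb_nonneg one_lt_two hMpos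
  have hPe' := mul_le_mul_of_nonneg_right hPe hlog
  refine ⟨M, n, hM, C, hadm, hn0, ?_, ?_, hPe', ?_, heq⟩
  · rwa [div_le_iff₀ hε] at hnε
  · rw [Real.le_logb_iff_rpow_le one_lt_two (by linarith)]
    exact hMR
  · have := hD M n C hadm
    linarith

theorem rate_le_of_logb_le {R D : ℝ} (hR : 0 ≤ R)
    (hD : ∀ (M n : ℕ) [NeZero M] (C : Code 𝒳₁ 𝒳₂ 𝒴₁ M n), C.Admissible K c₁ c₂ →
      Real.logb 2 M ≤ n * D + 1 + C.errorProb K * Real.logb 2 M)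
    (h : IsAchievable K c₁ c₂ R) : R ≤ D := by
  by_contra! hlt
  -- The code will give `(1 - ε) R ≤ D + ε`, that is, `R - D ≤ ε (1 + R)`.
  obtain ⟨ε, hε, hε'⟩ : ∃ ε : ℝ, 0 < ε ∧ ε ≤ 1 / 2 ∧ ε * (1 + R) < R - D :=
    ⟨min (1 / 2) ((R - D) / (2 * (1 + R))), lt_min (by norm_num)
      (div_pos (by linarith) (by linarith)),
      min_le_left _ _, by
        calc _ ≤ (R - D) / (2 * (1 + R)) * (1 + R) :=
              mul_le_mul_of_nonneg_right (min_le_right _ _) (by linarith)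
          _ = (R - D) / 2 := by field_simp
          _ < R - D := by linarith⟩
  obtain ⟨M, n, _, C, -, hn, hnε, hnR, -, hlog, -⟩ :=
    exists_code_of_isAchievable hε hε'.1 hD h
  have h1 : (1 - ε) * (n * R) ≤ n * D + n * ε :=
    (mul_le_mul_of_nonneg_left hnR (by linarith)).trans (by linarith)
  have h2 : (1 - ε) * R ≤ D + ε := by
    have : n * ((1 - ε) * R) ≤ n * (D + ε) := by linarith
    exact le_of_mul_le_mul_left this hn
  linarith

/-- The Fano term involves `log M`, and `M` is bounded only from below in the definition of
achievability. The finite constant `D` forces `log M = O(n)`, so that the term is a small multiple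
of `n`. -/
theorem rate_le_of_equivocation_le {R D G : ℝ} (hDnn : 0 ≤ D)
    (hD : ∀ (M n : ℕ) [NeZero M] (C : Code 𝒳₁ 𝒳₂ 𝒴₁ M n), C.Admissible K c₁ c₂ →
      Real.logb 2 M ≤ n * D + 1 + C.errorProb K * Real.logb 2 M)
    (hG : ∀ (M n : ℕ) [NeZero M] (C : Code 𝒳₁ 𝒳₂ 𝒴₁ M n), C.Admissible K c₁ c₂ →
      C.equivocation K ≤ n * G + 1 + C.errorProb K * Real.logb 2 M)
    (h : IsAchievable K c₁ c₂ R) : R ≤ G := by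
  by_contra! hlt
  -- Per channel use the losses are `ε` from the secrecy condition, `ε` from the additive 1, and
  -- `2ε(D + ε)` from the Fano term; as `ε ≤ 1` they total at most `ε (2D + 4)`.
  obtain ⟨ε, hε, hε'⟩ : ∃ ε : ℝ, 0 < ε ∧ ε ≤ 1 / 2 ∧ ε * (2 * D + 4) < R - G :=
    ⟨min (1 / 2) ((R - G) / (2 * (2 * D + 4))),
      lt_min (by norm_num)
      (div_pos (by linarith) (by linarith)), min_le_left _ _, by
        calc _ ≤ (R - G) / (2 * (2 * D + 4)) * (2 * D + 4) :=
              mul_le_mul_of_nonneg_right (min_le_right _ _) (by linarith)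
          _ = (R - G) / 2 := by field_simp
          _ < R - G := by linarith⟩
  obtain ⟨M, n, _, C, hadm, hn, hnε, hnR, hPe, hlog, heq⟩ :=
    exists_code_of_isAchievable hε hε'.1 hD h
  have hlog0 : 0 ≤ Real.logb 2 M :=
    Real.logb_nonneg one_lt_two (Nat.one_le_cast.2 (NeZero.pos M))
  have h1 : Real.logb 2 M ≤ 2 * (n * D + n * ε) := by nlinarith [hε'.1]
  have h2 := hG M n C hadm
  have h3 : n * R ≤ C.equivocation K + n * ε := by
    have := mul_le_mul_of_nonneg_left heq hn.le
    rw [mul_sub, mul_div_cancel₀ _ hn.ne'] at this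
    linarith
  have h4 : ε * Real.logb 2 M ≤ ε * (2 * (n * D + n * ε)) :=
    mul_le_mul_of_nonneg_left h1 hε.le
  have h5 : n * R ≤ n * (G + ε * (2 * D + 4)) := by
    have : ε * ε * n ≤ 1 * ε * n := by gcongr; linarith
    nlinarith
  have := le_of_mul_le_mul_left h5 hn
  linarith

variable [StandardBorelSpace 𝒳₁] [StandardBorelSpace 𝒳₂] [StandardBorelSpace 𝒴₁]
  [StandardBorelSpace 𝒴₂] [Nonempty 𝒳₁] [Nonempty 𝒳₂] [Nonempty 𝒴₁] [Nonempty 𝒴₂]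

/-- The hypothesis concerns the sum over the letters of a code, because the input constraints bind
only the block average and single letters may exceed the budget. -/
theorem secrecyCapacity_le_of_directInfo_le {D : ℝ≥0∞}
    (h : ∀ (M n : ℕ) [NeZero M] (C : Code 𝒳₁ 𝒳₂ 𝒴₁ M n), C.Admissible K c₁ c₂ →
      ∑ k, directInfo K (C.letter₁ k) (C.letter₂ k) ≤ n * D) :
    secrecyCapacity K c₁ c₂ ≤ D := by
  rcases eq_or_ne D ∞ with rfl | hD
  · exact le_top
  refine iSup₂_le fun R hR => ?_
  rw [← ENNReal.ofReal_toReal hD, ← ENNReal.ofReal_coe_nnreal]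
  refine ENNReal.ofReal_le_ofReal (rate_le_of_logb_le R.2 (fun M n _ C hC => ?_) hR)
  have hfin : ∑ k, directInfo K (C.letter₁ k) (C.letter₂ k) ≠ ∞ :=
    ne_top_of_le_ne_top (ENNReal.mul_ne_top (by simp) hD) (h M n C hC)
  have hk := fun k => ENNReal.sum_ne_top.1 hfin k (Finset.mem_univ k)
  refine (C.logb_le K hk).trans ?_
  rw [← ENNReal.toReal_sum fun k _ => hk k]
  have := ENNReal.toReal_mono (ENNReal.mul_ne_top (by simp) hD) (h M n C hC)
  rw [ENNReal.toReal_mul, ENNReal.toReal_natCast] at this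
  linarith

theorem secrecyCapacity_le_of_genieInfo_le {D G : ℝ≥0∞} (hD : D ≠ ∞)
    (h : ∀ (M n : ℕ) [NeZero M] (C : Code 𝒳₁ 𝒳₂ 𝒴₁ M n), C.Admissible K c₁ c₂ →
      ∑ k, directInfo K (C.letter₁ k) (C.letter₂ k) ≤ n * D)
    (K' : Kernel (𝒳₁ × 𝒳₂) (𝒴₁ × 𝒴₂)) [IsMarkovKernel K'] (hK' : SameMarginals K' K)
    (hG : ∀ (M n : ℕ) [NeZero M] (C : Code 𝒳₁ 𝒳₂ 𝒴₁ M n), C.Admissible K c₁ c₂ →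
      ∑ k, genieInfo K' (C.letter₁ k) (C.letter₂ k) ≤ n * G) :
    secrecyCapacity K c₁ c₂ ≤ G := by
  rcases eq_or_ne G ∞ with rfl | hGt
  · exact le_top
  refine iSup₂_le fun R hR => ?_
  rw [← ENNReal.ofReal_toReal hGt, ← ENNReal.ofReal_coe_nnreal]
  refine ENNReal.ofReal_le_ofReal (rate_le_of_equivocation_le (D := D.toReal)
    ENNReal.toReal_nonneg (fun M n _ C hC => ?_) (fun M n _ C hC => ?_) hR)
  · have hfin : ∑ k, directInfo K (C.letter₁ k) (C.letter₂ k) ≠ ∞ :=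
      ne_top_of_le_ne_top (ENNReal.mul_ne_top (by simp) hD) (h M n C hC)
    have hk := fun k => ENNReal.sum_ne_top.1 hfin k (Finset.mem_univ k)
    refine (C.logb_le K hk).trans ?_
    rw [← ENNReal.toReal_sum fun k _ => hk k]
    have := ENNReal.toReal_mono (ENNReal.mul_ne_top (by simp) hD) (h M n C hC)
    rw [ENNReal.toReal_mul, ENNReal.toReal_natCast] at this
    linarith
  · have hfin : ∑ k, genieInfo K' (C.letter₁ k) (C.letter₂ k) ≠ ∞ :=
      ne_top_of_le_ne_top (ENNReal.mul_ne_top (by simp) hGt) (hG M n C hC)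
    have hk := fun k => ENNReal.sum_ne_top.1 hfin k (Finset.mem_univ k)
    rw [← C.equivocation_congr K K' hK'.2, ← C.errorProb_congr K K' hK'.1]
    refine (C.equivocation_le K' hk).trans ?_
    rw [← ENNReal.toReal_sum fun k _ => hk k]
    have := ENNReal.toReal_mono (ENNReal.mul_ne_top (by simp) hGt) (hG M n C hC)
    rw [ENNReal.toReal_mul, ENNReal.toReal_natCast] at this
    linarith

theorem genieInfo_le_maxGenieInfo (K : Kernel (𝒳₁ × 𝒳₂) (𝒴₁ × 𝒴₂)) [IsMarkovKernel K]
    (p₁ : Measure 𝒳₁) (p₂ : Measure 𝒳₂)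
    [h₁ : IsProbabilityMeasure p₁] [h₂ : IsProbabilityMeasure p₂]
    (hc₁ : ∫⁻ x, c₁.cost x ∂p₁ ≤ c₁.budget) (hc₂ : ∫⁻ x, c₂.cost x ∂p₂ ≤ c₂.budget) :
    genieInfo K p₁ p₂ ≤ maxGenieInfo K c₁ c₂ :=
  le_iSup_of_le p₁ <| le_iSup_of_le p₂ <| le_iSup_of_le h₁ <| le_iSup_of_le h₂ <|
    le_iSup_of_le hc₁ <| le_iSup_of_le hc₂ le_rfl

theorem directInfo_le_maxDirectInfo (K : Kernel (𝒳₁ × 𝒳₂) (𝒴₁ × 𝒴₂)) [IsMarkovKernel K]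
    (p₁ : Measure 𝒳₁) (p₂ : Measure 𝒳₂)
    [h₁ : IsProbabilityMeasure p₁] [h₂ : IsProbabilityMeasure p₂]
    (hc₁ : ∫⁻ x, c₁.cost x ∂p₁ ≤ c₁.budget) (hc₂ : ∫⁻ x, c₂.cost x ∂p₂ ≤ c₂.budget) :
    directInfo K p₁ p₂ ≤ maxDirectInfo K c₁ c₂ :=
  le_iSup_of_le p₁ <| le_iSup_of_le p₂ <| le_iSup_of_le h₁ <| le_iSup_of_le h₂ <|
    le_iSup_of_le hc₁ <| le_iSup_of_le hc₂ le_rfl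

theorem secrecyCapacity_le_of_none (K : Kernel (𝒳₁ × 𝒳₂) (𝒴₁ × 𝒴₂)) [IsMarkovKernel K]
    (hD : maxDirectInfo K (.none 𝒳₁) (.none 𝒳₂) ≠ ∞) :
    secrecyCapacity K (.none 𝒳₁) (.none 𝒳₂) ≤
      min (satoBound K (.none 𝒳₁) (.none 𝒳₂)) (maxDirectInfo K (.none 𝒳₁) (.none 𝒳₂)) := by
  have hdir : ∀ (M n : ℕ) [NeZero M] (C : Code 𝒳₁ 𝒳₂ 𝒴₁ M n),
      C.Admissible K (.none 𝒳₁) (.none 𝒳₂) →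
      ∑ k, directInfo K (C.letter₁ k) (C.letter₂ k) ≤
        n * maxDirectInfo K (.none 𝒳₁) (.none 𝒳₂) := fun M n _ C _ => by
    refine (Finset.sum_le_card_nsmul _ _ _ fun k _ => directInfo_le_maxDirectInfo
      (c₁ := .none 𝒳₁) (c₂ := .none 𝒳₂) K _ _ (by simp [InputConstraint.none])
      (by simp [InputConstraint.none])).trans ?_
    simp
  refine le_min (le_iInf fun K' => le_iInf fun hK => le_iInf fun hK' => ?_)
    (secrecyCapacity_le_of_directInfo_le hdir)
  refine secrecyCapacity_le_of_genieInfo_le hD hdir K' hK' fun M n _ C _ => ?_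
  refine (Finset.sum_le_card_nsmul _ _ _ fun k _ => genieInfo_le_maxGenieInfo
    (c₁ := .none 𝒳₁) (c₂ := .none 𝒳₂) K' _ _ (by simp [InputConstraint.none])
    (by simp [InputConstraint.none])).trans ?_
  simp

end Rates

/-! ### Bounds on conditional mutual information by Gaussian comparison -/

theorem klDiv_withDensity_exp {Ω : Type*} [MeasurableSpace Ω] {P Q : Measure Ω}
    [IsProbabilityMeasure P] [IsProbabilityMeasure Q] {g : Ω → ℝ} (hg : Measurable g)
    (hint : Integrable g P) (h : P = Q.withDensity fun ω => ENNReal.ofReal (Real.exp (g ω))) :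
    klDiv P Q = ENNReal.ofReal (∫ ω, g ω ∂P) := by
  have hac : P ≪ Q := h ▸ withDensity_absolutelyContinuous _ _
  have hllr : llr P Q =ᵐ[P] g := by
    have h1 : P.rnDeriv Q =ᵐ[Q] fun ω => ENNReal.ofReal (Real.exp (g ω)) := by
      rw [h]
      exact Measure.rnDeriv_withDensity _ (by fun_prop)
    filter_upwards [hac.ae_le h1] with ω hω
    rw [llr, hω, ENNReal.toReal_ofReal (Real.exp_nonneg _), Real.log_exp]
  rw [klDiv_of_ac_of_integrable hac ((integrable_congr hllr).2 hint), integral_congr_ae hllr]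
  simp

section Golden

variable {Ω α β γ : Type*} [MeasurableSpace Ω]
  [MeasurableSpace α] [StandardBorelSpace α] [Nonempty α]
  [MeasurableSpace β] [StandardBorelSpace β] [Nonempty β] [MeasurableSpace γ]
  {X : Ω → α} {Y : Ω → β} {Z : Ω → γ} {μ : Measure Ω} [IsProbabilityMeasure μ]

theorem lintegral_compProd_prod_swap (ν : Measure γ) [SFinite ν] (κ : Kernel γ α) (η : Kernel γ β)
    [IsMarkovKernel κ] [IsMarkovKernel η] {F : γ × α × β → ℝ≥0∞} (hF : Measurable F) :
    ∫⁻ q, F q ∂(ν ⊗ₘ (κ ×ₖ η)) = ∫⁻ q, F (q.1.1, q.2, q.1.2)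
      ∂(ν ⊗ₘ η ⊗ₘ κ.comap Prod.fst measurable_fst) := by
  have h : Measurable fun q : (γ × β) × α => F (q.1.1, q.2, q.1.2) := by fun_prop
  rw [Measure.lintegral_compProd hF, Measure.lintegral_compProd h,
    Measure.lintegral_compProd h.lintegral_kernel_prod_right']
  refine lintegral_congr fun z => ?_
  rw [Kernel.prod_apply, lintegral_prod_symm' _ (by fun_prop)]
  rfl

/-- Replacing the conditional law of `Y` given `Z` by any other kernel does not decrease the
divergence. -/
theorem condMutualInfo_mul_le (hX : Measurable X) (hY : Measurable Y) (hZ : Measurable Z)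
    (κ : Kernel γ β) [IsMarkovKernel κ] :
    condMutualInfo X Y Z μ * ENNReal.ofReal (Real.log 2) ≤
      klDiv (μ.map fun ω => (Z ω, X ω, Y ω)) (μ.map Z ⊗ₘ (condDistrib X Z μ ×ₖ κ)) := by
  rw [← klDiv_eq_condMutualInfo_mul]
  have : IsProbabilityMeasure (μ.map Z) := Measure.isProbabilityMeasure_map hZ.aemeasurable
  have hYZ : Measurable fun ω => (Z ω, Y ω) := hZ.prodMk hY
  have : IsProbabilityMeasure (μ.map fun ω => (Z ω, Y ω)) :=
    Measure.isProbabilityMeasure_map hYZ.aemeasurable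
  have hZXY : Measurable fun ω => (Z ω, X ω, Y ω) := hZ.prodMk (hX.prodMk hY)
  have : IsProbabilityMeasure (μ.map fun ω => (Z ω, X ω, Y ω)) :=
    Measure.isProbabilityMeasure_map hZXY.aemeasurable
  set B : Kernel (γ × β) α := (condDistrib X Z μ).comap Prod.fst measurable_fst
  set A : Kernel (γ × β) α := condDistrib X (fun ω => (Z ω, Y ω)) μ
  have he : Measurable fun q : (γ × β) × α => (q.1.1, q.2, q.1.2) := by fun_prop
  have he' : Measurable fun q : γ × α × β => ((q.1, q.2.2), q.2.1) := by fun_prop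
  have hA : (μ.map fun ω => (Z ω, Y ω)) ⊗ₘ A = μ.map fun ω => ((Z ω, Y ω), X ω) :=
    compProd_map_condDistrib hX.aemeasurable
  have hR : ∀ η : Kernel γ β, IsMarkovKernel η → (μ.map Z ⊗ₘ (condDistrib X Z μ ×ₖ η)) =
      (μ.map Z ⊗ₘ η ⊗ₘ B).map fun q => (q.1.1, q.2, q.1.2) := fun η _ =>
    Measure.ext_of_lintegral _ fun F hF => by
      rw [lintegral_map hF he, lintegral_compProd_prod_swap _ _ _ hF]
  calc klDiv (μ.map fun ω => (Z ω, X ω, Y ω))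
        (μ.map Z ⊗ₘ (condDistrib X Z μ ×ₖ condDistrib Y Z μ))
      = klDiv (((μ.map fun ω => (Z ω, Y ω)) ⊗ₘ A).map fun q => (q.1.1, q.2, q.1.2))
        (((μ.map fun ω => (Z ω, Y ω)) ⊗ₘ B).map fun q => (q.1.1, q.2, q.1.2)) := by
        congr 1
        · rw [hA, Measure.map_map he (hYZ.prodMk hX)]
          rfl
        · rw [hR _ inferInstance, compProd_map_condDistrib hY.aemeasurable]
    _ ≤ klDiv ((μ.map fun ω => (Z ω, Y ω)) ⊗ₘ A) ((μ.map fun ω => (Z ω, Y ω)) ⊗ₘ B) :=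
        klDiv_map_le _ _ he
    -- By the chain rule the right side exceeds the left by the divergence of the law of `(Z, Y)`
    -- from `μ.map Z ⊗ₘ κ`.
    _ ≤ klDiv ((μ.map fun ω => (Z ω, Y ω)) ⊗ₘ A) (μ.map Z ⊗ₘ κ ⊗ₘ B) := by
        rw [klDiv_compProd_eq_add (ν := μ.map Z ⊗ₘ κ)]
        exact le_add_self
    _ = klDiv ((μ.map fun ω => (Z ω, X ω, Y ω)).map fun q => ((q.1, q.2.2), q.2.1))
        ((μ.map Z ⊗ₘ (condDistrib X Z μ ×ₖ κ)).map fun q => ((q.1, q.2.2), q.2.1)) := by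
        congr 1
        · rw [hA, Measure.map_map he' hZXY]
          rfl
        · rw [hR _ inferInstance, Measure.map_map he' he]
          exact Measure.map_id.symm
    _ ≤ _ := klDiv_map_le _ _ he'

end Golden

/-! ### Gaussian kernels as reference laws and as test functions -/

section GaussKernel

variable {Ω α γ : Type*} [MeasurableSpace Ω] [MeasurableSpace α] [MeasurableSpace γ]

/-- The kernel `t ↦ N(m t, v)`. -/
def gaussKernel (m : α → ℝ) (hm : Measurable m) (v : ℝ≥0) : Kernel α ℝ where
  toFun t := gaussianReal (m t) v
  measurable' := measurable_gaussianReal.comp (hm.prodMk measurable_const)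

theorem gaussKernel_apply (m : α → ℝ) (hm : Measurable m) (v : ℝ≥0) (t : α) :
    gaussKernel m hm v t = gaussianReal (m t) v := rfl

instance (m : α → ℝ) (hm : Measurable m) (v : ℝ≥0) : IsMarkovKernel (gaussKernel m hm v) :=
  ⟨fun t => inferInstanceAs (IsProbabilityMeasure (gaussianReal (m t) v))⟩

/-- The logarithm of the density of `N(m, v)` with respect to `N(l, V)`. -/
def gaussLogRatio (v V m l y : ℝ) : ℝ :=
  1 / 2 * Real.log (V / v) - (y - m) ^ 2 / (2 * v) + (y - l) ^ 2 / (2 * V)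

theorem gaussianReal_eq_withDensity {v V : ℝ≥0} (hv : v ≠ 0) (hV : V ≠ 0) (m l : ℝ) :
    gaussianReal m v = (gaussianReal l V).withDensity fun y =>
      ENNReal.ofReal (Real.exp (gaussLogRatio v V m l y)) := by
  have hv' : (0 : ℝ) < v := NNReal.coe_pos.2 (pos_iff_ne_zero.2 hv)
  have hV' : (0 : ℝ) < V := NNReal.coe_pos.2 (pos_iff_ne_zero.2 hV)
  have hg : Measurable fun y => ENNReal.ofReal (Real.exp (gaussLogRatio v V m l y)) := by
    unfold gaussLogRatio
    fun_prop
  rw [gaussianReal_of_var_ne_zero _ hv, gaussianReal_of_var_ne_zero _ hV,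
    ← withDensity_mul _ (measurable_gaussianPDF _ _) hg]
  congr 1
  ext y
  rw [Pi.mul_apply, gaussianPDF, gaussianPDF, ← ENNReal.ofReal_mul (gaussianPDFReal_nonneg _ _ _)]
  congr 1
  have hs : Real.exp (1 / 2 * Real.log (V / v)) = √V / √v := by
    rw [← Real.sqrt_div' _ hv'.le, Real.sqrt_eq_rpow, Real.rpow_def_of_pos (div_pos hV' hv')]
    ring_nf
  have h2 : √(2 * Real.pi * v) = √(2 * Real.pi) * √v := Real.sqrt_mul (by positivity) _
  have h3 : √(2 * Real.pi * V) = √(2 * Real.pi) * √V := Real.sqrt_mul (by positivity) _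
  have hsv : 0 < √(v : ℝ) := Real.sqrt_pos.2 hv'
  have hsV : 0 < √(V : ℝ) := Real.sqrt_pos.2 hV'
  have hsp : 0 < √(2 * Real.pi) := by positivity
  have hexp : Real.exp (gaussLogRatio v V m l y) =
      √V / √v * (Real.exp (-(y - m) ^ 2 / (2 * v)) * (Real.exp (-(y - l) ^ 2 / (2 * V)))⁻¹) := by
    rw [← Real.exp_neg, ← Real.exp_add, ← hs, ← Real.exp_add, gaussLogRatio]
    congr 1
    ring
  rw [hexp, gaussianPDFReal, gaussianPDFReal, h2, h3]
  have := Real.exp_pos (-(y - l) ^ 2 / (2 * (V : ℝ)))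
  field_simp

theorem measurable_gaussLogRatio (v V : ℝ) :
    Measurable fun p : ℝ × ℝ × ℝ => gaussLogRatio v V p.1 p.2.1 p.2.2 := by
  unfold gaussLogRatio
  fun_prop

/-- Only second moments enter, whatever the law of `(m, l, Y)`; this is why the Gaussian bounds see
a channel only through its noise covariance. -/
theorem integral_gaussLogRatio {μ : Measure Ω} [IsProbabilityMeasure μ] {m l Y : Ω → ℝ}
    (v V : ℝ) (h₁ : Integrable (fun ω => (Y ω - m ω) ^ 2) μ)
    (h₂ : Integrable (fun ω => (Y ω - l ω) ^ 2) μ) :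
    Integrable (fun ω => gaussLogRatio v V (m ω) (l ω) (Y ω)) μ ∧
    ∫ ω, gaussLogRatio v V (m ω) (l ω) (Y ω) ∂μ = 1 / 2 * Real.log (V / v) -
      (∫ ω, (Y ω - m ω) ^ 2 ∂μ) / (2 * v) + (∫ ω, (Y ω - l ω) ^ 2 ∂μ) / (2 * V) := by
  have i1 := (integrable_const (1 / 2 * Real.log (V / v)) (μ := μ)).sub (h₁.div_const (2 * v))
  have i2 := h₂.div_const (2 * V)
  refine ⟨i1.add i2, ?_⟩
  refine (integral_add i1 i2).trans ?_
  rw [integral_sub' (integrable_const _) (h₁.div_const _), integral_div, integral_div]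
  simp

variable [StandardBorelSpace α] [Nonempty α] {X : Ω → α} {Y : Ω → ℝ} {Z : Ω → γ} {μ : Measure Ω}
  [IsProbabilityMeasure μ]

/-- Replace the law of `Y` given `Z` by `N(l Z, V)`. The divergence is then the mean of a Gaussian
log-ratio: the terms `1/2` from the two quadratic forms cancel up to sign, since the error around
`m` is exactly `v` and that around `l` at most `V`. -/
theorem condMutualInfo_le_of_gaussKernel (hX : Measurable X) (hY : Measurable Y) (hZ : Measurable Z)
    {m : γ × α → ℝ} (hm : Measurable m) {l : γ → ℝ} (hl : Measurable l) {v V : ℝ≥0}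
    (hv : v ≠ 0) (hV : V ≠ 0)
    (hlaw : μ.map (fun ω => ((Z ω, X ω), Y ω)) =
      μ.map (fun ω => (Z ω, X ω)) ⊗ₘ gaussKernel m hm v)
    (hi₁ : Integrable (fun ω => (Y ω - m (Z ω, X ω)) ^ 2) μ)
    (hi₂ : Integrable (fun ω => (Y ω - l (Z ω)) ^ 2) μ)
    (h₁ : ∫ ω, (Y ω - m (Z ω, X ω)) ^ 2 ∂μ = v) (h₂ : ∫ ω, (Y ω - l (Z ω)) ^ 2 ∂μ ≤ V) :
    condMutualInfo X Y Z μ ≤ ENNReal.ofReal (1 / 2 * Real.logb 2 (V / v)) := by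
  have hlog : 0 < Real.log 2 := Real.log_pos one_lt_two
  have hv' : (0 : ℝ) < v := NNReal.coe_pos.2 (pos_iff_ne_zero.2 hv)
  have hV' : (0 : ℝ) < V := NNReal.coe_pos.2 (pos_iff_ne_zero.2 hV)
  have hZX : Measurable fun ω => (Z ω, X ω) := hZ.prodMk hX
  have hZXY : Measurable fun ω => (Z ω, X ω, Y ω) := hZ.prodMk (hX.prodMk hY)
  have : IsProbabilityMeasure (μ.map Z) := Measure.isProbabilityMeasure_map hZ.aemeasurable
  have : IsProbabilityMeasure (μ.map fun ω => (Z ω, X ω, Y ω)) :=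
    Measure.isProbabilityMeasure_map hZXY.aemeasurable
  set g : γ × α × ℝ → ℝ := fun q => gaussLogRatio v V (m (q.1, q.2.1)) (l q.1) q.2.2
  have hg : Measurable g := (measurable_gaussLogRatio v V).comp
    (f := fun q : γ × α × ℝ => (m (q.1, q.2.1), l q.1, q.2.2)) (by fun_prop)
  obtain ⟨hgi, hgv⟩ := integral_gaussLogRatio v V hi₁ hi₂
  have hd : (μ.map fun ω => (Z ω, X ω, Y ω)) = (μ.map Z ⊗ₘ (condDistrib X Z μ ×ₖ
      gaussKernel l hl V)).withDensity fun q => ENNReal.ofReal (Real.exp (g q)) := by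
    refine Measure.ext_of_lintegral _ fun F hF => ?_
    rw [lintegral_withDensity_eq_lintegral_mul _ (by fun_prop) hF,
      lintegral_compProd_condDistrib_prod hX hZ _ _ (by fun_prop), lintegral_map hF hZXY]
    have h1 : Measurable fun q : (γ × α) × ℝ => F (q.1.1, q.1.2, q.2) := by fun_prop
    have h2 := congrArg (fun ν => ∫⁻ q, F (q.1.1, q.1.2, q.2) ∂ν) hlaw
    beta_reduce at h2
    rw [lintegral_map h1 (hZX.prodMk hY), Measure.lintegral_compProd h1,
      lintegral_map h1.lintegral_kernel_prod_right' hZX] at h2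
    refine h2.trans (lintegral_congr fun ω => ?_)
    rw [gaussKernel_apply, gaussKernel_apply, gaussianReal_eq_withDensity hv hV _ (l (Z ω)),
      lintegral_withDensity_eq_lintegral_mul _ (by
        exact hg.exp.ennreal_ofReal.comp (f := fun y => (Z ω, X ω, y)) (by fun_prop))
        (by fun_prop)]
    rfl
  have hle := condMutualInfo_mul_le (μ := μ) hX hY hZ (gaussKernel l hl V)
  rw [klDiv_withDensity_exp hg ((integrable_map_measure hg.aestronglyMeasurable
    hZXY.aemeasurable).2 hgi) hd, integral_map hZXY.aemeasurable hg.aestronglyMeasurable] at hle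
  rw [← ENNReal.mul_le_mul_iff_left (c := ENNReal.ofReal (Real.log 2)) (by simpa using hlog)
    ENNReal.ofReal_ne_top]
  refine hle.trans ?_
  rw [← ENNReal.ofReal_mul' hlog.le]
  refine ENNReal.ofReal_le_ofReal ?_
  change ∫ ω, gaussLogRatio v V (m (Z ω, X ω)) (l (Z ω)) (Y ω) ∂μ ≤ _
  rw [hgv, h₁, Real.logb, mul_assoc, div_mul_cancel₀ _ hlog.ne']
  have e1 : (v : ℝ) / (2 * v) = 1 / 2 := by field_simp
  have e2 : (∫ ω, (Y ω - l (Z ω)) ^ 2 ∂μ) / (2 * V) ≤ 1 / 2 := by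
    rw [div_le_iff₀ (by positivity)]
    linarith
  linarith

/-- The law of `Y` need not be Gaussian: `hmix` concerns `(Z, X)` only and says that mixing `N(m,
v)` over `X` given `Z` yields `N(l Z, V)`. The ratio of the two densities, averaged over `X` given
`Z`, is therefore 1 for each `y`. Its logarithm is thus a valid Donsker-Varadhan test function
whatever the law of `Y` given `Z`. -/
theorem le_condMutualInfo_of_gaussKernel (hX : Measurable X) (hY : Measurable Y) (hZ : Measurable Z)
    {m : γ × α → ℝ} (hm : Measurable m) {l : γ → ℝ} (hl : Measurable l) {v V : ℝ≥0}
    (hv : v ≠ 0) (hV : V ≠ 0)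
    (hmix : (μ.map (fun ω => (Z ω, X ω)) ⊗ₘ gaussKernel m hm v).map (fun q => (q.1.1, q.2)) =
      μ.map Z ⊗ₘ gaussKernel l hl V)
    (hi₁ : Integrable (fun ω => (Y ω - m (Z ω, X ω)) ^ 2) μ)
    (hi₂ : Integrable (fun ω => (Y ω - l (Z ω)) ^ 2) μ) :
    ENNReal.ofReal ((1 / 2 * Real.log (V / v) - (∫ ω, (Y ω - m (Z ω, X ω)) ^ 2 ∂μ) / (2 * v) +
      (∫ ω, (Y ω - l (Z ω)) ^ 2 ∂μ) / (2 * V)) / Real.log 2) ≤ condMutualInfo X Y Z μ := by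
  have hlog : 0 < Real.log 2 := Real.log_pos one_lt_two
  have hZX : Measurable fun ω => (Z ω, X ω) := hZ.prodMk hX
  have hZXY : Measurable fun ω => (Z ω, X ω, Y ω) := hZ.prodMk (hX.prodMk hY)
  have : IsProbabilityMeasure (μ.map Z) := Measure.isProbabilityMeasure_map hZ.aemeasurable
  have : IsProbabilityMeasure (μ.map fun ω => (Z ω, X ω, Y ω)) :=
    Measure.isProbabilityMeasure_map hZXY.aemeasurable
  set g : γ × α × ℝ → ℝ := fun q => gaussLogRatio v V (m (q.1, q.2.1)) (l q.1) q.2.2 with hgdef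
  have hg : Measurable g := (measurable_gaussLogRatio v V).comp
    (f := fun q : γ × α × ℝ => (m (q.1, q.2.1), l q.1, q.2.2)) (by fun_prop)
  have hge : Measurable fun q => ENNReal.ofReal (Real.exp (g q)) := hg.exp.ennreal_ofReal
  obtain ⟨hgi, hgv⟩ := integral_gaussLogRatio v V hi₁ hi₂
  set κ := condDistrib X Z μ
  have hT : ∀ᵐ z ∂(μ.map Z), (κ ⊗ₖ gaussKernel m hm v).snd z = gaussKernel l hl V z := by
    refine Kernel.ae_eq_of_compProd_eq (hmix ▸ ?_)
    refine Measure.ext_of_lintegral _ fun F hF => ?_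
    have h1 : Measurable fun q : (γ × α) × ℝ => F (q.1.1, q.2) := by fun_prop
    rw [Measure.lintegral_compProd hF, lintegral_map hF (by fun_prop),
      Measure.lintegral_compProd h1, ← compProd_map_condDistrib hX.aemeasurable,
      Measure.lintegral_compProd h1.lintegral_kernel_prod_right']
    refine lintegral_congr fun z => ?_
    rw [Kernel.lintegral_snd _ _ (by fun_prop), Kernel.lintegral_compProd _ _ _ (by fun_prop)]
  -- A bound for every `y` is needed, since the law of `Y` given `Z` may be singular. Equality for
  -- almost every `y` follows from uniqueness of densities; Fatou's lemma along a sequence from the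
  -- dense set where it holds extends the inequality to all `y`.
  have hone : ∀ᵐ z ∂(μ.map Z), ∀ y, ∫⁻ x, ENNReal.ofReal (Real.exp (g (z, x, y))) ∂κ z ≤ 1 := by
    filter_upwards [hT] with z hz y
    set u : ℝ → ℝ≥0∞ := fun y => ∫⁻ x, ENNReal.ofReal (Real.exp (g (z, x, y))) ∂κ z
    have hgz : Measurable fun p : ℝ × α => ENNReal.ofReal (Real.exp (g (z, p.2, p.1))) :=
      hge.comp (f := fun p : ℝ × α => (z, p.2, p.1)) (by fun_prop)
    have hum : Measurable u := hgz.lintegral_prod_right'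
    have hwd : (gaussianReal (l z) V).withDensity u =
        (gaussianReal (l z) V).withDensity fun _ => 1 := by
      rw [show (fun _ : ℝ => (1 : ℝ≥0∞)) = 1 from rfl, withDensity_one]
      refine Eq.trans (Measure.ext_of_lintegral _ fun F hF => ?_) hz
      rw [lintegral_withDensity_eq_lintegral_mul _ hum hF, Kernel.lintegral_snd _ _ hF,
        Kernel.lintegral_compProd _ _ _ (by fun_prop)]
      have h3 : ∀ x, ∫⁻ y, F y ∂gaussKernel m hm v (z, x) =
          ∫⁻ y, ENNReal.ofReal (Real.exp (g (z, x, y))) * F y ∂gaussianReal (l z) V := fun x => by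
        rw [gaussKernel_apply, gaussianReal_eq_withDensity hv hV _ (l z),
          lintegral_withDensity_eq_lintegral_mul _ (by
            exact hge.comp (f := fun y => (z, x, y)) (by fun_prop)) hF]
        rfl
      simp_rw [h3]
      rw [lintegral_lintegral_swap (by
        exact ((hgz.comp measurable_swap).mul (hF.comp measurable_snd)).aemeasurable)]
      refine lintegral_congr fun y => ?_
      exact (lintegral_mul_const _ (hgz.comp (f := fun x => (y, x)) (by fun_prop))).symm
    have hae : u =ᵐ[gaussianReal (l z) V] fun _ => 1 :=
      (withDensity_eq_iff_of_sigmaFinite hum.aemeasurable aemeasurable_const).1 hwd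
    have hae' : ∀ᵐ y, u y = 1 := (gaussianReal_absolutelyContinuous' (l z) hV).ae_le hae
    obtain ⟨s, hs, hlim⟩ := mem_closure_iff_seq_limit.1 (Measure.dense_of_ae hae' y)
    calc ∫⁻ x, ENNReal.ofReal (Real.exp (g (z, x, y))) ∂κ z
        = ∫⁻ x, Filter.liminf (fun n => ENNReal.ofReal (Real.exp (g (z, x, s n)))) Filter.atTop
            ∂κ z := by
          refine lintegral_congr fun x => (Filter.Tendsto.liminf_eq ?_).symm
          have hc : Continuous fun y => ENNReal.ofReal (Real.exp (g (z, x, y))) := by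
            simp only [hgdef, gaussLogRatio]
            exact ENNReal.continuous_ofReal.comp (by fun_prop)
          exact (hc.tendsto y).comp hlim
      _ ≤ Filter.liminf (fun n => u (s n)) Filter.atTop :=
          lintegral_liminf_le fun n => hge.comp (f := fun x => (z, x, s n)) (by fun_prop)
      _ = 1 := by
          rw [show (fun n => u (s n)) = fun _ => 1 from funext hs]
          exact Filter.liminf_const 1
  have hQ : ∫⁻ q, ENNReal.ofReal (Real.exp (g q))
      ∂(μ.map Z ⊗ₘ (κ ×ₖ condDistrib Y Z μ)) ≤ 1 := by
    have h : Measurable fun q : (γ × ℝ) × α =>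
      ENNReal.ofReal (Real.exp (g (q.1.1, q.2, q.1.2))) :=
      hge.comp (f := fun q : (γ × ℝ) × α => (q.1.1, q.2, q.1.2)) (by fun_prop)
    rw [lintegral_compProd_prod_swap _ _ _ hge, Measure.lintegral_compProd h,
      Measure.lintegral_compProd h.lintegral_kernel_prod_right']
    calc _ ≤ ∫⁻ z, ∫⁻ _, 1 ∂condDistrib Y Z μ z ∂(μ.map Z) := by
          refine lintegral_mono_ae ?_
          filter_upwards [hone] with z hz
          exact lintegral_mono fun y => hz y
      _ = 1 := by simp
  have hDV := ofReal_integral_le_klDiv (P := μ.map fun ω => (Z ω, X ω, Y ω)) hg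
    ((integrable_map_measure hg.aestronglyMeasurable hZXY.aemeasurable).2 hgi) hQ
  rw [integral_map hZXY.aemeasurable hg.aestronglyMeasurable, klDiv_eq_condMutualInfo_mul] at hDV
  rw [← ENNReal.mul_le_mul_iff_left (c := ENNReal.ofReal (Real.log 2)) (by simpa using hlog)
    ENNReal.ofReal_ne_top]
  refine le_trans (le_of_eq ?_) hDV
  rw [← ENNReal.ofReal_mul' hlog.le, div_mul_cancel₀ _ hlog.ne', ← hgv]

end GaussKernel

/-! ### The function `f` and its minimizer -/

/-- The mean squared error of the estimator `c * Y₂` of `Y₁`, for centred inputs with powers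
`P₁`, `P₂` and noise covariance `ρ`. -/
def errVar (a b P₁ P₂ ρ c : ℝ) : ℝ :=
  (1 - c * √a) ^ 2 * P₁ + (√b - c) ^ 2 * P₂ + 1 - 2 * c * ρ + c ^ 2

/-- The coefficient of the optimal linear estimator of `Y₁` from `Y₂`. -/
def gain (a b P₁ P₂ ρ : ℝ) : ℝ := (ρ + √a * P₁ + √b * P₂) / (1 + a * P₁ + P₂)

/-- The minimal mean squared error of a linear estimator of `Y₁` from `Y₂`. -/
def condVar (a b P₁ P₂ ρ : ℝ) : ℝ := errVar a b P₁ P₂ ρ (gain a b P₁ P₂ ρ)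

section Algebra

variable {a b P₁ P₂ ρ : ℝ}

/-- Completing the square in `c`; the minimum is at `gain`. -/
theorem errVar_eq (ha : 0 ≤ a) (hb : 0 ≤ b) (h₁ : 0 ≤ P₁) (h₂ : 0 ≤ P₂) (c : ℝ) :
    errVar a b P₁ P₂ ρ c = 1 + P₁ + b * P₂ - (ρ + √a * P₁ + √b * P₂) ^ 2 / (1 + a * P₁ + P₂) +
      (1 + a * P₁ + P₂) * (c - gain a b P₁ P₂ ρ) ^ 2 := by
  have hD : 0 < 1 + a * P₁ + P₂ := by positivity
  have hsa := Real.sq_sqrt ha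
  have hsb := Real.sq_sqrt hb
  have e : errVar a b P₁ P₂ ρ c = 1 + P₁ + b * P₂ - 2 * c * (ρ + √a * P₁ + √b * P₂) +
      (1 + a * P₁ + P₂) * c ^ 2 := by
    unfold errVar
    linear_combination (c ^ 2 * P₁) * hsa + P₂ * hsb
  rw [e, gain]
  field_simp
  ring

theorem condVar_eq (ha : 0 ≤ a) (hb : 0 ≤ b) (h₁ : 0 ≤ P₁) (h₂ : 0 ≤ P₂) :
    condVar a b P₁ P₂ ρ =
      1 + P₁ + b * P₂ - (ρ + √a * P₁ + √b * P₂) ^ 2 / (1 + a * P₁ + P₂) := by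
  rw [condVar, errVar_eq ha hb h₁ h₂]
  simp

theorem condVar_le_errVar (ha : 0 ≤ a) (hb : 0 ≤ b) (h₁ : 0 ≤ P₁) (h₂ : 0 ≤ P₂) (c : ℝ) :
    condVar a b P₁ P₂ ρ ≤ errVar a b P₁ P₂ ρ c := by
  rw [condVar_eq ha hb h₁ h₂, errVar_eq ha hb h₁ h₂]
  have hD : 0 < 1 + a * P₁ + P₂ := by positivity
  have := mul_nonneg hD.le (sq_nonneg (c - gain a b P₁ P₂ ρ))
  linarith

theorem one_sub_sq_le_condVar (h₁ : 0 ≤ P₁) (h₂ : 0 ≤ P₂) :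
    1 - ρ ^ 2 ≤ condVar a b P₁ P₂ ρ := by
  rw [condVar, errVar]
  set c := gain a b P₁ P₂ ρ
  have e1 : 0 ≤ (1 - c * √a) ^ 2 * P₁ := by positivity
  have e2 : 0 ≤ (√b - c) ^ 2 * P₂ := by positivity
  nlinarith [sq_nonneg (c - ρ)]

theorem errVar_mono {Q₁ Q₂ : ℝ} (h₁ : P₁ ≤ Q₁) (h₂ : P₂ ≤ Q₂) (c : ℝ) :
    errVar a b P₁ P₂ ρ c ≤ errVar a b Q₁ Q₂ ρ c := by
  unfold errVar
  gcongr

theorem f_eq_condVar (ha : 0 ≤ a) (hb : 0 ≤ b) (h₁ : 0 ≤ P₁) (h₂ : 0 ≤ P₂) :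
    f a b P₁ P₂ ρ = 1 / 2 * Real.logb 2 (condVar a b P₁ P₂ ρ / (1 - ρ ^ 2)) := by
  have hD : 0 < 1 + a * P₁ + P₂ := by positivity
  rw [f, condVar_eq ha hb h₁ h₂, mul_comm (1 - ρ ^ 2), ← div_div, sub_div, mul_div_cancel_right₀ _
    hD.ne']

theorem one_sub_sq_pos (hρ : ρ ∈ Set.Ioo (-1 : ℝ) 1) : 0 < 1 - ρ ^ 2 := by
  nlinarith [hρ.1, hρ.2]

theorem condVar_pos (h₁ : 0 ≤ P₁) (h₂ : 0 ≤ P₂) (hρ : ρ ∈ Set.Ioo (-1 : ℝ) 1) :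
    0 < condVar a b P₁ P₂ ρ :=
  (one_sub_sq_pos hρ).trans_le (one_sub_sq_le_condVar h₁ h₂)

theorem f_nonneg (ha : 0 ≤ a) (hb : 0 ≤ b) (h₁ : 0 ≤ P₁) (h₂ : 0 ≤ P₂)
    (hρ : ρ ∈ Set.Ioo (-1 : ℝ) 1) : 0 ≤ f a b P₁ P₂ ρ := by
  rw [f_eq_condVar ha hb h₁ h₂]
  refine mul_nonneg (by norm_num) (Real.logb_nonneg one_lt_two ?_)
  rw [le_div_iff₀ (one_sub_sq_pos hρ), one_mul]
  exact one_sub_sq_le_condVar h₁ h₂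

/-- The estimator optimal at the larger powers, used at the smaller ones, has an error no larger;
the optimal error there is smaller still. -/
theorem f_mono (ha : 0 ≤ a) (hb : 0 ≤ b) (h₁ : 0 ≤ P₁) (h₂ : 0 ≤ P₂) {Q₁ Q₂ : ℝ}
    (h₁' : P₁ ≤ Q₁) (h₂' : P₂ ≤ Q₂) (hρ : ρ ∈ Set.Ioo (-1 : ℝ) 1) :
    f a b P₁ P₂ ρ ≤ f a b Q₁ Q₂ ρ := by
  have hp := one_sub_sq_pos hρ
  rw [f_eq_condVar ha hb h₁ h₂, f_eq_condVar ha hb (h₁.trans h₁') (h₂.trans h₂')]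
  gcongr
  · norm_num
  · exact div_pos (condVar_pos h₁ h₂ hρ) hp
  · exact (condVar_le_errVar ha hb h₁ h₂ _).trans (errVar_mono h₁' h₂' _)

/-- A concavity argument without derivatives. Freezing the coefficient `c` at its value for `(P₁,
P₂)` makes the error variance affine in the powers, and `log x ≤ x - 1` gives a supporting plane at
`(P₁, P₂)`. Summed over the letters, its nonconstant part is nonpositive by the block constraints.
-/
theorem sum_f_le (ha : 0 ≤ a) (hb : 0 ≤ b) {n : ℕ} {p₁ p₂ : Fin n → ℝ} (h₁ : ∀ k, 0 ≤ p₁ k)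
    (h₂ : ∀ k, 0 ≤ p₂ k) (hP₁ : 0 ≤ P₁) (hP₂ : 0 ≤ P₂) (hs₁ : ∑ k, p₁ k ≤ n * P₁)
    (hs₂ : ∑ k, p₂ k ≤ n * P₂) (hρ : ρ ∈ Set.Ioo (-1 : ℝ) 1) :
    ∑ k, f a b (p₁ k) (p₂ k) ρ ≤ n * f a b P₁ P₂ ρ := by
  have hlog : 0 < Real.log 2 := Real.log_pos one_lt_two
  have hp := one_sub_sq_pos hρ
  set c := gain a b P₁ P₂ ρ
  set V := condVar a b P₁ P₂ ρ
  have hV : 0 < V := condVar_pos hP₁ hP₂ hρ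
  have hk : ∀ k, f a b (p₁ k) (p₂ k) ρ ≤
      f a b P₁ P₂ ρ + 1 / (2 * Real.log 2 * V) * (errVar a b (p₁ k) (p₂ k) ρ c - V) := fun k => by
    rw [f_eq_condVar ha hb (h₁ k) (h₂ k), f_eq_condVar ha hb hP₁ hP₂]
    have hVk : 0 < condVar a b (p₁ k) (p₂ k) ρ := condVar_pos (h₁ k) (h₂ k) hρ
    have e1 := Real.log_le_sub_one_of_pos (div_pos hVk hV)
    rw [Real.log_div hVk.ne' hV.ne'] at e1
    have e2 : condVar a b (p₁ k) (p₂ k) ρ / V ≤ errVar a b (p₁ k) (p₂ k) ρ c / V :=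
      div_le_div_of_nonneg_right (condVar_le_errVar ha hb (h₁ k) (h₂ k) c) hV.le
    rw [Real.logb, Real.logb, Real.log_div hVk.ne' hp.ne', Real.log_div hV.ne' hp.ne']
    have e3 : 1 / (2 * Real.log 2 * V) * (errVar a b (p₁ k) (p₂ k) ρ c - V) =
      1 / (2 * Real.log 2) * (errVar a b (p₁ k) (p₂ k) ρ c / V - 1) := by
      field_simp
    have e4 : 1 / (2 * Real.log 2) * (Real.log (condVar a b (p₁ k) (p₂ k) ρ) - Real.log V) ≤
      1 / (2 * Real.log 2) * (errVar a b (p₁ k) (p₂ k) ρ c / V - 1) :=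
      mul_le_mul_of_nonneg_left (by linarith) (by positivity)
    rw [e3]
    refine le_trans (le_of_eq ?_) (add_le_add_right e4 _)
    field_simp
    ring
  refine (Finset.sum_le_sum fun k _ => hk k).trans ?_
  rw [Finset.sum_add_distrib, ← Finset.mul_sum, Finset.sum_sub_distrib]
  simp only [Finset.sum_const, Finset.card_univ, Fintype.card_fin, nsmul_eq_mul]
  have e5 : ∑ k, errVar a b (p₁ k) (p₂ k) ρ c ≤ n * V := by
    have : ∑ k, errVar a b (p₁ k) (p₂ k) ρ c = (1 - c * √a) ^ 2 * ∑ k, p₁ k +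
        (√b - c) ^ 2 * ∑ k, p₂ k + n * (1 - 2 * c * ρ + c ^ 2) := by
      simp only [errVar, Finset.sum_add_distrib, Finset.sum_sub_distrib, Finset.mul_sum]
      simp
      ring
    rw [this]
    have g1 := mul_le_mul_of_nonneg_left hs₁ (sq_nonneg (1 - c * √a))
    have g2 := mul_le_mul_of_nonneg_left hs₂ (sq_nonneg (√b - c))
    have : n * V = (1 - c * √a) ^ 2 * (n * P₁) + (√b - c) ^ 2 * (n * P₂) +
        n * (1 - 2 * c * ρ + c ^ 2) := by
      simp only [V, condVar, errVar, c]
      ring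
    linarith
  have : 1 / (2 * Real.log 2 * V) * (∑ k, errVar a b (p₁ k) (p₂ k) ρ c - n * V) ≤ 0 :=
    mul_nonpos_of_nonneg_of_nonpos (by positivity) (by linarith)
  linarith

/-! ### Minimization over the noise covariance -/

/-- The first factor of the discriminant. -/
def discrLeft (a b P₁ P₂ : ℝ) : ℝ :=
  (√a - 1) ^ 2 * P₁ + (√b - 1) ^ 2 * P₂ + (√(a * b) - 1) ^ 2 * P₁ * P₂

/-- The second factor of the discriminant. -/
def discrRight (a b P₁ P₂ : ℝ) : ℝ :=
  (√a + 1) ^ 2 * P₁ + (√b + 1) ^ 2 * P₂ + (√(a * b) - 1) ^ 2 * P₁ * P₂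

theorem discrLeft_nonneg (h₁ : 0 ≤ P₁) (h₂ : 0 ≤ P₂) : 0 ≤ discrLeft a b P₁ P₂ := by
  unfold discrLeft; positivity

theorem discrRight_nonneg (h₁ : 0 ≤ P₁) (h₂ : 0 ≤ P₂) : 0 ≤ discrRight a b P₁ P₂ := by
  unfold discrRight; positivity

theorem discrRight_sub_discrLeft :
    discrRight a b P₁ P₂ - discrLeft a b P₁ P₂ = 4 * (√a * P₁ + √b * P₂) := by
  unfold discrRight discrLeft; ring

/-- With `α`, `β` the square roots of the factors of `Δ`, the numerator of `rhoStar` is `(β - α)² /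
2` and its denominator `(β² - α²) / 2`, so `ρ* = (β - α) / (β + α)`. The form without division
includes the case of a zero denominator, where `β = α`. -/
theorem rhoStar_mul (ha : 0 ≤ a) (hb : 0 ≤ b) (h₁ : 0 ≤ P₁) (h₂ : 0 ≤ P₂) :
    rhoStar a b P₁ P₂ * (√(discrRight a b P₁ P₂) + √(discrLeft a b P₁ P₂)) =
      √(discrRight a b P₁ P₂) - √(discrLeft a b P₁ P₂) := by
  have hA := Real.sq_sqrt (discrLeft_nonneg (a := a) (b := b) h₁ h₂)
  have hB := Real.sq_sqrt (discrRight_nonneg (a := a) (b := b) h₁ h₂)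
  have hd := discrRight_sub_discrLeft (a := a) (b := b) (P₁ := P₁) (P₂ := P₂)
  have hα := Real.sqrt_nonneg (discrLeft a b P₁ P₂)
  have hβ := Real.sqrt_nonneg (discrRight a b P₁ P₂)
  have hnum : (1 + a) * P₁ + (1 + b) * P₂ + (√(a * b) - 1) ^ 2 * P₁ * P₂ - √(discr a b P₁ P₂) =
      (√(discrRight a b P₁ P₂) - √(discrLeft a b P₁ P₂)) ^ 2 / 2 := by
    have h1 : √(discr a b P₁ P₂) = √(discrLeft a b P₁ P₂) * √(discrRight a b P₁ P₂) :=
      Real.sqrt_mul (discrLeft_nonneg h₁ h₂) _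
    have h2 : (1 + a) * P₁ + (1 + b) * P₂ + (√(a * b) - 1) ^ 2 * P₁ * P₂ =
        (discrLeft a b P₁ P₂ + discrRight a b P₁ P₂) / 2 := by
      unfold discrLeft discrRight
      linear_combination (-P₁) * Real.sq_sqrt ha - P₂ * Real.sq_sqrt hb
    rw [h1, h2]
    linear_combination (-1 / 2) * hA - 1 / 2 * hB
  rw [rhoStar, hnum]
  set α := √(discrLeft a b P₁ P₂)
  set β := √(discrRight a b P₁ P₂)
  set S := √a * P₁ + √b * P₂
  have hS : 0 ≤ S := by positivity
  rcases hS.eq_or_lt with h | h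
  · have : β ^ 2 = α ^ 2 := by linarith
    have : β = α := by rwa [sq_eq_sq₀ hβ hα] at this
    rw [this]
    simp
  · field_simp
    have : S = (β ^ 2 - α ^ 2) / 4 := by linarith
    rw [this]
    ring

theorem rhoStar_mem_Icc (ha : 0 ≤ a) (hb : 0 ≤ b) (h₁ : 0 ≤ P₁) (h₂ : 0 ≤ P₂) :
    rhoStar a b P₁ P₂ ∈ Set.Icc (0 : ℝ) 1 := by
  have h := rhoStar_mul ha hb h₁ h₂
  have hα := Real.sqrt_nonneg (discrLeft a b P₁ P₂)
  have hβ := Real.sqrt_nonneg (discrRight a b P₁ P₂)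
  have hd := discrRight_sub_discrLeft (a := a) (b := b) (P₁ := P₁) (P₂ := P₂)
  have hS : 0 ≤ √a * P₁ + √b * P₂ := by positivity
  have hle : √(discrLeft a b P₁ P₂) ≤ √(discrRight a b P₁ P₂) := Real.sqrt_le_sqrt (by linarith)
  set α := √(discrLeft a b P₁ P₂)
  set β := √(discrRight a b P₁ P₂)
  rcases (add_nonneg hβ hα).eq_or_lt with h0 | h0
  · have hS0 : √a * P₁ + √b * P₂ = 0 := by
      have hA := Real.sq_sqrt (discrLeft_nonneg (a := a) (b := b) h₁ h₂)
      have hB := Real.sq_sqrt (discrRight_nonneg (a := a) (b := b) h₁ h₂)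
      have h3 : β = 0 := by linarith
      have h4 : α = 0 := by linarith
      rw [show √(discrLeft a b P₁ P₂) = 0 from h4] at hA
      rw [show √(discrRight a b P₁ P₂) = 0 from h3] at hB
      linarith
    rw [rhoStar, hS0]
    simp
  · have hρ : rhoStar a b P₁ P₂ = (β - α) / (β + α) := by rw [eq_div_iff h0.ne', h]
    rw [hρ]
    exact ⟨div_nonneg (by linarith) h0.le, (div_le_one h0).2 (by linarith)⟩

/-- Partial fractions in `ρ`. Minimizing `f` is thereby reduced to minimizing `A/(1-ρ) + B/(1+ρ)`
with `A`, `B` free of `ρ`. -/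
theorem condVar_div_mul (ha : 0 ≤ a) (hb : 0 ≤ b) (h₁ : 0 ≤ P₁) (h₂ : 0 ≤ P₂)
    (hρ : ρ ∈ Set.Ioo (-1 : ℝ) 1) :
    condVar a b P₁ P₂ ρ / (1 - ρ ^ 2) * (1 + a * P₁ + P₂) =
      1 + (discrLeft a b P₁ P₂ / (1 - ρ) + discrRight a b P₁ P₂ / (1 + ρ)) / 2 := by
  have hD : 0 < 1 + a * P₁ + P₂ := by positivity
  have e1 : 0 < 1 - ρ := by linarith [hρ.2]
  have e2 : 0 < 1 + ρ := by linarith [hρ.1]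
  have hp : 1 - ρ ^ 2 = (1 - ρ) * (1 + ρ) := by ring
  rw [condVar_eq ha hb h₁ h₂, hp]
  field_simp
  unfold discrLeft discrRight
  rw [Real.sqrt_mul ha]
  have hsa := Real.sq_sqrt ha
  have hsb := Real.sq_sqrt hb
  set s := √a
  set t := √b
  rw [← hsa, ← hsb]
  ring

theorem rhoStar_mem_Ioo_or (ha : 0 ≤ a) (hb : 0 ≤ b) (h₁ : 0 ≤ P₁) (h₂ : 0 ≤ P₂) :
    rhoStar a b P₁ P₂ ∈ Set.Ioo (-1 : ℝ) 1 ∨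
      rhoStar a b P₁ P₂ = 1 ∧ discrLeft a b P₁ P₂ = 0 := by
  have hm := rhoStar_mem_Icc ha hb h₁ h₂
  rcases hm.2.eq_or_lt with h | h
  · refine Or.inr ⟨h, ?_⟩
    have := rhoStar_mul ha hb h₁ h₂
    rw [h] at this
    have h0 : √(discrLeft a b P₁ P₂) = 0 := by linarith
    exact (Real.sqrt_eq_zero (discrLeft_nonneg h₁ h₂)).1 h0
  · exact Or.inl ⟨by linarith [hm.1], h⟩

/-- The factor `1 - ρ²` vanishes, so division by zero and the logarithm of zero return 0. -/
theorem f_rhoStar_of_eq_one (h : rhoStar a b P₁ P₂ = 1) :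
    f a b P₁ P₂ (rhoStar a b P₁ P₂) = 0 := by
  rw [h, f]
  simp

theorem discr_div_add (ha : 0 ≤ a) (hb : 0 ≤ b) (h₁ : 0 ≤ P₁) (h₂ : 0 ≤ P₂)
    (hρ : rhoStar a b P₁ P₂ ∈ Set.Ioo (-1 : ℝ) 1) :
    discrLeft a b P₁ P₂ / (1 - rhoStar a b P₁ P₂) +
      discrRight a b P₁ P₂ / (1 + rhoStar a b P₁ P₂) =
      (√(discrLeft a b P₁ P₂) + √(discrRight a b P₁ P₂)) ^ 2 / 2 := by
  have h := rhoStar_mul ha hb h₁ h₂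
  have hA := Real.sq_sqrt (discrLeft_nonneg (a := a) (b := b) h₁ h₂)
  have hB := Real.sq_sqrt (discrRight_nonneg (a := a) (b := b) h₁ h₂)
  set α := √(discrLeft a b P₁ P₂)
  set β := √(discrRight a b P₁ P₂)
  set ρ := rhoStar a b P₁ P₂
  have e1 : 0 < 1 - ρ := by linarith [hρ.2]
  have e2 : 0 < 1 + ρ := by linarith [hρ.1]
  rw [← hA, ← hB]
  have k1 : α * 2 = (β + α) * (1 - ρ) := by linarith
  have k2 : β * 2 = (β + α) * (1 + ρ) := by linarith
  have k3 : α ^ 2 / (1 - ρ) = α * (β + α) / 2 := by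
    rw [div_eq_div_iff e1.ne' two_ne_zero]
    linear_combination α * k1
  have k4 : β ^ 2 / (1 + ρ) = β * (β + α) / 2 := by
    rw [div_eq_div_iff e2.ne' two_ne_zero]
    linear_combination β * k2
  rw [k3, k4]
  ring

theorem f_rhoStar_le (ha : 0 ≤ a) (hb : 0 ≤ b) (h₁ : 0 ≤ P₁) (h₂ : 0 ≤ P₂)
    (hρ : ρ ∈ Set.Ioo (-1 : ℝ) 1) :
    f a b P₁ P₂ (rhoStar a b P₁ P₂) ≤ f a b P₁ P₂ ρ := by
  rcases rhoStar_mem_Ioo_or ha hb h₁ h₂ with hs | ⟨hs, -⟩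
  · have hD : 0 < 1 + a * P₁ + P₂ := by positivity
    rw [f_eq_condVar ha hb h₁ h₂, f_eq_condVar ha hb h₁ h₂]
    refine mul_le_mul_of_nonneg_left (Real.logb_le_logb_of_le one_lt_two
      (div_pos (condVar_pos h₁ h₂ hs) (one_sub_sq_pos hs)) ?_) (by norm_num)
    refine le_of_mul_le_mul_right ?_ hD
    rw [condVar_div_mul ha hb h₁ h₂ hs, condVar_div_mul ha hb h₁ h₂ hρ,
      discr_div_add ha hb h₁ h₂ hs]
    have hA := Real.sq_sqrt (discrLeft_nonneg (a := a) (b := b) h₁ h₂)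
    have hB := Real.sq_sqrt (discrRight_nonneg (a := a) (b := b) h₁ h₂)
    set α := √(discrLeft a b P₁ P₂)
    set β := √(discrRight a b P₁ P₂)
    have e1 : 0 < 1 - ρ := by linarith [hρ.2]
    have e2 : 0 < 1 + ρ := by linarith [hρ.1]
    rw [← hA, ← hB]
    -- Cauchy-Schwarz, with weights `1 - ρ` and `1 + ρ` of sum 2.
    have : (α + β) ^ 2 / 2 ≤ α ^ 2 / (1 - ρ) + β ^ 2 / (1 + ρ) := by
      rw [div_add_div _ _ e1.ne' e2.ne', div_le_div_iff₀ two_pos (mul_pos e1 e2)]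
      nlinarith [sq_nonneg (α * (1 + ρ) - β * (1 - ρ))]
    linarith
  · rw [f_rhoStar_of_eq_one hs]
    exact f_nonneg ha hb h₁ h₂ hρ

/-- At an interior minimizer, `ρ ↦ f a b P₁ P₂ ρ` is stationary. -/
theorem rhoStar_stationary (ha : 0 ≤ a) (hb : 0 ≤ b) (h₁ : 0 ≤ P₁) (h₂ : 0 ≤ P₂)
    (hρ : rhoStar a b P₁ P₂ ∈ Set.Ioo (-1 : ℝ) 1) :
    rhoStar a b P₁ P₂ / (1 - rhoStar a b P₁ P₂ ^ 2) =
      gain a b P₁ P₂ (rhoStar a b P₁ P₂) / condVar a b P₁ P₂ (rhoStar a b P₁ P₂) := by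
  have hD : 0 < 1 + a * P₁ + P₂ := by positivity
  have hp := one_sub_sq_pos hρ
  have hV : 0 < condVar a b P₁ P₂ (rhoStar a b P₁ P₂) := condVar_pos h₁ h₂ hρ
  have h3 := condVar_div_mul ha hb h₁ h₂ hρ
  rw [discr_div_add ha hb h₁ h₂ hρ] at h3
  have h := rhoStar_mul ha hb h₁ h₂
  have hA := Real.sq_sqrt (discrLeft_nonneg (a := a) (b := b) h₁ h₂)
  have hB := Real.sq_sqrt (discrRight_nonneg (a := a) (b := b) h₁ h₂)
  have hd := discrRight_sub_discrLeft (a := a) (b := b) (P₁ := P₁) (P₂ := P₂)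
  -- Cleared of denominators, with `D = 1 + aP₁ + P₂` and `S = √a P₁ + √b P₂`, the claim is `ρ V D =
  -- (ρ + S)(1 - ρ²)`. It follows from the minimal value of `V D / (1 - ρ²)` in `h4` and from `ρ (α
  -- + β)² = β² - α² = 4S` in `h5`.
  rw [gain, div_div, div_eq_div_iff hp.ne' (mul_pos hD hV).ne']
  set α := √(discrLeft a b P₁ P₂)
  set β := √(discrRight a b P₁ P₂)
  set ρ := rhoStar a b P₁ P₂
  set V := condVar a b P₁ P₂ ρ
  have h4 : V * (1 + a * P₁ + P₂) = (1 + (α + β) ^ 2 / 2 / 2) * (1 - ρ ^ 2) := by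
    rw [← h3]
    field_simp
  have h5 : ρ * (α + β) ^ 2 = 4 * (√a * P₁ + √b * P₂) := by
    rw [← hd, ← hA, ← hB]
    linear_combination (α + β) * h
  linear_combination ρ * h4 + (1 - ρ ^ 2) / 4 * h5

/-- If `ρ* = 1`, then `discrLeft` vanishes and the estimator with coefficient 1 has error at most
`2(1 - ρ)`. The ratio inside the logarithm is then at most `2/(1 + ρ)`, which tends to 1 as `ρ → 1`.
-/
theorem exists_f_le (ha : 0 ≤ a) (hb : 0 ≤ b) (h₁ : 0 ≤ P₁) (h₂ : 0 ≤ P₂) {ε : ℝ} (hε : 0 < ε) :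
    ∃ ρ ∈ Set.Ioo (-1 : ℝ) 1, f a b P₁ P₂ ρ ≤ f a b P₁ P₂ (rhoStar a b P₁ P₂) + ε := by
  rcases rhoStar_mem_Ioo_or ha hb h₁ h₂ with hs | ⟨hs, hA⟩
  · exact ⟨_, hs, by linarith⟩
  have hlim : Filter.Tendsto (fun ρ : ℝ => 1 / 2 * Real.logb 2 (2 / (1 + ρ)))
      (nhdsWithin 1 (Set.Iio 1)) (nhds (1 / 2 * Real.logb 2 (2 / (1 + 1)))) := by
    refine Filter.Tendsto.mono_left ?_ nhdsWithin_le_nhds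
    have : ContinuousAt (fun ρ : ℝ => 1 / 2 * Real.logb 2 (2 / (1 + ρ))) 1 := by
      unfold Real.logb
      refine continuousAt_const.mul (ContinuousAt.div_const (ContinuousAt.log ?_ (by norm_num)) _)
      exact continuousAt_const.div (continuousAt_const.add continuousAt_id) (by norm_num)
    exact this
  have h0 : 1 / 2 * Real.logb 2 (2 / (1 + 1)) = 0 := by norm_num
  rw [h0] at hlim
  obtain ⟨ρ, hρε, hρ⟩ := ((hlim.eventually (gt_mem_nhds hε)).and
    (Ioo_mem_nhdsLT (show (-1 : ℝ) < 1 by norm_num))).exists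
  refine ⟨ρ, hρ, ?_⟩
  rw [f_rhoStar_of_eq_one hs, zero_add]
  refine le_trans ?_ hρε.le
  have e1 : 0 < 1 - ρ := by linarith [hρ.2]
  have e2 : 0 < 1 + ρ := by linarith [hρ.1]
  rw [f_eq_condVar ha hb h₁ h₂]
  refine mul_le_mul_of_nonneg_left (Real.logb_le_logb_of_le one_lt_two
    (div_pos (condVar_pos h₁ h₂ hρ) (one_sub_sq_pos hρ)) ?_) (by norm_num)
  have h3 : condVar a b P₁ P₂ ρ ≤ 2 * (1 - ρ) := by
    refine (condVar_le_errVar ha hb h₁ h₂ 1).trans ?_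
    have h4 : (√a - 1) ^ 2 * P₁ + (√b - 1) ^ 2 * P₂ ≤ discrLeft a b P₁ P₂ := by
      have : 0 ≤ (√(a * b) - 1) ^ 2 * P₁ * P₂ := by positivity
      unfold discrLeft
      linarith
    unfold errVar
    nlinarith
  rw [show 1 - ρ ^ 2 = (1 - ρ) * (1 + ρ) by ring, div_le_div_iff₀ (mul_pos e1 e2) e2]
  calc condVar a b P₁ P₂ ρ * (1 + ρ) ≤ 2 * (1 - ρ) * (1 + ρ) :=
        mul_le_mul_of_nonneg_right h3 e2.le
    _ = _ := by ring

end Algebra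

/-! ### Gaussian linear algebra -/

section Gaussian

theorem lintegral_gaussianReal (m : ℝ) (v : ℝ≥0) {F : ℝ → ℝ≥0∞} (hF : Measurable F) :
    ∫⁻ y, F y ∂gaussianReal m v = ∫⁻ g, F (m + √v * g) ∂gaussianReal 0 1 := by
  have h : gaussianReal m v = (gaussianReal 0 1).map fun g => m + √v * g := by
    have e : (fun g => m + √v * g) = (fun y => m + y) ∘ fun g => √(v : ℝ) * g := rfl
    rw [e, ← Measure.map_map (by fun_prop) (by fun_prop), gaussianReal_map_const_mul,
      gaussianReal_map_const_add]
    congr 1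
    · simp
    · ext
      simp
  rw [h, lintegral_map hF (by fun_prop)]

variable {ι : Type*} [Fintype ι]

theorem covariance_linear_pi_gaussianReal (v : ι → ℝ≥0) (α β : ι → ℝ) :
    cov[fun x => ∑ i, α i * x i, fun x => ∑ i, β i * x i;
      Measure.pi fun i => gaussianReal 0 (v i)] = ∑ i, α i * β i * v i := by
  classical
  have hL : ∀ i, MemLp (fun x : ι → ℝ => x i) 2 (Measure.pi fun i => gaussianReal 0 (v i)) :=
    fun i => (memLp_id_gaussianReal' 2 (by simp)).comp_measurePreserving
      (measurePreserving_eval (fun i => gaussianReal 0 (v i)) i)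
  have hI := iIndepFun_pi (μ := fun i => gaussianReal 0 (v i)) (X := fun _ x => x)
    (fun _ => aemeasurable_id')
  rw [covariance_fun_sum_fun_sum (fun i => (hL i).const_mul _) (fun i => (hL i).const_mul _)]
  refine Finset.sum_congr rfl fun i _ => ?_
  rw [Finset.sum_eq_single i]
  · rw [covariance_const_mul_left, covariance_const_mul_right,
      covariance_self (measurable_pi_apply i).aemeasurable,
      (measurePreserving_eval (fun i => gaussianReal 0 (v i)) i).variance_fun_comp
        (f := fun x => x) (by fun_prop), variance_fun_id_gaussianReal]
    ring
  · intro j _ hj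
    rw [covariance_const_mul_left, covariance_const_mul_right,
      (hI.indepFun hj.symm).covariance_eq_zero (hL i) (hL j)]
    simp
  · simp

/-- Uncorrelated linear forms of a Gaussian vector are independent. Zero variances are allowed, as
is needed for inputs of power 0. -/
theorem map_linear_pi_gaussianReal (v : ι → ℝ≥0) (α β : ι → ℝ) {A B : ℝ≥0}
    (hA : ∑ i, α i * α i * v i = A) (hB : ∑ i, β i * β i * v i = B)
    (hAB : ∑ i, α i * β i * v i = 0) :
    (Measure.pi fun i => gaussianReal 0 (v i)).map
      (fun x => (∑ i, α i * x i, ∑ i, β i * x i)) =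
      (gaussianReal 0 A).prod (gaussianReal 0 B) := by
  classical
  set Q := Measure.pi fun i => gaussianReal 0 (v i)
  have hL : ∀ i, HasGaussianLaw (fun x : ι → ℝ => x i) Q := fun i => by
    refine ⟨?_⟩
    have := (measurePreserving_eval (fun i => gaussianReal 0 (v i)) i).map_eq
    change IsGaussian (Q.map (Function.eval i))
    rw [this]
    infer_instance
  have hI := iIndepFun_pi (μ := fun i => gaussianReal 0 (v i)) (X := fun _ x => x)
    (fun _ => aemeasurable_id')
  have hG : HasGaussianLaw (fun x : ι → ℝ => x) Q := hI.hasGaussianLaw hL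
  have hlin : ∀ γ : ι → ℝ, ∃ L : (ι → ℝ) →L[ℝ] ℝ, ∀ x, L x = ∑ i, γ i * x i := fun γ =>
    ⟨∑ i, γ i • ContinuousLinearMap.proj i, fun x => by simp⟩
  have hmeas : ∀ γ : ι → ℝ, Measurable fun x : ι → ℝ => ∑ i, γ i * x i := fun γ => by fun_prop
  have hmarg : ∀ (γ : ι → ℝ) (C : ℝ≥0), ∑ i, γ i * γ i * v i = C →
      Q.map (fun x => ∑ i, γ i * x i) = gaussianReal 0 C := fun γ C hC => by
    obtain ⟨L, hLe⟩ := hlin γ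
    have h := (hG.map_fun L).map_eq_gaussianReal
    simp only [hLe] at h
    rw [h, ← covariance_self (hmeas γ).aemeasurable, covariance_linear_pi_gaussianReal, hC,
      Real.toNNReal_coe, integral_finsetSum _ fun i _ => ((hL i).integrable).const_mul _]
    congr 1
    refine Finset.sum_eq_zero fun i _ => ?_
    have e := (measurePreserving_eval (fun i => gaussianReal 0 (v i)) i).map_eq
    have e' := integral_map (μ := Q) (measurable_pi_apply i).aemeasurable
      (f := fun y : ℝ => y) (by fun_prop)
    rw [integral_const_mul]
    refine mul_eq_zero_of_right _ (e'.symm.trans ?_)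
    change ∫ y, y ∂(Q.map (Function.eval i)) = 0
    rw [e, integral_id_gaussianReal]
  obtain ⟨L₁, h₁⟩ := hlin α
  obtain ⟨L₂, h₂⟩ := hlin β
  have hp := hG.map_fun (L₁.prod L₂)
  simp only [ContinuousLinearMap.prod_apply, h₁, h₂] at hp
  have := hp.indepFun_of_covariance_eq_zero
    ((covariance_linear_pi_gaussianReal v α β).trans hAB)
  rw [(indepFun_iff_map_prod_eq_prod_map_map (hmeas α).aemeasurable (hmeas β).aemeasurable).1 this,
    hmarg α A hA, hmarg β B hB]

theorem lintegral_pi_fin_succ {n : ℕ} (P : Fin (n + 1) → Measure ℝ)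
    [∀ i, IsProbabilityMeasure (P i)] {F : (Fin (n + 1) → ℝ) → ℝ≥0∞} (hF : Measurable F) :
    ∫⁻ x, F x ∂Measure.pi P =
      ∫⁻ t, ∫⁻ x, F (Fin.cons t x) ∂(Measure.pi fun i : Fin n => P i.succ) ∂P 0 := by
  have h := (measurePreserving_piFinSuccAbove P 0).symm
  rw [← h.lintegral_comp hF, lintegral_prod _ (by fun_prop)]
  simp [MeasurableEquiv.piFinSuccAbove, Fin.insertNthEquiv]

end Gaussian

/-! ### The noise of the Gaussian channel -/

section Noise

theorem lintegral_pi_fin_two (P : Fin 2 → Measure ℝ) [∀ i, IsProbabilityMeasure (P i)]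
    {F : (Fin 2 → ℝ) → ℝ≥0∞} (hF : Measurable F) :
    ∫⁻ x, F x ∂Measure.pi P = ∫⁻ s, ∫⁻ t, F ![s, t] ∂P 1 ∂P 0 := by
  rw [lintegral_pi_fin_succ P hF]
  refine lintegral_congr fun s => ?_
  rw [lintegral_pi_fin_succ _ (by fun_prop)]
  refine lintegral_congr fun t => ?_
  rw [Measure.pi_of_empty, lintegral_dirac]
  rfl

theorem lintegral_pi_fin_four (P : Fin 4 → Measure ℝ) [∀ i, IsProbabilityMeasure (P i)]
    {F : (Fin 4 → ℝ) → ℝ≥0∞} (hF : Measurable F) :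
    ∫⁻ x, F x ∂Measure.pi P =
      ∫⁻ s, ∫⁻ t, ∫⁻ u, ∫⁻ w, F ![s, t, u, w] ∂P 3 ∂P 2 ∂P 1 ∂P 0 := by
  rw [lintegral_pi_fin_succ P hF]
  refine lintegral_congr fun s => ?_
  rw [lintegral_pi_fin_succ _ (by fun_prop)]
  refine lintegral_congr fun t => ?_
  rw [lintegral_pi_fin_two _ (by fun_prop)]
  rfl

/-- The standard Gaussian law of the plane is invariant under the orthogonal matrix with rows `(ρ,
s)`, `(s, -ρ)`. The result writes `Z₁` as `ρ Z₂` plus an independent term, the form needed for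
conditioning on `Y₂`. -/
theorem correlatedNoise_eq_map {ρ : ℝ} (hρ : ρ ∈ Set.Icc (-1 : ℝ) 1) :
    correlatedNoise ρ = ((gaussianReal 0 1).prod (gaussianReal 0 1)).map
      fun g => (ρ * g.1 + √(1 - ρ ^ 2) * g.2, g.1) := by
  set s := √(1 - ρ ^ 2)
  have hs : s ^ 2 = 1 - ρ ^ 2 := Real.sq_sqrt (by nlinarith [hρ.1, hρ.2])
  have hmap := map_linear_pi_gaussianReal (fun _ : Fin 2 => 1) ![ρ, s] ![s, -ρ] (A := 1) (B := 1)
    (by simp [Fin.sum_univ_two]; nlinarith) (by simp [Fin.sum_univ_two]; nlinarith)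
    (by simp [Fin.sum_univ_two]; ring)
  refine Measure.ext_of_lintegral _ fun F hF => ?_
  have e1 : Measurable fun x : Fin 2 → ℝ => F (ρ * x 0 + s * x 1, x 0) := by fun_prop
  have h := lintegral_pi_fin_two (fun _ => gaussianReal 0 1) e1
  rw [lintegral_map (μ := (gaussianReal 0 1).prod _) hF (by fun_prop),
    lintegral_prod _ (by fun_prop), correlatedNoise, ← hmap,
    Measure.map_map (by fun_prop) (by fun_prop), lintegral_map hF (by fun_prop)]
  refine Eq.trans (lintegral_congr fun x => ?_) h
  simp only [Function.comp_apply, Fin.sum_univ_two, Matrix.cons_val_zero, Matrix.cons_val_one]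
  congr 2
  linear_combination x 0 * hs

theorem correlatedNoise_map_fst (ρ : ℝ) :
    (correlatedNoise ρ).map Prod.fst = gaussianReal 0 1 := by
  rw [correlatedNoise, Measure.map_map (by fun_prop) (by fun_prop)]
  exact Measure.map_fst_prod.trans (by simp)

theorem correlatedNoise_map_snd {ρ : ℝ} (hρ : ρ ∈ Set.Icc (-1 : ℝ) 1) :
    (correlatedNoise ρ).map Prod.snd = gaussianReal 0 1 := by
  rw [correlatedNoise_eq_map hρ, Measure.map_map (by fun_prop) (by fun_prop)]
  exact Measure.map_fst_prod.trans (by simp)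

theorem integral_mul_correlatedNoise (ρ : ℝ) : ∫ z, z.1 * z.2 ∂correlatedNoise ρ = ρ := by
  have hi : Integrable (fun g : ℝ => g ^ 2) (gaussianReal 0 1) :=
    (memLp_id_gaussianReal' 2 (by simp)).integrable_sq
  have hi' : Integrable (fun g : ℝ => g) (gaussianReal 0 1) :=
    (memLp_id_gaussianReal' 2 (by simp)).integrable (by norm_num)
  have h2 : ∫ g, g ^ 2 ∂gaussianReal 0 1 = 1 := by
    have := variance_fun_id_gaussianReal (μ := 0) (v := 1)
    rw [variance_eq_integral (by fun_prop)] at this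
    simpa using this
  rw [correlatedNoise, integral_map (by fun_prop) (by fun_prop)]
  have e : (fun g : ℝ × ℝ => g.1 * (ρ * g.1 + √(1 - ρ ^ 2) * g.2)) =
      fun g => ρ * (g.1 ^ 2 * 1) + √(1 - ρ ^ 2) * (g.1 * g.2) := by
    ext g
    ring
  rw [e, integral_add ((hi.mul_prod (integrable_const (1 : ℝ))).const_mul _)
    ((hi'.mul_prod hi').const_mul _), integral_const_mul, integral_const_mul,
    integral_prod_mul (fun g => g ^ 2) (fun _ => (1 : ℝ)),
    integral_prod_mul (fun g => g) (fun g => g), h2]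
  simp

variable (a b : ℝ)

/-- The noise at the receiver. -/
def noise₁ (ω : (ℝ × ℝ) × ℝ × ℝ) : ℝ := ω.2.1 - (ω.1.1 + √b * ω.1.2)

/-- The noise at the eavesdropper. -/
def noise₂ (ω : (ℝ × ℝ) × ℝ × ℝ) : ℝ := ω.2.2 - (√a * ω.1.1 + ω.1.2)

@[fun_prop]
theorem measurable_noise₁ : Measurable (noise₁ b) := by
  unfold noise₁
  fun_prop

@[fun_prop]
theorem measurable_noise₂ : Measurable (noise₂ a) := by
  unfold noise₂
  fun_prop

theorem lintegral_additiveChannel (ν : Measure (ℝ × ℝ)) [IsProbabilityMeasure ν] (x : ℝ × ℝ)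
    {F : ℝ × ℝ → ℝ≥0∞} (hF : Measurable F) :
    ∫⁻ y, F y ∂additiveChannel a b ν x =
      ∫⁻ z, F (x.1 + √b * x.2 + z.1, √a * x.1 + x.2 + z.2) ∂ν := by
  rw [additiveChannel, Kernel.lintegral_map _ (by fun_prop) _ hF,
    Kernel.lintegral_id_prod (by fun_prop), Kernel.const_apply]

variable {a b} {ν : Measure (ℝ × ℝ)} [IsProbabilityMeasure ν]

theorem map_compProd_additiveChannel (p : Measure (ℝ × ℝ)) [IsProbabilityMeasure p] :
    (p ⊗ₘ additiveChannel a b ν).map (fun ω => (ω.1, noise₁ b ω, noise₂ a ω)) = p.prod ν := by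
  refine Measure.ext_of_lintegral _ fun F hF => ?_
  rw [lintegral_map hF (by fun_prop), Measure.lintegral_compProd (by fun_prop),
    lintegral_prod _ (by fun_prop)]
  refine lintegral_congr fun x => ?_
  rw [lintegral_additiveChannel _ _ _ _ (by fun_prop)]
  simp [noise₁, noise₂]

theorem sameMarginals_additiveChannel {ν' : Measure (ℝ × ℝ)} [IsProbabilityMeasure ν']
    (h₁ : ν.map Prod.fst = ν'.map Prod.fst) (h₂ : ν.map Prod.snd = ν'.map Prod.snd) :
    SameMarginals (additiveChannel a b ν) (additiveChannel a b ν') := by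
  constructor
  · ext1 x
    refine Measure.ext_of_lintegral _ fun F hF => ?_
    rw [Kernel.lintegral_fst _ _ hF, Kernel.lintegral_fst _ _ hF,
      lintegral_additiveChannel _ _ _ _ (by fun_prop),
      lintegral_additiveChannel _ _ _ _ (by fun_prop)]
    have h := congrArg (fun m => ∫⁻ z, F (x.1 + √b * x.2 + z) ∂m) h₁
    beta_reduce at h
    rwa [lintegral_map (by fun_prop) measurable_fst, lintegral_map (by fun_prop) measurable_fst]
      at h
  · ext1 x
    refine Measure.ext_of_lintegral _ fun F hF => ?_
    rw [Kernel.lintegral_snd _ _ hF, Kernel.lintegral_snd _ _ hF,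
      lintegral_additiveChannel _ _ _ _ (by fun_prop),
      lintegral_additiveChannel _ _ _ _ (by fun_prop)]
    have h := congrArg (fun m => ∫⁻ z, F (√a * x.1 + x.2 + z) ∂m) h₂
    beta_reduce at h
    rwa [lintegral_map (by fun_prop) measurable_snd, lintegral_map (by fun_prop) measurable_snd]
      at h

variable {K : Kernel (ℝ × ℝ) (ℝ × ℝ)} [IsMarkovKernel K]

/-- Only the first marginal of `K` is prescribed. Each noise by itself is independent of the inputs,
while the pair of noises may well depend on them. -/
theorem map_noise₁ (hK : K.fst = (additiveChannel a b ν).fst)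
    (p : Measure (ℝ × ℝ)) [IsProbabilityMeasure p] :
    (p ⊗ₘ K).map (fun ω => (ω.1, noise₁ b ω)) = p.prod (ν.map Prod.fst) := by
  refine Measure.ext_of_lintegral _ fun F hF => ?_
  rw [lintegral_map hF (by fun_prop), Measure.lintegral_compProd (by fun_prop),
    lintegral_prod _ (by fun_prop)]
  refine lintegral_congr fun x => ?_
  have h1 : Measurable fun y => F (x, y - (x.1 + √b * x.2)) := by fun_prop
  have h := Kernel.lintegral_fst K x h1
  rw [hK, Kernel.lintegral_fst _ _ h1, lintegral_additiveChannel _ _ _ _ (by fun_prop)] at h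
  rw [lintegral_map (by fun_prop) measurable_fst]
  refine h.symm.trans ?_
  simp

theorem map_noise₂ (hK : K.snd = (additiveChannel a b ν).snd)
    (p : Measure (ℝ × ℝ)) [IsProbabilityMeasure p] :
    (p ⊗ₘ K).map (fun ω => (ω.1, noise₂ a ω)) = p.prod (ν.map Prod.snd) := by
  refine Measure.ext_of_lintegral _ fun F hF => ?_
  rw [lintegral_map hF (by fun_prop), Measure.lintegral_compProd (by fun_prop),
    lintegral_prod _ (by fun_prop)]
  refine lintegral_congr fun x => ?_
  have h1 : Measurable fun y => F (x, y - (√a * x.1 + x.2)) := by fun_prop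
  have h := Kernel.lintegral_snd K x h1
  rw [hK, Kernel.lintegral_snd _ _ h1, lintegral_additiveChannel _ _ _ _ (by fun_prop)] at h
  rw [lintegral_map (by fun_prop) measurable_snd]
  refine h.symm.trans ?_
  simp

end Noise

/-! ### Second moments -/

section Moments

theorem integral_sq_sum {Ω ι : Type*} [MeasurableSpace Ω] [Fintype ι] {μ : Measure Ω}
    {T : ι → Ω → ℝ} (hT : ∀ i, MemLp (T i) 2 μ) (w : ι → ℝ) :
    ∫ ω, (∑ i, w i * T i ω) ^ 2 ∂μ = ∑ i, ∑ j, w i * w j * ∫ ω, T i ω * T j ω ∂μ := by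
  have hi : ∀ i j, Integrable (fun ω => w i * w j * (T i ω * T j ω)) μ := fun i j =>
    ((hT i).integrable_mul (hT j)).const_mul _
  have e : (fun ω => (∑ i, w i * T i ω) ^ 2) =
      fun ω => ∑ i, ∑ j, w i * w j * (T i ω * T j ω) := by
    ext ω
    rw [sq, Finset.sum_mul_sum]
    exact Finset.sum_congr rfl fun i _ => Finset.sum_congr rfl fun j _ => by ring
  rw [e, integral_finsetSum _ fun i _ => integrable_finsetSum _ fun j _ => hi i j]
  refine Finset.sum_congr rfl fun i _ => ?_
  rw [integral_finsetSum _ fun j _ => hi i j]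
  exact Finset.sum_congr rfl fun j _ => integral_const_mul _ _

theorem integral_sq_gaussianReal (v : ℝ≥0) : ∫ x, x ^ 2 ∂gaussianReal 0 v = v := by
  have := variance_fun_id_gaussianReal (μ := 0) (v := v)
  rw [variance_eq_integral (by fun_prop)] at this
  simpa using this

variable {a b : ℝ} {ν : Measure (ℝ × ℝ)} [IsProbabilityMeasure ν]
  {K : Kernel (ℝ × ℝ) (ℝ × ℝ)} [IsMarkovKernel K]
  {p₁ p₂ : Measure ℝ} [IsProbabilityMeasure p₁] [IsProbabilityMeasure p₂]

/-- Every cross term between an input and a noise vanishes by the marginal independence, so the only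
trace of the coupling in `K` is the mean product of the two noises. -/
theorem integral_sq_estimate (hK : SameMarginals K (additiveChannel a b ν))
    (hν₁ : ν.map Prod.fst = gaussianReal 0 1) (hν₂ : ν.map Prod.snd = gaussianReal 0 1)
    (hp₁ : MemLp (fun x => x) 2 p₁) (hp₂ : MemLp (fun x => x) 2 p₂) (α β c : ℝ) :
    Integrable (fun ω => (α * (ω.1.1 - ∫ x, x ∂p₁) + β * (ω.1.2 - ∫ x, x ∂p₂) + noise₁ b ω -
      c * noise₂ a ω) ^ 2) ((p₁.prod p₂) ⊗ₘ K) ∧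
    ∫ ω, (α * (ω.1.1 - ∫ x, x ∂p₁) + β * (ω.1.2 - ∫ x, x ∂p₂) + noise₁ b ω -
      c * noise₂ a ω) ^ 2 ∂((p₁.prod p₂) ⊗ₘ K) =
      α ^ 2 * Var[fun x => x; p₁] + β ^ 2 * Var[fun x => x; p₂] + 1 -
        2 * c * ∫ ω, noise₁ b ω * noise₂ a ω ∂((p₁.prod p₂) ⊗ₘ K) + c ^ 2 := by
  set p := p₁.prod p₂
  set μ := p ⊗ₘ K
  set m₁ := ∫ x, x ∂p₁
  set m₂ := ∫ x, x ∂p₂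
  have hn₁ : μ.map (fun ω => (ω.1, noise₁ b ω)) = p.prod (gaussianReal 0 1) :=
    hν₁ ▸ map_noise₁ hK.1 p
  have hn₂ : μ.map (fun ω => (ω.1, noise₂ a ω)) = p.prod (gaussianReal 0 1) :=
    hν₂ ▸ map_noise₂ hK.2 p
  have mp : MeasurePreserving (fun ω : (ℝ × ℝ) × ℝ × ℝ => ω.1) μ p :=
    ⟨measurable_fst, Measure.fst_compProd _ _⟩
  have mp₁ : MeasurePreserving (fun ω : (ℝ × ℝ) × ℝ × ℝ => ω.1.1) μ p₁ :=
    measurePreserving_fst.comp mp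
  have mp₂ : MeasurePreserving (fun ω : (ℝ × ℝ) × ℝ × ℝ => ω.1.2) μ p₂ :=
    measurePreserving_snd.comp mp
  have mq₁ : MeasurePreserving (noise₁ b) μ (gaussianReal 0 1) :=
    (measurePreserving_snd (μ := p)).comp
      (⟨by fun_prop, hn₁⟩ : MeasurePreserving (fun ω => (ω.1, noise₁ b ω)) μ _)
  have mq₂ : MeasurePreserving (noise₂ a) μ (gaussianReal 0 1) :=
    (measurePreserving_snd (μ := p)).comp
      (⟨by fun_prop, hn₂⟩ : MeasurePreserving (fun ω => (ω.1, noise₂ a ω)) μ _)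
  have hg : MemLp (fun x : ℝ => x) 2 (gaussianReal 0 1) := memLp_id_gaussianReal' 2 (by simp)
  have hc₁ : MemLp (fun x => x - m₁) 2 p₁ := hp₁.sub (memLp_const m₁)
  have hc₂ : MemLp (fun x => x - m₂) 2 p₂ := hp₂.sub (memLp_const m₂)
  have z₁ : ∫ x, (x - m₁) ∂p₁ = 0 := by
    rw [integral_sub (hp₁.integrable (by norm_num)) (integrable_const _)]
    simp [m₁]
  have z₂ : ∫ x, (x - m₂) ∂p₂ = 0 := by
    rw [integral_sub (hp₂.integrable (by norm_num)) (integrable_const _)]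
    simp [m₂]
  have lA : MemLp (fun ω : (ℝ × ℝ) × ℝ × ℝ => ω.1.1 - m₁) 2 μ := hc₁.comp_measurePreserving mp₁
  have lB : MemLp (fun ω : (ℝ × ℝ) × ℝ × ℝ => ω.1.2 - m₂) 2 μ := hc₂.comp_measurePreserving mp₂
  have lN₁ : MemLp (noise₁ b) 2 μ := hg.comp_measurePreserving mq₁
  have lN₂ : MemLp (noise₂ a) 2 μ := hg.comp_measurePreserving mq₂
  have sq : ∀ {T : (ℝ × ℝ) × ℝ × ℝ → ℝ} {Q : Measure ℝ}, MeasurePreserving T μ Q →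
      ∀ m, ∫ ω, (T ω - m) * (T ω - m) ∂μ = ∫ x, (x - m) ^ 2 ∂Q := fun {T Q} hT m => by
    rw [← hT.map_eq, integral_map hT.measurable.aemeasurable (by fun_prop)]
    simp only [pow_two]
  have vA : ∫ ω : (ℝ × ℝ) × ℝ × ℝ, (ω.1.1 - m₁) * (ω.1.1 - m₁) ∂μ = Var[fun x => x; p₁] := by
    rw [sq mp₁, variance_eq_integral (by fun_prop)]
  have vB : ∫ ω : (ℝ × ℝ) × ℝ × ℝ, (ω.1.2 - m₂) * (ω.1.2 - m₂) ∂μ = Var[fun x => x; p₂] := by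
    rw [sq mp₂, variance_eq_integral (by fun_prop)]
  have vN₁ : ∫ ω, noise₁ b ω * noise₁ b ω ∂μ = 1 := by
    simpa [integral_sq_gaussianReal] using sq mq₁ 0
  have vN₂ : ∫ ω, noise₂ a ω * noise₂ a ω ∂μ = 1 := by
    simpa [integral_sq_gaussianReal] using sq mq₂ 0
  have cAB : ∫ ω : (ℝ × ℝ) × ℝ × ℝ, (ω.1.1 - m₁) * (ω.1.2 - m₂) ∂μ = 0 := by
    have h := integral_map mp.measurable.aemeasurable (μ := μ)
      (f := fun x : ℝ × ℝ => (x.1 - m₁) * (x.2 - m₂)) (by fun_prop)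
    rw [mp.map_eq, integral_prod_mul (fun x => x - m₁) (fun x => x - m₂), z₁, zero_mul] at h
    exact h.symm
  have cN : ∀ {N : (ℝ × ℝ) × ℝ × ℝ → ℝ}, Measurable N →
      μ.map (fun ω => (ω.1, N ω)) = p.prod (gaussianReal 0 1) →
      ∀ s : ℝ × ℝ → ℝ, Measurable s → ∫ ω, s ω.1 * N ω ∂μ = 0 := fun {N} hN h s hs => by
    have h' := integral_map (μ := μ) (φ := fun ω => (ω.1, N ω)) (by fun_prop)
      (f := fun q : (ℝ × ℝ) × ℝ => s q.1 * q.2) (by fun_prop)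
    rw [h, integral_prod_mul s (fun x => x), integral_id_gaussianReal, mul_zero] at h'
    exact h'.symm
  have cA₁ := cN (measurable_noise₁ b) hn₁ (fun x => x.1 - m₁) (by fun_prop)
  have cB₁ := cN (measurable_noise₁ b) hn₁ (fun x => x.2 - m₂) (by fun_prop)
  have cA₂ := cN (measurable_noise₂ a) hn₂ (fun x => x.1 - m₁) (by fun_prop)
  have cB₂ := cN (measurable_noise₂ a) hn₂ (fun x => x.2 - m₂) (by fun_prop)
  constructor
  · exact ((((lA.const_mul α).add (lB.const_mul β)).add lN₁).sub (lN₂.const_mul c)).integrable_sq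
  · have h := integral_sq_sum (μ := μ) (T := ![fun ω => ω.1.1 - m₁, fun ω => ω.1.2 - m₂, noise₁ b,
      noise₂ a]) (by intro i; fin_cases i <;> assumption) ![α, β, 1, -c]
    have s1 : ∀ X Y : (ℝ × ℝ) × ℝ × ℝ → ℝ, ∫ ω, X ω * Y ω ∂μ = ∫ ω, Y ω * X ω ∂μ := fun X Y => by
      simp only [mul_comm]
    simp only [Fin.sum_univ_four, Matrix.cons_val] at h
    rw [s1 (fun ω => ω.1.2 - m₂) (fun ω => ω.1.1 - m₁), s1 (noise₁ b) (fun ω => ω.1.1 - m₁),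
      s1 (noise₁ b) (fun ω => ω.1.2 - m₂), s1 (noise₂ a) (fun ω => ω.1.1 - m₁),
      s1 (noise₂ a) (fun ω => ω.1.2 - m₂), s1 (noise₂ a) (noise₁ b), vA, vB, vN₁, vN₂, cAB, cA₁,
      cA₂, cB₁, cB₂] at h
    calc _ = ∫ ω : (ℝ × ℝ) × ℝ × ℝ, (α * (ω.1.1 - m₁) + β * (ω.1.2 - m₂) + 1 * noise₁ b ω +
        -c * noise₂ a ω) ^ 2 ∂μ := by
          refine integral_congr_ae (.of_forall fun ω => ?_)
          ring
      _ = _ := h.trans (by ring)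

theorem integral_noise_mul_noise :
    ∫ ω, noise₁ b ω * noise₂ a ω ∂((p₁.prod p₂) ⊗ₘ additiveChannel a b ν) = ∫ z, z.1 * z.2 ∂ν := by
  have h := map_compProd_additiveChannel (a := a) (b := b) (ν := ν) (p₁.prod p₂)
  have h' := congrArg (fun m : Measure ((ℝ × ℝ) × ℝ × ℝ) => m.map Prod.snd) h
  beta_reduce at h'
  rw [Measure.map_snd_prod, measure_univ, one_smul,
    Measure.map_map (by fun_prop) (by fun_prop)] at h'
  have h'' := integral_map (μ := (p₁.prod p₂) ⊗ₘ additiveChannel a b ν)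
    (φ := Prod.snd ∘ fun ω => (ω.1, noise₁ b ω, noise₂ a ω)) (by fun_prop)
    (f := fun z : ℝ × ℝ => z.1 * z.2) (by fun_prop)
  rw [h'] at h''
  exact h''.symm

theorem memLp_of_lintegral_sq_le {P : ℝ≥0}
    (h : ∫⁻ x, ENNReal.ofReal (x ^ 2) ∂p₁ ≤ P) : MemLp (fun x => x) 2 p₁ := by
  refine (memLp_two_iff_integrable_sq (by fun_prop)).2 ⟨by fun_prop, ?_⟩
  rw [hasFiniteIntegral_iff_ofReal (.of_forall fun x => sq_nonneg x)]
  exact h.trans_lt ENNReal.coe_lt_top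

theorem variance_le_of_lintegral_sq_le {P : ℝ≥0}
    (h : ∫⁻ x, ENNReal.ofReal (x ^ 2) ∂p₁ ≤ P) : Var[fun x => x; p₁] ≤ P := by
  refine (variance_le_expectation_sq (by fun_prop)).trans ?_
  have e : ENNReal.ofReal (∫ x, x ^ 2 ∂p₁) ≤ ENNReal.ofReal P := by
    rw [ofReal_integral_eq_lintegral_ofReal (memLp_of_lintegral_sq_le h).integrable_sq
      (.of_forall fun x => sq_nonneg x)]
    simpa using h
  exact (ENNReal.ofReal_le_ofReal_iff P.2).1 e

theorem lintegral_sq_gaussianReal (P : ℝ≥0) :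
    ∫⁻ x, ENNReal.ofReal (x ^ 2) ∂gaussianReal 0 P = P := by
  have hi : MemLp (fun x : ℝ => x) 2 (gaussianReal 0 P) := memLp_id_gaussianReal' 2 (by simp)
  rw [← ofReal_integral_eq_lintegral_ofReal hi.integrable_sq (.of_forall fun x => sq_nonneg x),
    integral_sq_gaussianReal]
  simp

end Moments

/-! ### The Gaussian channel: genie-aided information -/

section Genie

variable {a b : ℝ} {ν : Measure (ℝ × ℝ)} [IsProbabilityMeasure ν]
  {K : Kernel (ℝ × ℝ) (ℝ × ℝ)} [IsMarkovKernel K]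
  {p₁ p₂ : Measure ℝ} [IsProbabilityMeasure p₁] [IsProbabilityMeasure p₂]

theorem lintegral_output₂ (hK : K.snd = (additiveChannel a b ν).snd)
    (hν₂ : ν.map Prod.snd = gaussianReal 0 1) (p : Measure (ℝ × ℝ)) [IsProbabilityMeasure p]
    {H : ℝ × ℝ × ℝ → ℝ≥0∞} (hH : Measurable H) :
    ∫⁻ ω, H (ω.2.2, ω.1) ∂(p ⊗ₘ K) =
      ∫⁻ x, ∫⁻ z, H (√a * x.1 + x.2 + z, x) ∂gaussianReal 0 1 ∂p := by
  have h := congrArg (fun m => ∫⁻ q, H (√a * q.1.1 + q.1.2 + q.2, q.1) ∂m) (map_noise₂ hK p)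
  beta_reduce at h
  rw [lintegral_map (by fun_prop) (by fun_prop), hν₂, lintegral_prod _ (by fun_prop)] at h
  refine Eq.trans (lintegral_congr fun ω => ?_) h
  simp [noise₂]

/-- The conditional mean of `Y₁` given `(Y₂, X₁, X₂)` when the noises have covariance `ρ`. -/
def genieMean (a b ρ : ℝ) (q : ℝ × ℝ × ℝ) : ℝ :=
  q.2.1 + √b * q.2.2 + ρ * (q.1 - (√a * q.2.1 + q.2.2))

theorem measurable_genieMean (a b ρ : ℝ) : Measurable (genieMean a b ρ) := by
  unfold genieMean
  fun_prop

theorem map_genie_eq_compProd {ρ : ℝ} (hρ : ρ ∈ Set.Icc (-1 : ℝ) 1) {v : ℝ≥0}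
    (hv : (v : ℝ) = 1 - ρ ^ 2) (p : Measure (ℝ × ℝ)) [IsProbabilityMeasure p] :
    (p ⊗ₘ additiveChannel a b (correlatedNoise ρ)).map (fun ω => ((ω.2.2, ω.1), ω.2.1)) =
      (p ⊗ₘ additiveChannel a b (correlatedNoise ρ)).map (fun ω => (ω.2.2, ω.1)) ⊗ₘ
        gaussKernel (genieMean a b ρ) (measurable_genieMean a b ρ) v := by
  refine Measure.ext_of_lintegral _ fun F hF => ?_
  have hm := (Measurable.lintegral_kernel_prod_right'
    (κ := gaussKernel (genieMean a b ρ) (measurable_genieMean a b ρ) v) hF)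
  rw [lintegral_map hF (by fun_prop), Measure.lintegral_compProd hF,
    lintegral_map hm (by fun_prop), lintegral_output₂ (K := additiveChannel a b (correlatedNoise ρ))
      rfl (correlatedNoise_map_snd hρ) p hm, Measure.lintegral_compProd (by fun_prop)]
  refine lintegral_congr fun x => ?_
  rw [lintegral_additiveChannel _ _ _ _ (by fun_prop), correlatedNoise_eq_map hρ,
    lintegral_map (by fun_prop) (by fun_prop), lintegral_prod _ (by fun_prop)]
  refine lintegral_congr fun z => ?_
  rw [gaussKernel_apply, lintegral_gaussianReal (genieMean a b ρ _) _ (by fun_prop), hv]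
  refine lintegral_congr fun g => ?_
  congr 2
  simp only [genieMean]
  ring

theorem estimate_eq (c : ℝ) (ω : (ℝ × ℝ) × ℝ × ℝ) (m₁ m₂ : ℝ) :
    ω.2.1 - (c * ω.2.2 + ((1 - c * √a) * m₁ + (√b - c) * m₂)) =
      (1 - c * √a) * (ω.1.1 - m₁) + (√b - c) * (ω.1.2 - m₂) + noise₁ b ω - c * noise₂ a ω := by
  rw [noise₁, noise₂]
  ring

theorem sub_genieMean_eq (ρ : ℝ) (ω : (ℝ × ℝ) × ℝ × ℝ) (m₁ m₂ : ℝ) :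
    ω.2.1 - genieMean a b ρ (ω.2.2, ω.1) =
      0 * (ω.1.1 - m₁) + 0 * (ω.1.2 - m₂) + noise₁ b ω - ρ * noise₂ a ω := by
  rw [noise₁, noise₂, genieMean]
  ring

theorem genieInfo_correlatedNoise_le {P₁ P₂ : ℝ≥0} {ρ : ℝ} (ha : 0 ≤ a) (hb : 0 ≤ b)
    (hρ : ρ ∈ Set.Ioo (-1 : ℝ) 1) (h₁ : ∫⁻ x, ENNReal.ofReal (x ^ 2) ∂p₁ ≤ P₁)
    (h₂ : ∫⁻ x, ENNReal.ofReal (x ^ 2) ∂p₂ ≤ P₂) :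
    genieInfo (additiveChannel a b (correlatedNoise ρ)) p₁ p₂ ≤
      ENNReal.ofReal (f a b P₁ P₂ ρ) := by
  have hρ' := Set.Ioo_subset_Icc_self hρ
  have hv := one_sub_sq_pos hρ
  have hV : 0 < condVar a b P₁ P₂ ρ := condVar_pos P₁.coe_nonneg P₂.coe_nonneg hρ
  set c := gain a b P₁ P₂ ρ
  set m₁ := ∫ x, x ∂p₁
  set m₂ := ∫ x, x ∂p₂
  have hest := integral_sq_estimate (K := additiveChannel a b (correlatedNoise ρ)) ⟨rfl, rfl⟩
    (correlatedNoise_map_fst ρ) (correlatedNoise_map_snd hρ') (memLp_of_lintegral_sq_le h₁)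
    (memLp_of_lintegral_sq_le h₂)
  simp only [integral_noise_mul_noise, integral_mul_correlatedNoise] at hest
  obtain ⟨i₁, e₁⟩ := hest 0 0 ρ
  obtain ⟨i₂, e₂⟩ := hest (1 - c * √a) (√b - c) c
  simp only [← sub_genieMean_eq] at i₁ e₁
  simp only [← estimate_eq] at i₂ e₂
  rw [f_eq_condVar ha hb P₁.coe_nonneg P₂.coe_nonneg]
  refine condMutualInfo_le_of_gaussKernel (v := ⟨1 - ρ ^ 2, hv.le⟩) (V := ⟨_, hV.le⟩)
    -- The added constant is the mean of `Y₁ - c Y₂`; it lets variances, which are at most the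
    -- powers, replace second moments.
    (l := fun z => c * z + ((1 - c * √a) * m₁ + (√b - c) * m₂))
    (by fun_prop) (by fun_prop) (by fun_prop) (measurable_genieMean a b ρ) (by fun_prop)
    (fun h => hv.ne' (congrArg NNReal.toReal h)) (fun h => hV.ne' (congrArg NNReal.toReal h))
    (map_genie_eq_compProd hρ' rfl _) i₁ i₂ (e₁.trans ?_) (e₂.trans_le ?_)
  · change _ = 1 - ρ ^ 2
    ring
  · change _ ≤ condVar a b P₁ P₂ ρ
    rw [condVar, errVar]
    have hv₁ := variance_le_of_lintegral_sq_le h₁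
    have hv₂ := variance_le_of_lintegral_sq_le h₂
    have := mul_le_mul_of_nonneg_left hv₁ (sq_nonneg (1 - c * √a))
    have := mul_le_mul_of_nonneg_left hv₂ (sq_nonneg (√b - c))
    linarith

/-- For Gaussian inputs, `Y₂` and the innovation left after subtracting `c Y₂` from the virtual `Y₁`
are uncorrelated forms in four independent Gaussians, hence independent. The virtual `Y₁` is drawn
from the kernel of covariance `ρ`, so `K` enters only through its second marginal. -/
theorem map_genie_mixture {P₁ P₂ : ℝ≥0} {ρ : ℝ} {v V : ℝ≥0} (hv : (v : ℝ) = 1 - ρ ^ 2)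
    (hV : (V : ℝ) = condVar a b P₁ P₂ ρ) (ha : 0 ≤ a) (hb : 0 ≤ b)
    (hK : K.snd = (additiveChannel a b ν).snd) (hν₂ : ν.map Prod.snd = gaussianReal 0 1) :
    let μ := ((gaussianReal 0 P₁).prod (gaussianReal 0 P₂)) ⊗ₘ K
    (μ.map (fun ω => (ω.2.2, ω.1)) ⊗ₘ
        gaussKernel (genieMean a b ρ) (measurable_genieMean a b ρ) v).map
        (fun q => (q.1.1, q.2)) =
      μ.map (fun ω => ω.2.2) ⊗ₘ
        gaussKernel (fun z => gain a b P₁ P₂ ρ * z) (by fun_prop) V := by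
  intro μ
  set c := gain a b P₁ P₂ ρ
  have hD : 0 < 1 + a * P₁ + P₂ := by positivity
  have hsa := Real.sq_sqrt ha
  have hsb := Real.sq_sqrt hb
  have hc : c * (1 + a * P₁ + P₂) = ρ + √a * P₁ + √b * P₂ := div_mul_cancel₀ _ hD.ne'
  -- The coordinates are `X₁`, `X₂`, `Z₂` and the fresh noise of the kernel; the two forms are `Y₂`
  -- and the innovation.
  have hmap := map_linear_pi_gaussianReal ![P₁, P₂, 1, 1] ![√a, 1, 1, 0]
    ![1 - c * √a, √b - c, ρ - c, √v] (A := ⟨1 + a * P₁ + P₂, hD.le⟩) (B := V)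
    (by
      simp [Fin.sum_univ_four]
      change _ = 1 + a * P₁ + P₂
      linear_combination (P₁ : ℝ) * hsa)
    (by
      simp [Fin.sum_univ_four]
      rw [hv, hV, condVar, errVar]
      ring)
    (by
      simp [Fin.sum_univ_four]
      linear_combination -hc - c * (P₁ : ℝ) * hsa)
  have hΦ : ∀ {Φ : ℝ × ℝ → ℝ≥0∞}, Measurable Φ →
      ∫⁻ x₁, ∫⁻ x₂, ∫⁻ z, ∫⁻ g, Φ (√a * x₁ + x₂ + z,
        (1 - c * √a) * x₁ + (√b - c) * x₂ + (ρ - c) * z + √v * g)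
        ∂gaussianReal 0 1 ∂gaussianReal 0 1 ∂gaussianReal 0 P₂ ∂gaussianReal 0 P₁ =
      ∫⁻ u, ∫⁻ w, Φ (u, w) ∂gaussianReal 0 V ∂gaussianReal 0 ⟨1 + a * P₁ + P₂, hD.le⟩ :=
    fun {Φ} hΦ => by
      have h := congrArg (fun m => ∫⁻ q, Φ q ∂m) hmap
      beta_reduce at h
      rw [lintegral_map hΦ (by fun_prop), lintegral_pi_fin_four _ (by fun_prop),
        lintegral_prod _ (by fun_prop)] at h
      refine Eq.trans ?_ h
      simp [Fin.sum_univ_four]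
  refine Measure.ext_of_lintegral _ fun F hF => ?_
  have hm : Measurable fun q : ℝ × ℝ × ℝ => ∫⁻ y, F (q.1, y)
      ∂gaussKernel (genieMean a b ρ) (measurable_genieMean a b ρ) v q :=
    Measurable.lintegral_kernel_prod_right' (f := fun q : (ℝ × ℝ × ℝ) × ℝ => F (q.1.1, q.2))
      (by fun_prop)
  have hm' : Measurable fun z : ℝ => ∫⁻ y, F (z, y)
      ∂gaussKernel (fun z => c * z) (by fun_prop) V z := hF.lintegral_kernel_prod_right'
  have hout : ∀ {H : ℝ × ℝ × ℝ → ℝ≥0∞}, Measurable H → ∫⁻ ω, H (ω.2.2, ω.1) ∂μ =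
      ∫⁻ x₁, ∫⁻ x₂, ∫⁻ z, H (√a * x₁ + x₂ + z, x₁, x₂) ∂gaussianReal 0 1
        ∂gaussianReal 0 P₂ ∂gaussianReal 0 P₁ := fun {H} hH => by
    rw [lintegral_output₂ hK hν₂ _ hH, lintegral_prod _ (by fun_prop)]
  rw [lintegral_map hF (by fun_prop), Measure.lintegral_compProd (by fun_prop),
    lintegral_map hm (by fun_prop), hout hm, Measure.lintegral_compProd hF,
    lintegral_map hm' (by fun_prop)]
  refine Eq.trans ?_ (hout (hm'.comp measurable_fst)).symm
  calc _ = ∫⁻ u, ∫⁻ w, F (u, c * u + w) ∂gaussianReal 0 V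
        ∂gaussianReal 0 ⟨1 + a * P₁ + P₂, hD.le⟩ := by
        refine Eq.trans ?_ (hΦ (Φ := fun q => F (q.1, c * q.1 + q.2)) (by fun_prop))
        refine lintegral_congr fun x₁ => lintegral_congr fun x₂ => lintegral_congr fun z => ?_
        rw [gaussKernel_apply, lintegral_gaussianReal (genieMean a b ρ _) _ (by fun_prop)]
        refine lintegral_congr fun g => ?_
        congr 2
        simp only [genieMean]
        ring
    -- The integral over `w` is a dummy, inserted so that `hΦ` can be read backwards for a function
    -- of `u` alone.
    _ = ∫⁻ u, ∫⁻ w, (∫⁻ y, F (u, y) ∂gaussKernel (fun z => c * z) (by fun_prop) V u)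
        ∂gaussianReal 0 V ∂gaussianReal 0 ⟨1 + a * P₁ + P₂, hD.le⟩ := by
        refine lintegral_congr fun u => ?_
        rw [lintegral_const, measure_univ, mul_one, gaussKernel_apply,
          lintegral_gaussianReal (c * u) V (by fun_prop), lintegral_gaussianReal 0 V (by fun_prop)]
        simp
    _ = _ := by
        refine (hΦ (Φ := fun q => ∫⁻ y, F (q.1, y)
          ∂gaussKernel (fun z => c * z) (by fun_prop) V q.1)
          (hm'.comp measurable_fst)).symm.trans ?_
        simp

/-- The test function is made for covariance `ρ` but evaluated under `K`. Its mean is affine in the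
noise covariance of `K`, and the bracket multiplying the mismatch is, up to the unit of information,
the derivative of `f` in `ρ`. -/
theorem le_genieInfo_gaussianReal {P₁ P₂ : ℝ≥0} {ρ : ℝ} (ha : 0 ≤ a) (hb : 0 ≤ b)
    (hρ : ρ ∈ Set.Ioo (-1 : ℝ) 1) (hK : SameMarginals K (additiveChannel a b ν))
    (hν₁ : ν.map Prod.fst = gaussianReal 0 1) (hν₂ : ν.map Prod.snd = gaussianReal 0 1) :
    ENNReal.ofReal (f a b P₁ P₂ ρ - (ρ - ∫ ω, noise₁ b ω * noise₂ a ω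
        ∂(((gaussianReal 0 P₁).prod (gaussianReal 0 P₂)) ⊗ₘ K)) *
        (ρ / (1 - ρ ^ 2) - gain a b P₁ P₂ ρ / condVar a b P₁ P₂ ρ) / Real.log 2) ≤
      genieInfo K (gaussianReal 0 P₁) (gaussianReal 0 P₂) := by
  have hv := one_sub_sq_pos hρ
  have hV : 0 < condVar a b P₁ P₂ ρ := condVar_pos P₁.coe_nonneg P₂.coe_nonneg hρ
  set c := gain a b P₁ P₂ ρ with hc
  set r := ∫ ω, noise₁ b ω * noise₂ a ω ∂(((gaussianReal 0 P₁).prod (gaussianReal 0 P₂)) ⊗ₘ K)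
  have hest := integral_sq_estimate hK hν₁ hν₂
    (memLp_of_lintegral_sq_le (lintegral_sq_gaussianReal P₁).le)
    (memLp_of_lintegral_sq_le (lintegral_sq_gaussianReal P₂).le)
  simp only [variance_fun_id_gaussianReal] at hest
  obtain ⟨i₁, e₁⟩ := hest 0 0 ρ
  obtain ⟨i₂, e₂⟩ := hest (1 - c * √a) (√b - c) c
  simp only [← sub_genieMean_eq] at i₁ e₁
  simp only [← estimate_eq, integral_id_gaussianReal, mul_zero, add_zero] at i₂ e₂
  have h := le_condMutualInfo_of_gaussKernel
    (μ := ((gaussianReal 0 P₁).prod (gaussianReal 0 P₂)) ⊗ₘ K)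
    (X := fun ω => ω.1) (Y := fun ω => ω.2.1) (Z := fun ω => ω.2.2)
    (v := ⟨1 - ρ ^ 2, hv.le⟩) (V := ⟨_, hV.le⟩) (l := fun z => c * z)
    (by fun_prop) (by fun_prop) (by fun_prop) (measurable_genieMean a b ρ) (by fun_prop)
    (fun h => hv.ne' (congrArg NNReal.toReal h)) (fun h => hV.ne' (congrArg NNReal.toReal h))
    (map_genie_mixture rfl rfl ha hb hK.2 hν₂) i₁ i₂
  refine (ENNReal.ofReal_le_ofReal (le_of_eq ?_)).trans h
  rw [e₁, e₂, f_eq_condVar ha hb P₁.coe_nonneg P₂.coe_nonneg]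
  have e : (1 - c * √a) ^ 2 * P₁ + (√b - c) ^ 2 * P₂ + 1 - 2 * c * r + c ^ 2 =
      condVar a b P₁ P₂ ρ + 2 * c * (ρ - r) := by
    rw [condVar, errVar]
    ring
  rw [e]
  change _ = (1 / 2 * Real.log (condVar a b P₁ P₂ ρ / (1 - ρ ^ 2)) - _ / (2 * (1 - ρ ^ 2)) +
    _ / (2 * condVar a b P₁ P₂ ρ)) / Real.log 2
  have hlog : 0 < Real.log 2 := Real.log_pos one_lt_two
  rw [Real.logb]
  have e1 : (0 ^ 2 * (P₁ : ℝ) + 0 ^ 2 * P₂ + 1 - 2 * ρ * r + ρ ^ 2) / (2 * (1 - ρ ^ 2)) =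
      1 / 2 + (ρ - r) * (ρ / (1 - ρ ^ 2)) := by
    field_simp
    ring
  have e2 : (condVar a b P₁ P₂ ρ + 2 * c * (ρ - r)) / (2 * condVar a b P₁ P₂ ρ) =
      1 / 2 + (ρ - r) * (c / condVar a b P₁ P₂ ρ) := by
    field_simp
  rw [e1, e2]
  ring

theorem genieInfo_correlatedNoise {P₁ P₂ : ℝ≥0} {ρ : ℝ} (ha : 0 ≤ a) (hb : 0 ≤ b)
    (hρ : ρ ∈ Set.Ioo (-1 : ℝ) 1) :
    genieInfo (additiveChannel a b (correlatedNoise ρ)) (gaussianReal 0 P₁) (gaussianReal 0 P₂) =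
      ENNReal.ofReal (f a b P₁ P₂ ρ) := by
  refine (genieInfo_correlatedNoise_le ha hb hρ (lintegral_sq_gaussianReal P₁).le
    (lintegral_sq_gaussianReal P₂).le).antisymm ?_
  refine le_of_eq_of_le ?_ (le_genieInfo_gaussianReal ha hb hρ ⟨rfl, rfl⟩
    (correlatedNoise_map_fst ρ) (correlatedNoise_map_snd (Set.Ioo_subset_Icc_self hρ)))
  rw [integral_noise_mul_noise, integral_mul_correlatedNoise]
  simp

theorem maxGenieInfo_correlatedNoise {P₁ P₂ : ℝ≥0} {ρ : ℝ} (ha : 0 ≤ a) (hb : 0 ≤ b)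
    (hρ : ρ ∈ Set.Ioo (-1 : ℝ) 1) :
    maxGenieInfo (additiveChannel a b (correlatedNoise ρ)) (.power P₁) (.power P₂) =
      ENNReal.ofReal (f a b P₁ P₂ ρ) := by
  refine le_antisymm ?_ ?_
  · exact iSup_le fun p₁ => iSup_le fun p₂ => iSup_le fun _ => iSup_le fun _ => iSup_le fun h₁ =>
      iSup_le fun h₂ => genieInfo_correlatedNoise_le ha hb hρ h₁ h₂
  · rw [← genieInfo_correlatedNoise ha hb hρ]
    exact genieInfo_le_maxGenieInfo _ _ _ (lintegral_sq_gaussianReal P₁).le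
      (lintegral_sq_gaussianReal P₂).le

/-- The saddle-point half of the minimax: by stationarity at an interior `ρ*`, Gaussian inputs yield
`f(ρ*)` against every admissible `K`. At `ρ* = 1` the bound is 0. -/
theorem f_rhoStar_le_maxGenieInfo {P₁ P₂ : ℝ≥0} (ha : 0 ≤ a) (hb : 0 ≤ b)
    (hK : SameMarginals K (additiveChannel a b ν))
    (hν₁ : ν.map Prod.fst = gaussianReal 0 1) (hν₂ : ν.map Prod.snd = gaussianReal 0 1) :
    ENNReal.ofReal (f a b P₁ P₂ (rhoStar a b P₁ P₂)) ≤
      maxGenieInfo K (.power P₁) (.power P₂) := by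
  rcases rhoStar_mem_Ioo_or ha hb P₁.coe_nonneg P₂.coe_nonneg with h | h
  · refine le_trans (le_of_eq_of_le ?_ (le_genieInfo_gaussianReal ha hb h hK hν₁ hν₂))
      (genieInfo_le_maxGenieInfo _ _ _ (lintegral_sq_gaussianReal P₁).le
        (lintegral_sq_gaussianReal P₂).le)
    rw [rhoStar_stationary ha hb P₁.coe_nonneg P₂.coe_nonneg h]
    simp
  · rw [f_rhoStar_of_eq_one h.1]
    simp

end Genie

/-! ### The Gaussian channel: direct information -/

section Direct

variable {a b : ℝ} {ν : Measure (ℝ × ℝ)} [IsProbabilityMeasure ν]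
  {p₁ p₂ : Measure ℝ} [IsProbabilityMeasure p₁] [IsProbabilityMeasure p₂]

theorem lintegral_output₁ (hν₁ : ν.map Prod.fst = gaussianReal 0 1) (p : Measure (ℝ × ℝ))
    [IsProbabilityMeasure p] {H : ℝ × ℝ × ℝ → ℝ≥0∞} (hH : Measurable H) :
    ∫⁻ ω, H (ω.2.1, ω.1) ∂(p ⊗ₘ additiveChannel a b ν) =
      ∫⁻ x, ∫⁻ z, H (x.1 + √b * x.2 + z, x) ∂gaussianReal 0 1 ∂p := by
  have h := congrArg (fun m => ∫⁻ q, H (q.1.1 + √b * q.1.2 + q.2, q.1) ∂m)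
    (map_noise₁ (K := additiveChannel a b ν) rfl p)
  beta_reduce at h
  rw [lintegral_map (by fun_prop) (by fun_prop), hν₁, lintegral_prod _ (by fun_prop)] at h
  refine Eq.trans (lintegral_congr fun ω => ?_) h
  simp [noise₁]

theorem lintegral_input {α β : Type*} [MeasurableSpace α] [MeasurableSpace β] (p : Measure α)
    [IsProbabilityMeasure p] (K : Kernel α β) [IsMarkovKernel K] {H : α → ℝ≥0∞}
    (hH : Measurable H) : ∫⁻ ω, H ω.1 ∂(p ⊗ₘ K) = ∫⁻ x, H x ∂p := by
  rw [Measure.lintegral_compProd (by fun_prop)]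
  simp

/-- The conditional mean of `Y₁` given `(X₂, X₁)`. -/
def directMean (b : ℝ) (q : ℝ × ℝ) : ℝ := q.2 + √b * q.1

theorem measurable_directMean (b : ℝ) : Measurable (directMean b) := by
  unfold directMean
  fun_prop

theorem map_direct_eq_compProd (hν₁ : ν.map Prod.fst = gaussianReal 0 1) (p : Measure (ℝ × ℝ))
    [IsProbabilityMeasure p] :
    (p ⊗ₘ additiveChannel a b ν).map (fun ω => ((ω.1.2, ω.1.1), ω.2.1)) =
      (p ⊗ₘ additiveChannel a b ν).map (fun ω => (ω.1.2, ω.1.1)) ⊗ₘ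
        gaussKernel (directMean b) (measurable_directMean b) 1 := by
  refine Measure.ext_of_lintegral _ fun F hF => ?_
  have hm := (Measurable.lintegral_kernel_prod_right'
    (κ := gaussKernel (directMean b) (measurable_directMean b) 1) hF)
  rw [lintegral_map hF (by fun_prop), Measure.lintegral_compProd hF,
    lintegral_map hm (by fun_prop), lintegral_output₁ hν₁ p
      (H := fun q => F ((q.2.2, q.2.1), q.1)) (by fun_prop)]
  refine Eq.trans ?_ (lintegral_input p _ (hm.comp (measurable_snd.prodMk measurable_fst))).symm
  refine lintegral_congr fun x => ?_
  rw [Function.comp_apply, gaussKernel_apply,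
    lintegral_gaussianReal (directMean b _) _ (by fun_prop)]
  simp [directMean]

theorem directInfo_additiveChannel_le {P₁ P₂ : ℝ≥0} (hν₁ : ν.map Prod.fst = gaussianReal 0 1)
    (hν₂ : ν.map Prod.snd = gaussianReal 0 1) (h₁ : ∫⁻ x, ENNReal.ofReal (x ^ 2) ∂p₁ ≤ P₁)
    (h₂ : ∫⁻ x, ENNReal.ofReal (x ^ 2) ∂p₂ ≤ P₂) :
    directInfo (additiveChannel a b ν) p₁ p₂ ≤
      ENNReal.ofReal (1 / 2 * Real.logb 2 (1 + P₁)) := by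
  set m₁ := ∫ x, x ∂p₁
  have hest := integral_sq_estimate (K := additiveChannel a b ν) ⟨rfl, rfl⟩ hν₁ hν₂
    (memLp_of_lintegral_sq_le h₁) (memLp_of_lintegral_sq_le h₂)
  obtain ⟨i₁, e₁⟩ := hest 0 0 0
  obtain ⟨i₂, e₂⟩ := hest 1 0 0
  have t₁ : ∀ ω : (ℝ × ℝ) × ℝ × ℝ, 0 * (ω.1.1 - ∫ x, x ∂p₁) + 0 * (ω.1.2 - ∫ x, x ∂p₂) +
      noise₁ b ω - 0 * noise₂ a ω = ω.2.1 - directMean b (ω.1.2, ω.1.1) := fun ω => by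
    rw [noise₁, directMean]
    ring
  have t₂ : ∀ ω : (ℝ × ℝ) × ℝ × ℝ, 1 * (ω.1.1 - ∫ x, x ∂p₁) + 0 * (ω.1.2 - ∫ x, x ∂p₂) +
      noise₁ b ω - 0 * noise₂ a ω = ω.2.1 - (√b * ω.1.2 + m₁) := fun ω => by
    rw [noise₁]
    ring
  simp only [t₁] at i₁ e₁
  simp only [t₂] at i₂ e₂
  have h := condMutualInfo_le_of_gaussKernel (μ := (p₁.prod p₂) ⊗ₘ additiveChannel a b ν)
    (X := fun ω => ω.1.1) (Y := fun ω => ω.2.1) (Z := fun ω => ω.1.2)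
    (v := 1) (V := 1 + P₁) (l := fun z => √b * z + m₁)
    (by fun_prop) (by fun_prop) (by fun_prop) (measurable_directMean b) (by fun_prop)
    one_ne_zero (by positivity) (map_direct_eq_compProd hν₁ _) i₁ i₂
    (e₁.trans (by simp)) (e₂.trans_le ?_)
  · simpa [directInfo] using h
  · have hv₁ := variance_le_of_lintegral_sq_le h₁
    push_cast
    linarith

theorem map_direct_mixture {P₁ P₂ : ℝ≥0} (hν₁ : ν.map Prod.fst = gaussianReal 0 1) :
    let μ := ((gaussianReal 0 P₁).prod (gaussianReal 0 P₂)) ⊗ₘ additiveChannel a b ν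
    (μ.map (fun ω => (ω.1.2, ω.1.1)) ⊗ₘ
        gaussKernel (directMean b) (measurable_directMean b) 1).map (fun q => (q.1.1, q.2)) =
      μ.map (fun ω => ω.1.2) ⊗ₘ gaussKernel (fun z => √b * z) (by fun_prop) (P₁ + 1) := by
  intro μ
  rw [← map_direct_eq_compProd hν₁, Measure.map_map (by fun_prop) (by fun_prop)]
  refine Measure.ext_of_lintegral _ fun F hF => ?_
  have hm' : Measurable fun z : ℝ => ∫⁻ y, F (z, y)
      ∂gaussKernel (fun z => √b * z) (by fun_prop) (P₁ + 1) z := hF.lintegral_kernel_prod_right'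
  rw [lintegral_map hF (by fun_prop), Measure.lintegral_compProd hF,
    lintegral_map hm' (by fun_prop)]
  refine (lintegral_output₁ hν₁ _ (H := fun q => F (q.2.2, q.1)) (by fun_prop)).trans ?_
  refine Eq.trans ?_ (lintegral_input _ _ (hm'.comp measurable_snd)).symm
  rw [lintegral_prod_symm _ (by fun_prop),
    lintegral_prod_symm _ (hm'.comp measurable_snd).aemeasurable]
  refine lintegral_congr fun x₂ => ?_
  have hc : gaussianReal 0 (P₁ + 1) = gaussianReal 0 P₁ ∗ gaussianReal 0 1 := by
    rw [gaussianReal_conv_gaussianReal, add_zero]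
  have hs : ∫⁻ y, F (x₂, y) ∂gaussianReal (√b * x₂) (P₁ + 1) =
      ∫⁻ w, F (x₂, √b * x₂ + w) ∂gaussianReal 0 (P₁ + 1) := by
    rw [lintegral_gaussianReal (√b * x₂) _ (by fun_prop),
      lintegral_gaussianReal 0 (P₁ + 1) (by fun_prop)]
    simp
  simp only [Function.comp_apply, lintegral_const, measure_univ, mul_one, gaussKernel_apply]
  rw [hs, hc, Measure.lintegral_conv (by fun_prop)]
  refine lintegral_congr fun x₁ => lintegral_congr fun z => ?_
  congr 2
  ring

theorem le_directInfo_gaussianReal {P₁ P₂ : ℝ≥0} (hν₁ : ν.map Prod.fst = gaussianReal 0 1)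
    (hν₂ : ν.map Prod.snd = gaussianReal 0 1) :
    ENNReal.ofReal (1 / 2 * Real.logb 2 (1 + P₁)) ≤
      directInfo (additiveChannel a b ν) (gaussianReal 0 P₁) (gaussianReal 0 P₂) := by
  have hest := integral_sq_estimate (K := additiveChannel a b ν) ⟨rfl, rfl⟩ hν₁ hν₂
    (memLp_of_lintegral_sq_le (lintegral_sq_gaussianReal P₁).le)
    (memLp_of_lintegral_sq_le (lintegral_sq_gaussianReal P₂).le)
  simp only [variance_fun_id_gaussianReal, integral_id_gaussianReal] at hest
  obtain ⟨i₁, e₁⟩ := hest 0 0 0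
  obtain ⟨i₂, e₂⟩ := hest 1 0 0
  have t₁ : ∀ ω : (ℝ × ℝ) × ℝ × ℝ, 0 * (ω.1.1 - 0) + 0 * (ω.1.2 - 0) +
      noise₁ b ω - 0 * noise₂ a ω = ω.2.1 - directMean b (ω.1.2, ω.1.1) := fun ω => by
    rw [noise₁, directMean]
    ring
  have t₂ : ∀ ω : (ℝ × ℝ) × ℝ × ℝ, 1 * (ω.1.1 - 0) + 0 * (ω.1.2 - 0) +
      noise₁ b ω - 0 * noise₂ a ω = ω.2.1 - √b * ω.1.2 := fun ω => by
    rw [noise₁]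
    ring
  simp only [t₁] at i₁ e₁
  simp only [t₂] at i₂ e₂
  have h := le_condMutualInfo_of_gaussKernel
    (μ := ((gaussianReal 0 P₁).prod (gaussianReal 0 P₂)) ⊗ₘ additiveChannel a b ν)
    (X := fun ω => ω.1.1) (Y := fun ω => ω.2.1) (Z := fun ω => ω.1.2)
    (v := 1) (V := P₁ + 1) (l := fun z => √b * z)
    (by fun_prop) (by fun_prop) (by fun_prop) (measurable_directMean b) (by fun_prop)
    one_ne_zero (by positivity) (map_direct_mixture hν₁) i₁ i₂
  refine (ENNReal.ofReal_le_ofReal (le_of_eq ?_)).trans h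
  have hP : (0 : ℝ) < P₁ + 1 := by positivity
  rw [e₁, e₂, Real.logb, add_comm 1 (P₁ : ℝ)]
  push_cast
  field_simp
  ring

end Direct

/-! ### Fully correlated noises -/

section Degenerate

/-- With `Kernel.id` as the kernel replacing the law of `Y` given `Z`, the reference law is the true
one. -/
theorem condMutualInfo_eq_zero_of_ae_eq {Ω α β : Type*} [MeasurableSpace Ω]
    [MeasurableSpace α] [StandardBorelSpace α] [Nonempty α]
    [MeasurableSpace β] [StandardBorelSpace β] [Nonempty β] {X : Ω → α} {Y Z : Ω → β}
    {μ : Measure Ω} [IsProbabilityMeasure μ] (hX : Measurable X) (hY : Measurable Y)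
    (hZ : Measurable Z) (h : ∀ᵐ ω ∂μ, Y ω = Z ω) : condMutualInfo X Y Z μ = 0 := by
  have : IsProbabilityMeasure (μ.map Z) := Measure.isProbabilityMeasure_map hZ.aemeasurable
  have hd : (μ.map fun ω => (Z ω, X ω, Y ω)) =
      μ.map Z ⊗ₘ (condDistrib X Z μ ×ₖ Kernel.id) := by
    refine Measure.ext_of_lintegral _ fun F hF => ?_
    rw [lintegral_compProd_condDistrib_prod hX hZ _ _ hF,
      lintegral_map hF (hZ.prodMk (hX.prodMk hY))]
    refine lintegral_congr_ae ?_
    filter_upwards [h] with ω hω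
    rw [Kernel.id_apply, lintegral_dirac' _ (by fun_prop), hω]
  have hle := condMutualInfo_mul_le (μ := μ) hX hY hZ Kernel.id
  rw [← hd, InformationTheory.klDiv_self, nonpos_iff_eq_zero, mul_eq_zero] at hle
  exact hle.resolve_right (by simpa using Real.log_pos one_lt_two)

theorem ae_mul_eq_zero_of_lintegral_sq_le {p : Measure ℝ} {P : ℝ≥0} {c : ℝ}
    (h : ∫⁻ x, ENNReal.ofReal (x ^ 2) ∂p ≤ P) (hc : c ^ 2 * P = 0) : ∀ᵐ x ∂p, c * x = 0 := by
  rcases mul_eq_zero.1 hc with h0 | h0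
  · exact .of_forall fun x => by simp [pow_eq_zero_iff two_ne_zero |>.1 h0]
  · rw [NNReal.coe_eq_zero.1 h0, ENNReal.coe_zero, nonpos_iff_eq_zero,
      lintegral_eq_zero_iff (by fun_prop)] at h
    filter_upwards [h] with x hx
    have : x ^ 2 ≤ 0 := ENNReal.ofReal_eq_zero.1 hx
    simp [pow_eq_zero_iff two_ne_zero |>.1 (this.antisymm (sq_nonneg x))]

/-- All three nonnegative terms of `discrLeft` vanish, so `(√a - 1)X₁ = 0` and `(√b - 1)X₂ = 0`
almost surely for admissible inputs. As also `Z₁ = Z₂`, the two outputs coincide. -/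
theorem maxGenieInfo_correlatedNoise_one {a b : ℝ} {P₁ P₂ : ℝ≥0}
    (h : discrLeft a b P₁ P₂ = 0) :
    maxGenieInfo (additiveChannel a b (correlatedNoise 1)) (.power P₁) (.power P₂) = 0 := by
  have d₁ : 0 ≤ (√a - 1) ^ 2 * (P₁ : ℝ) := by positivity
  have d₂ : 0 ≤ (√b - 1) ^ 2 * (P₂ : ℝ) := by positivity
  have d₃ : 0 ≤ (√(a * b) - 1) ^ 2 * (P₁ : ℝ) * P₂ := by positivity
  rw [discrLeft] at h
  refine nonpos_iff_eq_zero.1 (iSup_le fun p₁ => iSup_le fun p₂ => iSup_le fun _ => iSup_le fun _ =>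
    iSup_le fun h₁ => iSup_le fun h₂ => le_of_eq ?_)
  set μ := (p₁.prod p₂) ⊗ₘ additiveChannel a b (correlatedNoise 1)
  have mp : MeasurePreserving (fun ω : (ℝ × ℝ) × ℝ × ℝ => ω.1) μ (p₁.prod p₂) :=
    ⟨measurable_fst, Measure.fst_compProd _ _⟩
  have mq : MeasurePreserving (fun ω => (noise₁ b ω, noise₂ a ω)) μ (correlatedNoise 1) :=
    (measurePreserving_snd (μ := p₁.prod p₂)).comp
      (⟨by fun_prop, map_compProd_additiveChannel _⟩ :
        MeasurePreserving (fun ω => (ω.1, noise₁ b ω, noise₂ a ω)) μ _)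
  have e₁ := (measurePreserving_fst.comp mp).quasiMeasurePreserving.ae
    (ae_mul_eq_zero_of_lintegral_sq_le (c := √a - 1) h₁ (by linarith))
  have e₂ := (measurePreserving_snd.comp mp).quasiMeasurePreserving.ae
    (ae_mul_eq_zero_of_lintegral_sq_le (c := √b - 1) h₂ (by linarith))
  have e₃ : ∀ᵐ z ∂correlatedNoise 1, z.1 = z.2 := by
    rw [correlatedNoise, ae_map_iff (by fun_prop)
      (measurableSet_eq_fun measurable_fst measurable_snd)]
    exact .of_forall fun g => by simp
  refine condMutualInfo_eq_zero_of_ae_eq (by fun_prop) (by fun_prop) (by fun_prop) ?_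
  filter_upwards [e₁, e₂, mq.quasiMeasurePreserving.ae e₃] with ω h₁ h₂ h₃
  simp only [Function.comp_apply, noise₁, noise₂] at h₁ h₂ h₃
  linear_combination h₃ - h₁ + h₂

end Degenerate

/-! ### The bound for the Gaussian channel -/

section Bound

variable {a b : ℝ} {ν : Measure (ℝ × ℝ)} [IsProbabilityMeasure ν]
  {K : Kernel (ℝ × ℝ) (ℝ × ℝ)} [IsMarkovKernel K] {P₁ P₂ : ℝ≥0}

theorem exists_power_le {n : ℕ} (p : Fin n → Measure ℝ) {P : ℝ≥0}
    (h : ∑ k, ∫⁻ x, ENNReal.ofReal (x ^ 2) ∂(p k) ≤ n * P) :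
    ∃ q : Fin n → ℝ≥0, (∀ k, ∫⁻ x, ENNReal.ofReal (x ^ 2) ∂(p k) ≤ q k) ∧
      ∑ k, (q k : ℝ) ≤ n * P := by
  have hfin : ∑ k, ∫⁻ x, ENNReal.ofReal (x ^ 2) ∂(p k) ≠ ∞ :=
    ne_top_of_le_ne_top (ENNReal.mul_ne_top (by simp) (by simp)) h
  have hk := fun k => ENNReal.sum_ne_top.1 hfin k (Finset.mem_univ k)
  refine ⟨fun k => (∫⁻ x, ENNReal.ofReal (x ^ 2) ∂(p k)).toNNReal, fun k => ?_, ?_⟩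
  · rw [ENNReal.coe_toNNReal (hk k)]
  · have := ENNReal.toReal_mono (ENNReal.mul_ne_top (by simp) (by simp)) h
    rw [ENNReal.toReal_sum fun k _ => hk k, ENNReal.toReal_mul] at this
    simpa [ENNReal.coe_toNNReal_eq_toReal] using this

theorem Code.exists_powers {M n : ℕ} [NeZero M] (C : Code ℝ ℝ ℝ M n)
    (hC : C.Admissible K (.power P₁) (.power P₂)) :
    ∃ q₁ q₂ : Fin n → ℝ≥0, (∀ k, ∫⁻ x, ENNReal.ofReal (x ^ 2) ∂(C.letter₁ k) ≤ q₁ k) ∧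
      (∀ k, ∫⁻ x, ENNReal.ofReal (x ^ 2) ∂(C.letter₂ k) ≤ q₂ k) ∧
      ∑ k, (q₁ k : ℝ) ≤ n * P₁ ∧ ∑ k, (q₂ k : ℝ) ≤ n * P₂ := by
  obtain ⟨h₁, h₂⟩ := hC
  have hm : Measurable fun x : ℝ => ENNReal.ofReal (x ^ 2) := by fun_prop
  simp only [InputConstraint.power] at h₁ h₂
  simp only [C.lintegral_letter₁ K hm] at h₁
  simp only [C.lintegral_letter₂ K hm] at h₂
  obtain ⟨q₁, hq₁, s₁⟩ := exists_power_le _ h₁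
  obtain ⟨q₂, hq₂, s₂⟩ := exists_power_le _ h₂
  exact ⟨q₁, q₂, hq₁, hq₂, s₁, s₂⟩

theorem sum_ofReal_f_le (ha : 0 ≤ a) (hb : 0 ≤ b) {ρ : ℝ} (hρ : ρ ∈ Set.Ioo (-1 : ℝ) 1) {n : ℕ}
    {q₁ q₂ : Fin n → ℝ≥0} (s₁ : ∑ k, (q₁ k : ℝ) ≤ n * P₁) (s₂ : ∑ k, (q₂ k : ℝ) ≤ n * P₂) :
    ∑ k, ENNReal.ofReal (f a b (q₁ k) (q₂ k) ρ) ≤ n * ENNReal.ofReal (f a b P₁ P₂ ρ) := by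
  rw [← ENNReal.ofReal_sum_of_nonneg fun k _ =>
      f_nonneg ha hb (q₁ k).coe_nonneg (q₂ k).coe_nonneg hρ,
    ← ENNReal.ofReal_natCast, ← ENNReal.ofReal_mul (by positivity)]
  exact ENNReal.ofReal_le_ofReal (sum_f_le ha hb (fun k => (q₁ k).coe_nonneg)
    (fun k => (q₂ k).coe_nonneg) P₁.coe_nonneg P₂.coe_nonneg s₁ s₂ hρ)

theorem f_zero_gains (P₁ P₂ : ℝ≥0) : f 0 0 P₁ P₂ 0 = 1 / 2 * Real.logb 2 (1 + P₁) := by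
  have h : (1 + P₂ : ℝ) ≠ 0 := by positivity
  simp [f, mul_div_cancel_right₀ _ h]

theorem sum_directInfo_le (hν₁ : ν.map Prod.fst = gaussianReal 0 1)
    (hν₂ : ν.map Prod.snd = gaussianReal 0 1) {M n : ℕ} [NeZero M] (C : Code ℝ ℝ ℝ M n)
    (hC : C.Admissible K (.power P₁) (.power P₂)) :
    ∑ k, directInfo (additiveChannel a b ν) (C.letter₁ k) (C.letter₂ k) ≤
      n * ENNReal.ofReal (1 / 2 * Real.logb 2 (1 + P₁)) := by
  obtain ⟨q₁, q₂, h₁, h₂, s₁, s₂⟩ := C.exists_powers hC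
  refine (Finset.sum_le_sum fun k _ => directInfo_additiveChannel_le hν₁ hν₂ (h₁ k) (h₂ k)).trans ?_
  -- With zero gains and `ρ = 0`, `f` is the point-to-point capacity formula, so the same averaging
  -- over powers applies.
  have h := sum_ofReal_f_le le_rfl le_rfl (ρ := 0) (by simp) s₁ s₂
  simpa only [f_zero_gains] using h

theorem sum_genieInfo_le (ha : 0 ≤ a) (hb : 0 ≤ b) {ρ : ℝ} (hρ : ρ ∈ Set.Ioo (-1 : ℝ) 1)
    {M n : ℕ} [NeZero M] (C : Code ℝ ℝ ℝ M n) (hC : C.Admissible K (.power P₁) (.power P₂)) :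
    ∑ k, genieInfo (additiveChannel a b (correlatedNoise ρ)) (C.letter₁ k) (C.letter₂ k) ≤
      n * ENNReal.ofReal (f a b P₁ P₂ ρ) := by
  obtain ⟨q₁, q₂, h₁, h₂, s₁, s₂⟩ := C.exists_powers hC
  exact (Finset.sum_le_sum fun k _ => genieInfo_correlatedNoise_le ha hb hρ (h₁ k) (h₂ k)).trans
    (sum_ofReal_f_le ha hb hρ s₁ s₂)

theorem sameMarginals_correlatedNoise {ρ : ℝ} (hρ : ρ ∈ Set.Icc (-1 : ℝ) 1)
    (hν₁ : ν.map Prod.fst = gaussianReal 0 1) (hν₂ : ν.map Prod.snd = gaussianReal 0 1) :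
    SameMarginals (additiveChannel a b (correlatedNoise ρ)) (additiveChannel a b ν) :=
  sameMarginals_additiveChannel ((correlatedNoise_map_fst ρ).trans hν₁.symm)
    ((correlatedNoise_map_snd hρ).trans hν₂.symm)

theorem rhoStar_mem_Icc_neg_one (ha : 0 ≤ a) (hb : 0 ≤ b) (P₁ P₂ : ℝ≥0) :
    rhoStar a b P₁ P₂ ∈ Set.Icc (-1 : ℝ) 1 :=
  Set.Icc_subset_Icc_left (by norm_num) (rhoStar_mem_Icc ha hb P₁.coe_nonneg P₂.coe_nonneg)

theorem le_ofReal_f_rhoStar (ha : 0 ≤ a) (hb : 0 ≤ b) {c : ℝ≥0∞}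
    (h : ∀ ρ ∈ Set.Ioo (-1 : ℝ) 1, c ≤ ENNReal.ofReal (f a b P₁ P₂ ρ)) :
    c ≤ ENNReal.ofReal (f a b P₁ P₂ (rhoStar a b P₁ P₂)) := by
  refine ENNReal.le_of_forall_pos_le_add fun ε hε _ => ?_
  obtain ⟨ρ, hρ, hle⟩ := exists_f_le ha hb P₁.coe_nonneg P₂.coe_nonneg (NNReal.coe_pos.2 hε)
  calc c ≤ ENNReal.ofReal (f a b P₁ P₂ ρ) := h ρ hρ
    _ ≤ ENNReal.ofReal (f a b P₁ P₂ (rhoStar a b P₁ P₂) + ε) := ENNReal.ofReal_le_ofReal hle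
    _ ≤ _ := ENNReal.ofReal_add_le.trans (by simp)

theorem maxGenieInfo_rhoStar (ha : 0 ≤ a) (hb : 0 ≤ b) :
    maxGenieInfo (additiveChannel a b (correlatedNoise (rhoStar a b P₁ P₂)))
      (.power P₁) (.power P₂) = ENNReal.ofReal (f a b P₁ P₂ (rhoStar a b P₁ P₂)) := by
  rcases rhoStar_mem_Ioo_or ha hb P₁.coe_nonneg P₂.coe_nonneg with h | ⟨h, h'⟩
  · exact maxGenieInfo_correlatedNoise ha hb h
  · rw [f_rhoStar_of_eq_one h, ENNReal.ofReal_zero]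
    simp only [h]
    exact maxGenieInfo_correlatedNoise_one h'

theorem satoBound_additiveChannel (ha : 0 ≤ a) (hb : 0 ≤ b)
    (hν₁ : ν.map Prod.fst = gaussianReal 0 1) (hν₂ : ν.map Prod.snd = gaussianReal 0 1) :
    satoBound (additiveChannel a b ν) (.power P₁) (.power P₂) =
      ENNReal.ofReal (f a b P₁ P₂ (rhoStar a b P₁ P₂)) := by
  refine le_antisymm ?_ (le_iInf fun K' => le_iInf fun _ => le_iInf fun hK' =>
    f_rhoStar_le_maxGenieInfo ha hb hK' hν₁ hν₂)
  rw [← maxGenieInfo_rhoStar ha hb]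
  exact iInf_le_of_le _ (iInf_le_of_le inferInstance (iInf_le_of_le
    (sameMarginals_correlatedNoise (rhoStar_mem_Icc_neg_one ha hb P₁ P₂) hν₁ hν₂) le_rfl))

theorem secrecyCapacity_additiveChannel_le (ha : 0 ≤ a) (hb : 0 ≤ b)
    (hν₁ : ν.map Prod.fst = gaussianReal 0 1) (hν₂ : ν.map Prod.snd = gaussianReal 0 1) :
    secrecyCapacity (additiveChannel a b ν) (.power P₁) (.power P₂) ≤
      min (satoBound (additiveChannel a b ν) (.power P₁) (.power P₂))
        (maxDirectInfo (additiveChannel a b ν) (.power P₁) (.power P₂)) := by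
  refine le_min ?_ ?_
  -- Block-averaged powers are handled by `sum_f_le`, which is specific to Gaussian noises. The
  -- bound is therefore proved for each `ρ` in the open interval and passed to `ρ*`, with
  -- `satoBound` replaced by its value.
  · rw [satoBound_additiveChannel ha hb hν₁ hν₂]
    refine le_ofReal_f_rhoStar ha hb fun ρ hρ => ?_
    exact secrecyCapacity_le_of_genieInfo_le ENNReal.ofReal_ne_top
      (fun M n _ C hC => sum_directInfo_le hν₁ hν₂ C hC)
      (additiveChannel a b (correlatedNoise ρ))
      (sameMarginals_correlatedNoise (Set.Ioo_subset_Icc_self hρ) hν₁ hν₂)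
      fun M n _ C hC => sum_genieInfo_le ha hb hρ C hC
  · refine (secrecyCapacity_le_of_directInfo_le
      fun M n _ C hC => sum_directInfo_le hν₁ hν₂ C hC).trans ?_
    exact (le_directInfo_gaussianReal (P₂ := P₂) hν₁ hν₂).trans (directInfo_le_maxDirectInfo _ _ _
      (lintegral_sq_gaussianReal P₁).le (lintegral_sq_gaussianReal P₂).le)

/-- Monotonicity in the powers puts the inner supremum at full power for every `ρ`. The infimum is
then a limit rather than a value when `ρ* = 1`. -/
theorem iInf_iSup_ofReal_f (ha : 0 ≤ a) (hb : 0 ≤ b) (Q₁ Q₂ : ℝ≥0) :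
    ⨅ ρ ∈ Set.Ioo (-1 : ℝ) 1, ⨆ (P₁ : ℝ≥0) (_ : P₁ ≤ Q₁) (P₂ : ℝ≥0) (_ : P₂ ≤ Q₂),
      ENNReal.ofReal (f a b P₁ P₂ ρ) = ENNReal.ofReal (f a b Q₁ Q₂ (rhoStar a b Q₁ Q₂)) := by
  have h : ∀ ρ ∈ Set.Ioo (-1 : ℝ) 1, ⨆ (P₁ : ℝ≥0) (_ : P₁ ≤ Q₁) (P₂ : ℝ≥0) (_ : P₂ ≤ Q₂),
      ENNReal.ofReal (f a b P₁ P₂ ρ) = ENNReal.ofReal (f a b Q₁ Q₂ ρ) := fun ρ hρ => by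
    refine le_antisymm (iSup₂_le fun P₁ h₁ => iSup₂_le fun P₂ h₂ => ENNReal.ofReal_le_ofReal
      (f_mono ha hb P₁.coe_nonneg P₂.coe_nonneg (NNReal.coe_le_coe.2 h₁)
        (NNReal.coe_le_coe.2 h₂) hρ)) ?_
    exact le_iSup₂_of_le Q₁ le_rfl (le_iSup₂_of_le Q₂ le_rfl le_rfl)
  rw [iInf_congr fun ρ => iInf_congr (h ρ)]
  refine le_antisymm (le_ofReal_f_rhoStar ha hb fun ρ hρ => iInf₂_le ρ hρ) ?_
  exact le_iInf₂ fun ρ hρ => ENNReal.ofReal_le_ofReal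
    (f_rhoStar_le ha hb Q₁.coe_nonneg Q₂.coe_nonneg hρ)

end Bound

end WTCHI

end

theorem theorem3 :
    -- the bound for a general memoryless channel
    (∀ (𝒳₁ 𝒳₂ 𝒴₁ 𝒴₂ : Type*)
      [MeasurableSpace 𝒳₁] [MeasurableSpace 𝒳₂] [MeasurableSpace 𝒴₁] [MeasurableSpace 𝒴₂]
      [StandardBorelSpace 𝒳₁] [StandardBorelSpace 𝒳₂] [StandardBorelSpace 𝒴₁]
      [StandardBorelSpace 𝒴₂] [Nonempty 𝒳₁] [Nonempty 𝒳₂] [Nonempty 𝒴₁] [Nonempty 𝒴₂]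
      (K : Kernel (𝒳₁ × 𝒳₂) (𝒴₁ × 𝒴₂)) [IsMarkovKernel K],
      WTCHI.maxDirectInfo K (.none 𝒳₁) (.none 𝒳₂) ≠ ∞ →
      WTCHI.secrecyCapacity K (.none 𝒳₁) (.none 𝒳₂) ≤
        min (WTCHI.satoBound K (.none 𝒳₁) (.none 𝒳₂))
          (WTCHI.maxDirectInfo K (.none 𝒳₁) (.none 𝒳₂))) ∧
    -- the Gaussian channel with gains `a`, `b` and any joint law `ν` of the two unit-variance noises
    (∀ (a b : ℝ), 0 ≤ a → 0 ≤ b →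
      -- the evaluation of the conditional mutual information for noise covariance `ρ`
      (∀ P₁ P₂ : ℝ≥0, ∀ ρ ∈ Set.Ioo (-1 : ℝ) 1,
        WTCHI.genieInfo (WTCHI.additiveChannel a b (WTCHI.correlatedNoise ρ))
            (gaussianReal 0 P₁) (gaussianReal 0 P₂) = ENNReal.ofReal (WTCHI.f a b P₁ P₂ ρ) ∧
        WTCHI.maxGenieInfo (WTCHI.additiveChannel a b (WTCHI.correlatedNoise ρ))
            (.power P₁) (.power P₂) = ENNReal.ofReal (WTCHI.f a b P₁ P₂ ρ)) ∧
      -- `ρ*` minimizes `f`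
      (∀ P₁ P₂ : ℝ≥0, WTCHI.rhoStar a b P₁ P₂ ∈ Set.Icc (-1 : ℝ) 1 ∧
        ∀ ρ ∈ Set.Ioo (-1 : ℝ) 1,
          WTCHI.f a b P₁ P₂ (WTCHI.rhoStar a b P₁ P₂) ≤ WTCHI.f a b P₁ P₂ ρ) ∧
      ∀ (Pbar₁ Pbar₂ : ℝ≥0) (ν : Measure (ℝ × ℝ)) [IsProbabilityMeasure ν],
        ν.map Prod.fst = gaussianReal 0 1 → ν.map Prod.snd = gaussianReal 0 1 →
        -- the bound
        WTCHI.secrecyCapacity (WTCHI.additiveChannel a b ν) (.power Pbar₁) (.power Pbar₂) ≤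
          min (WTCHI.satoBound (WTCHI.additiveChannel a b ν) (.power Pbar₁) (.power Pbar₂))
            (WTCHI.maxDirectInfo (WTCHI.additiveChannel a b ν) (.power Pbar₁) (.power Pbar₂)) ∧
        -- the value of `R_u`, which is attained by Gaussian noises with covariance `ρ*`
        WTCHI.satoBound (WTCHI.additiveChannel a b ν) (.power Pbar₁) (.power Pbar₂) =
          ENNReal.ofReal (WTCHI.f a b Pbar₁ Pbar₂ (WTCHI.rhoStar a b Pbar₁ Pbar₂)) ∧
        WTCHI.SameMarginals
          (WTCHI.additiveChannel a b (WTCHI.correlatedNoise (WTCHI.rhoStar a b Pbar₁ Pbar₂)))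
          (WTCHI.additiveChannel a b ν) ∧
        WTCHI.maxGenieInfo
            (WTCHI.additiveChannel a b (WTCHI.correlatedNoise (WTCHI.rhoStar a b Pbar₁ Pbar₂)))
            (.power Pbar₁) (.power Pbar₂) =
          ENNReal.ofReal (WTCHI.f a b Pbar₁ Pbar₂ (WTCHI.rhoStar a b Pbar₁ Pbar₂)) ∧
        -- the minimax formula for `R_u`
        ⨅ ρ ∈ Set.Ioo (-1 : ℝ) 1, ⨆ (P₁ : ℝ≥0) (_ : P₁ ≤ Pbar₁) (P₂ : ℝ≥0) (_ : P₂ ≤ Pbar₂),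
            ENNReal.ofReal (WTCHI.f a b P₁ P₂ ρ) =
          ENNReal.ofReal (WTCHI.f a b Pbar₁ Pbar₂ (WTCHI.rhoStar a b Pbar₁ Pbar₂))) := by
  refine ⟨fun 𝒳₁ 𝒳₂ 𝒴₁ 𝒴₂ _ _ _ _ _ _ _ _ _ _ _ _ K _ hK =>
    WTCHI.secrecyCapacity_le_of_none K hK, fun a b ha hb => ⟨fun P₁ P₂ ρ hρ =>
      ⟨WTCHI.genieInfo_correlatedNoise ha hb hρ, WTCHI.maxGenieInfo_correlatedNoise ha hb hρ⟩,
      fun P₁ P₂ => ⟨WTCHI.rhoStar_mem_Icc_neg_one ha hb P₁ P₂, fun ρ hρ =>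
        WTCHI.f_rhoStar_le ha hb P₁.coe_nonneg P₂.coe_nonneg hρ⟩,
      fun Q₁ Q₂ ν _ hν₁ hν₂ => ⟨WTCHI.secrecyCapacity_additiveChannel_le ha hb hν₁ hν₂,
        WTCHI.satoBound_additiveChannel ha hb hν₁ hν₂,
        WTCHI.sameMarginals_correlatedNoise (WTCHI.rhoStar_mem_Icc_neg_one ha hb Q₁ Q₂) hν₁ hν₂,
        WTCHI.maxGenieInfo_rhoStar ha hb, WTCHI.iInf_iSup_ofReal_f ha hb Q₁ Q₂⟩⟩⟩
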